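/- Let $F$ be a field of characteristic $\neq 2$ that is either finite (with the discrete topology), or $\mathbb R$, or $\mathbb C$, or a non-archimedean local field, and let $\psi\colon F\to\mathbb C^\times$ be a non-trivial continuous unitary additive character. Let $V$ be a finite-dimensional symplectic vector space over $F$, with form $\langle-,-\rangle$, let $Sp(V)$ be its symplectic group and $\mathrm{Gr}(V)$ the set of its Lagrangian subspaces. Let $\overline V$ be $V$ with the form $-\langle -,-\rangle$. *Weil index.* For a nondegenerate symmetric bilinear form $q$ on a finite-dimensional space $A$, $\gamma(q)\in\mathbb C^\times$ is the number with $(f_q\,dq)^\wedge=\gamma(q)\,f_{-q^*}$ as generalized functions on $A^*$, where $f_q(x)=\psi(\tfrac12 q(x,x))$, $dq$ is the self-dual measure on $A$ and $q^*$ is the dual form. It depends only on the class of $q$ in the Witt group $W(F)$. For a degenerate symmetric form, $\gamma$ is that of its nondegenerate quotient. For $a\in F^\times$, $\gamma(a)$ is the Weil index of the form $(x,y)\mapsto axy$ on $F$. *Maslov index.* For Lagrangian subspaces $\ell_1,\dots,\ell_n$ of a symplectic space $U$, $\tau(\ell_1,\dots,\ell_n)\in W(F)$ is the class of the nondegenerate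 quotient of the symmetric form $(v,w)\mapsto\sum_{i>j}\langle v_i,w_j\rangle$ on $\{(v_i)\in\ell_1\oplus\dots\oplus\ell_n : \sum_i v_i=0\}$. *Metaplectic group.* For $g\in Sp(V)$ and $\ell\in\mathrm{Gr}(V)$ put $$m_g(\ell)=\gamma(1)^{\frac12\dim V-\dim(g\ell\cap\ell)-1}\,\gamma(O_{g\ell,\ell}),$$ where $O_{g\ell,\ell}\in F^\times/(F^\times)^2$ is defined as follows: orient $\ell$ by any non-zero $o\in\det\ell$ and $g\ell$ by $g\,o$; choose bases $(e,u)$ of $g\ell$ and $(e,w)$ of $\ell$ that extend a common basis $e$ of $g\ell\cap\ell$, and let $\lambda,\lambda'\in F^\times$ be such that the wedge products of these two bases are $\lambda\, g\,o$ and $\lambda' o$; then $O_{g\ell,\ell}=\lambda\lambda'\det(\langle u_i,w_j\rangle)_{i,j}$ modulo squares. $Mp(V)$ consists of all pairs $(g,t)$ with $g\in Sp(V)$ and $t\colon\mathrm{Gr}(V)\to\mathbb C$ such that, for all $\ell,\ell'\in\mathrm{Gr}(V)$, $$t(\ell)^2=m_g(\ell)^2,\qquad t(\ell')=\gamma(\tau(\ell,g\ell,g\ell',\ell'))\,t(\ell).$$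 The product is $(g,s)(h,t)=(gh,\ \ell\mapsto s(\ell)t(\ell)\gamma(\tau(\ell,g\ell,gh\ell)))$. The topology is the group topology for which $(g,t)\mapsto g$ is a local homeomorphism onto $Sp(V)$ and each function $(g,t)\mapsto t(\ell)$ is locally constant over each set $\{g:\dim(g\ell\cap\ell)=n\}$. Equivalently, it is the coarsest topology for which $(g,t)\mapsto g$ is continuous and, for all $\ell,\ell'\in\mathrm{Gr}(V)$ and $z\in\mathbb C$, the set $\{(g,t): g\ell\cap\ell'=0,\ t(\ell)\gamma(\tau(\ell,g\ell,\ell'))=z\}$ is open. Let $Mp(V)''=\{(g,t)\in Mp(V):\det(g-1)\neq0\}$. *Statement.* For $\ell\in\mathrm{Gr}(V)$ and $(g,t)\in Mp(V)$ define $$\Theta_\ell(g,t)=t(\ell)\cdot\gamma\bigl(\tau(\Gamma_g,\Gamma_1,\ell\oplus\ell)\bigr),$$ where $\Gamma_g=\{(x,gx):x\in V\}$, $\Gamma_1$ and $\ell\oplus\ell$ are regarded as Lagrangian subspaces of $\overline V\oplus V$. Then: 1. $\Theta_\ell(g,t)=\Theta_{\ell'}(g,t)$ for all $\ell,\ell'\in\mathrm{Gr}(V)$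 and all $(g,t)\in Mp(V)$; 2. for every $\ell\in\mathrm{Gr}(V)$, the restriction of $\Theta_\ell$ to $Mp(V)''$ is locally constant. -/

import Mathlib

open MeasureTheory
open scoped SchwartzMap

noncomputable section

namespace Metaplectic

/-- The class of topological fields under consideration: finite (discrete) fields, the real
numbers, the complex numbers, and non-archimedean local fields. -/
def IsLocalOrFinite (F : Type*) [Field F] [TopologicalSpace F] : Prop :=
  (Finite F ∧ DiscreteTopology F) ∨
  (∃ e : F ≃+* ℝ, IsHomeomorph e) ∨
  (∃ e : F ≃+* ℂ, IsHomeomorph e) ∨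
  (∃ _ : ValuativeRel F, IsNonarchimedeanLocalField F)

/-! ### The Weil index of a quadratic space -/

section WeilIndex

/-- The form `(x, y) ↦ a x y` on the line `F`. -/
def lineForm {F : Type*} [Field F] (a : F) : LinearMap.BilinForm F F := a • LinearMap.mul F F

lemma lineForm_isSymm {F : Type*} [Field F] (a : F) : (lineForm a).IsSymm :=
  ⟨fun x y => by simp [lineForm, mul_comm]⟩

/-- Schwartz-Bruhat functions on a finite-dimensional vector space `A` over a field as above.
If the field is finite or non-archimedean these are the locally constant functions of compact
support; if it is archimedean, they are the usual Schwartz functions on the underlying real vector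
space. -/
def IsSchwartzBruhat {A : Type*} [AddCommGroup A] [TopologicalSpace A] (φ : A → ℂ) : Prop :=
  (IsLocallyConstant φ ∧ HasCompactSupport φ) ∨
  ∃ (n : ℕ) (e : A ≃ₜ+ EuclideanSpace ℝ (Fin n)) (f : 𝓢(EuclideanSpace ℝ (Fin n), ℂ)),
    φ = fun x => f (e x)

variable {F : Type*} [Field F] [TopologicalSpace F] (ψ : AddChar F Circle)
variable {A : Type*} [AddCommGroup A] [Module F A]

/-- The function `x ↦ ψ (q(x,x)/2)`. -/
def quadChar (q : LinearMap.BilinForm F A) (x : A) : ℂ := (ψ ((2 : F)⁻¹ * q x x) : ℂ)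

/-- The Fourier transform of `φ dμ`, with `A` identified with its dual through `q`. -/
def fourier [MeasurableSpace A] (q : LinearMap.BilinForm F A) (μ : Measure A)
    (φ : A → ℂ) (x : A) : ℂ :=
  ∫ y, φ y * (ψ (q x y) : ℂ) ∂μ

/-- `μ` is the Haar measure on `A` which is self-dual with respect to `ψ (q(x,y))`. -/
def IsSelfDual [TopologicalSpace A] [MeasurableSpace A] (q : LinearMap.BilinForm F A)
    (μ : Measure A) : Prop :=
  μ.IsAddHaarMeasure ∧ ∀ φ : A → ℂ, IsSchwartzBruhat φ →
    ∀ x, fourier ψ q μ (fourier ψ q μ φ) x = φ (-x)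

/-- For a (nondegenerate) quadratic space `(A, q)` with self-dual measure `dq`, the number `c`
satisfies `(f_q dq)^ = c · f_{-q*}` as generalized functions on `A*`, where
`f_q(x) = ψ (q(x,x)/2)`. The isomorphism `x ↦ q(x, -)` is used to identify `A*` with `A`; it
carries the dual form `q*` to `q`. A generalized function is given by its values on
Schwartz-Bruhat densities `φ dq`. -/
def IsWeilIndex [TopologicalSpace A] [MeasurableSpace A] (q : LinearMap.BilinForm F A)
    (c : ℂ) : Prop :=
  ∃ μ : Measure A, IsSelfDual ψ q μ ∧ ∀ φ : A → ℂ, IsSchwartzBruhat φ →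
    ∫ x, quadChar ψ q x * fourier ψ q μ φ x ∂μ = c * ∫ x, quadChar ψ (-q) x * φ x ∂μ

/-- The nondegenerate form induced by a symmetric bilinear form `q` on `A / ker q`. -/
def nondegQuotient (q : LinearMap.BilinForm F A) (hq : q.IsSymm) :
    LinearMap.BilinForm F (A ⧸ LinearMap.ker q) :=
  LinearMap.liftQ₂ (LinearMap.ker q) (LinearMap.ker q) q le_rfl (by
    intro x hx
    rw [LinearMap.mem_ker] at hx ⊢
    ext y
    rw [LinearMap.flip_apply, hq.eq y x, hx])

/-- The Weil index `γ(q)` of (the nondegenerate quotient of) a symmetric bilinear form on a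
finite-dimensional space, which carries its canonical topology. -/
def weilIndex (q : LinearMap.BilinForm F A) (hq : q.IsSymm) : ℂ :=
  letI : TopologicalSpace (A ⧸ LinearMap.ker q) := moduleTopology F _
  letI : MeasurableSpace (A ⧸ LinearMap.ker q) := borel _
  Classical.epsilon (IsWeilIndex ψ (nondegQuotient q hq))

/-- `γ(a)`, the Weil index of the one-dimensional form `a x ^ 2`. -/
def weilIndexLine (a : F) : ℂ := weilIndex ψ (lineForm a) (lineForm_isSymm a)

end WeilIndex

/-! ### Symplectic spaces and Lagrangians -/

/-- A symplectic form on `V`. -/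
structure SymplecticForm (F V : Type*) [Field F] [AddCommGroup V] [Module F V] where
  form : LinearMap.BilinForm F V
  alt : form.IsAlt
  nondeg : form.Nondegenerate

section Symplectic

variable {F : Type*} [Field F] {V : Type*} [AddCommGroup V] [Module F V]

/-- The set `Gr(V)` of Lagrangian subspaces: those which equal their own orthogonal. -/
def Gr (ω : SymplecticForm F V) : Type _ :=
  {ℓ : Submodule F V // ω.form.orthogonal ℓ = ℓ}

lemma Gr.isotropic {ω : SymplecticForm F V} (ℓ : Gr ω) {x y : V} (hx : x ∈ ℓ.1) (hy : y ∈ ℓ.1) :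
    ω.form x y = 0 := by
  rw [← ℓ.2] at hy
  exact hy x hx

/-- The symplectic group `Sp(V)`. -/
def Sp (ω : SymplecticForm F V) : Subgroup (V ≃ₗ[F] V) where
  carrier := {g | ∀ x y, ω.form (g x) (g y) = ω.form x y}
  mul_mem' := by
    intro g h hg hh x y
    rw [LinearEquiv.mul_apply, LinearEquiv.mul_apply, hg, hh]
  one_mem' := fun _ _ => rfl
  inv_mem' := by
    intro g hg x y
    have h := hg (g⁻¹ x) (g⁻¹ y)
    rw [← LinearEquiv.mul_apply, ← LinearEquiv.mul_apply, mul_inv_cancel] at h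
    exact h.symm

/-- The topology of `Sp(V)` as a subset of the finite-dimensional space `End(V)`. -/
instance [TopologicalSpace F] (ω : SymplecticForm F V) : TopologicalSpace (Sp ω) :=
  TopologicalSpace.induced (fun g => (g.1 : V →ₗ[F] V)) (moduleTopology F (V →ₗ[F] V))

/-- The action of `Sp(V)` on `Gr(V)`. -/
def Gr.map {ω : SymplecticForm F V} (g : Sp ω) (ℓ : Gr ω) : Gr ω :=
  ⟨ℓ.1.map (g.1 : V →ₗ[F] V), by
    ext x
    constructor
    · intro hx
      refine ⟨g.1.symm x, ?_, by simp⟩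
      have : g.1.symm x ∈ ω.form.orthogonal ℓ.1 := by
        intro y hy
        have h1 := hx (g.1 y) ⟨y, hy, rfl⟩
        have h2 := g.2 y (g.1.symm x)
        rw [LinearEquiv.apply_symm_apply] at h2
        exact h2.symm.trans h1
      rwa [ℓ.2] at this
    · rintro ⟨y, hy, rfl⟩ _ ⟨z, hz, rfl⟩
      exact (g.2 z y).trans (ℓ.isotropic hz hy)⟩

/-- The symplectic space `V̄ ⊕ V`, where `V̄` is `V` with minus the given form. -/
def SymplecticForm.double (ω : SymplecticForm F V) : SymplecticForm F (V × V) where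
  form := ω.form.compl₁₂ (LinearMap.snd F V V) (LinearMap.snd F V V) -
    ω.form.compl₁₂ (LinearMap.fst F V V) (LinearMap.fst F V V)
  alt := by
    intro x
    simp [ω.alt.self_eq_zero]
  nondeg := by
    refine ⟨fun x hx => ?_, fun x hx => ?_⟩
    · refine Prod.ext (ω.nondeg.1 _ fun y => ?_) (ω.nondeg.1 _ fun y => ?_)
      · simpa using hx (y, 0)
      · simpa using hx (0, y)
    · refine Prod.ext (ω.nondeg.2 _ fun y => ?_) (ω.nondeg.2 _ fun y => ?_)
      · simpa using hx (y, 0)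
      · simpa using hx (0, y)

lemma SymplecticForm.double_apply (ω : SymplecticForm F V) (x y : V × V) :
    ω.double.form x y = ω.form x.2 y.2 - ω.form x.1 y.1 := rfl

/-- The graph `Γ_g = {(x, g x)}`, a Lagrangian of `V̄ ⊕ V`. -/
def graph {ω : SymplecticForm F V} (g : Sp ω) : Gr ω.double :=
  ⟨LinearMap.graph (g.1 : V →ₗ[F] V), by
    ext x
    rw [LinearMap.mem_graph_iff]
    constructor
    · intro hx
      refine sub_eq_zero.mp (ω.nondeg.2 _ fun y => ?_)
      have h1 : ω.double.form (g.1.symm y, y) x = 0 := hx _ (by simp [LinearMap.mem_graph_iff])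
      have h2 := g.2 (g.1.symm y) x.1
      rw [SymplecticForm.double_apply] at h1
      rw [LinearEquiv.apply_symm_apply] at h2
      simp only [map_sub, LinearEquiv.coe_coe, h2]
      exact h1
    · rintro hx y hy
      rw [LinearMap.mem_graph_iff] at hy
      change ω.double.form y x = 0
      rw [SymplecticForm.double_apply, hx, hy]
      exact sub_eq_zero.mpr (g.2 _ _)⟩

/-- The Lagrangian `ℓ ⊕ ℓ` of `V̄ ⊕ V`. -/
def Gr.double {ω : SymplecticForm F V} (ℓ : Gr ω) : Gr ω.double :=
  ⟨ℓ.1.prod ℓ.1, by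
    ext x
    constructor
    · intro hx
      refine ⟨?_, ?_⟩
      · change x.1 ∈ ℓ.1
        rw [← ℓ.2]
        intro y hy
        have h : ω.double.form (y, 0) x = 0 := hx (y, 0) ⟨hy, ℓ.1.zero_mem⟩
        simpa [SymplecticForm.double_apply] using h
      · change x.2 ∈ ℓ.1
        rw [← ℓ.2]
        intro y hy
        have h : ω.double.form (0, y) x = 0 := hx (0, y) ⟨ℓ.1.zero_mem, hy⟩
        simpa [SymplecticForm.double_apply] using h
    · intro hx y hy
      change ω.double.form y x = 0
      rw [SymplecticForm.double_apply, ℓ.isotropic hy.1 hx.1, ℓ.isotropic hy.2 hx.2, sub_zero]⟩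

/-! ### The Maslov index -/

/-- The space of `(v₁, …, vₙ) ∈ ℓ₁ ⊕ ⋯ ⊕ ℓₙ` with `v₁ + ⋯ + vₙ = 0`. -/
def maslovSpace {ω : SymplecticForm F V} {n : ℕ} (L : Fin n → Gr ω) : Submodule F (Fin n → V) where
  carrier := {v | (∀ i, v i ∈ (L i).1) ∧ ∑ i, v i = 0}
  add_mem' := by
    rintro v w ⟨hv, hv'⟩ ⟨hw, hw'⟩
    exact ⟨fun i => (L i).1.add_mem (hv i) (hw i), by
      simp [Finset.sum_add_distrib, hv', hw']⟩
  zero_mem' := ⟨fun i => (L i).1.zero_mem, by simp⟩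
  smul_mem' := by
    rintro a v ⟨hv, hv'⟩
    exact ⟨fun i => (L i).1.smul_mem a (hv i), by simp [← Finset.smul_sum, hv']⟩

/-- The bilinear form `q(v, w) = ∑_{j < i} ⟨vᵢ, wⱼ⟩`. Its nondegenerate quotient is the
canonical quadratic space whose class in the Witt group is the Maslov index `τ(ℓ₁, …, ℓₙ)`.
For `n = 3` one has `q(v, v) = ⟨v₁, v₃⟩`. -/
def maslovForm {ω : SymplecticForm F V} {n : ℕ} (L : Fin n → Gr ω) :
    LinearMap.BilinForm F (maslovSpace L) :=
  ∑ i, ∑ j, if j < i then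
    ω.form.compl₁₂ ((LinearMap.proj i).comp (maslovSpace L).subtype)
      ((LinearMap.proj j).comp (maslovSpace L).subtype) else 0

lemma maslovForm_apply {ω : SymplecticForm F V} {n : ℕ} (L : Fin n → Gr ω)
    (v w : maslovSpace L) :
    maslovForm L v w = ∑ i, ∑ j, if j < i then ω.form (v.1 i) (w.1 j) else 0 := by
  simp only [maslovForm, LinearMap.sum_apply]
  refine Finset.sum_congr rfl fun i _ => Finset.sum_congr rfl fun j _ => ?_
  split_ifs <;> rfl

lemma maslovForm_isSymm {ω : SymplecticForm F V} {n : ℕ} (L : Fin n → Gr ω) :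
    (maslovForm L).IsSymm := by
  refine ⟨fun v w => ?_⟩
  rw [maslovForm_apply, maslovForm_apply]
  have h0 : ∑ i, ∑ j, ω.form (v.1 i) (w.1 j) = 0 := by
    have h : ω.form (∑ i, v.1 i) (∑ j, w.1 j) = 0 := by rw [v.2.2]; simp
    rw [← h]
    simp only [map_sum, LinearMap.sum_apply]
    exact Finset.sum_comm
  have h1 : ∑ i, ∑ j, (if j < i then ω.form (w.1 i) (v.1 j) else 0) =
      ∑ i, ∑ j, (if i < j then - ω.form (v.1 i) (w.1 j) else 0) := by
    rw [Finset.sum_comm]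
    refine Finset.sum_congr rfl fun i _ => Finset.sum_congr rfl fun j _ => ?_
    rw [ω.alt.neg_eq]
  rw [h1]
  refine sub_eq_zero.mp (Eq.trans ?_ h0)
  rw [← Finset.sum_sub_distrib]
  refine Finset.sum_congr rfl fun i _ => ?_
  rw [← Finset.sum_sub_distrib]
  refine Finset.sum_congr rfl fun j _ => ?_
  rcases lt_trichotomy i j with h | h | h
  · simp [h, h.not_gt]
  · subst h
    simp [(L i).isotropic (v.2.1 i) (w.2.1 i)]
  · simp [h, h.not_gt]

/-- `γ(τ(ℓ₁, …, ℓₙ))`. -/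
def gammaTau [TopologicalSpace F] (ψ : AddChar F Circle) {ω : SymplecticForm F V} {n : ℕ}
    (L : Fin n → Gr ω) : ℂ :=
  weilIndex ψ (maslovForm L) (maslovForm_isSymm L)

/-! ### The metaplectic group -/

/-- `a` represents the class `O_{ℓ₁,ℓ₂} ∈ Fˣ/(Fˣ)²` attached to subspaces `ℓ₁`, `ℓ₂` oriented by
the bases `o₁`, `o₂`. With bases `c₁ = (e, u)` and `c₂ = (e, w)` of `ℓ₁` and `ℓ₂` that extend a
common basis `e` of `ℓ₁ ∩ ℓ₂`, it is `det ⟨uᵢ, wⱼ⟩`, corrected by the change of orientation from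
`oᵢ` to `cᵢ`. -/
def IsOrientedPairing (ω : SymplecticForm F V) {ℓ₁ ℓ₂ : Submodule F V} {ι : Type*} [Fintype ι]
    (o₁ : Module.Basis ι F ℓ₁) (o₂ : Module.Basis ι F ℓ₂) (a : F) : Prop :=
  ∃ (k m : ℕ) (s : Fin k ⊕ Fin m ≃ ι) (c₁ : Module.Basis (Fin k ⊕ Fin m) F ℓ₁)
    (c₂ : Module.Basis (Fin k ⊕ Fin m) F ℓ₂),
    (∀ i, (c₁ (Sum.inl i) : V) = c₂ (Sum.inl i)) ∧
    Submodule.span F (Set.range fun i => (c₁ (Sum.inl i) : V)) = ℓ₁ ⊓ ℓ₂ ∧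
    a = (o₁.reindex s.symm).det c₁ * (o₂.reindex s.symm).det c₂ *
      (Matrix.of fun i j => ω.form (c₁ (Sum.inr i)) (c₂ (Sum.inr j))).det

/-- A representative in `F` of `O_{gℓ,ℓ}`, where `ℓ` is given any orientation and `gℓ` the
orientation transported by `g`. -/
def pairingClass [FiniteDimensional F V] {ω : SymplecticForm F V} (g : Sp ω) (ℓ : Gr ω) : F :=
  Classical.epsilon (IsOrientedPairing ω (ℓ₁ := (ℓ.map g).1) (ℓ₂ := ℓ.1)
    ((Module.finBasis F ℓ.1).map (g.1.submoduleMap ℓ.1)) (Module.finBasis F ℓ.1))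

/-- `m_g(ℓ) = γ(1)^{½ dim V - dim (gℓ ∩ ℓ) - 1} γ(O_{gℓ,ℓ})`. -/
def mFactor [TopologicalSpace F] [FiniteDimensional F V] (ψ : AddChar F Circle)
    {ω : SymplecticForm F V} (g : Sp ω) (ℓ : Gr ω) : ℂ :=
  weilIndexLine ψ (1 : F) ^ (((Module.finrank F V / 2 : ℕ) : ℤ) -
      (Module.finrank F ((ℓ.map g).1 ⊓ ℓ.1 : Submodule F V) : ℤ) - 1) *
    weilIndexLine ψ (pairingClass g ℓ)

/-- The metaplectic group `Mp(V)`: pairs `(g, t)` with `g ∈ Sp(V)` and `t` a function on `Gr(V)`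
such that `t(ℓ)² = m_g(ℓ)²` and `t(ℓ') = γ(τ(ℓ, gℓ, gℓ', ℓ')) t(ℓ)`. -/
structure Mp [TopologicalSpace F] [FiniteDimensional F V] (ψ : AddChar F Circle)
    (ω : SymplecticForm F V) where
  g : Sp ω
  t : Gr ω → ℂ
  sq_eq : ∀ ℓ, t ℓ ^ 2 = mFactor ψ g ℓ ^ 2
  change : ∀ ℓ ℓ', t ℓ' = gammaTau ψ ![ℓ, ℓ.map g, ℓ'.map g, ℓ'] * t ℓ

/-- The topology of `Mp(V)` as a two-fold covering of `Sp(V)`. It is the coarsest one for which the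
projection to `Sp(V)` is continuous and, for all Lagrangians `ℓ` and `ℓ'`, the function
`(g, t) ↦ t(ℓ) γ(τ(ℓ, gℓ, ℓ'))` is locally constant on the open set where `gℓ ∩ ℓ' = 0`.
For `ℓ' = ℓ` this function is `(g, t) ↦ t(ℓ)`; for `ℓ' = a⁻¹ℓ` with `a ∈ Sp(V)` it is, up to a
constant, the composition of the case `ℓ' = ℓ` with left translation by a lift of `a`, the product
in `Mp(V)` being `(a, s)(g, t) = (ag, s t γ(τ(ℓ, aℓ, agℓ)))`. So this is the group topology
for which `Mp(V) → Sp(V)` is a local homeomorphism and `(g, t) ↦ t(ℓ)` is locally constant where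
`dim (gℓ ∩ ℓ)` is constant. -/
instance [TopologicalSpace F] [FiniteDimensional F V] (ψ : AddChar F Circle)
    (ω : SymplecticForm F V) : TopologicalSpace (Mp ψ ω) :=
  TopologicalSpace.induced Mp.g inferInstance ⊓
    TopologicalSpace.generateFrom {S | ∃ (ℓ ℓ' : Gr ω) (z : ℂ),
      S = {x : Mp ψ ω | (ℓ.map x.g).1 ⊓ ℓ'.1 = ⊥ ∧
        x.t ℓ * gammaTau ψ ![ℓ, ℓ.map x.g, ℓ'] = z}}

/-- `Mp(V)''`, the part of `Mp(V)` where `det (g - 1) ≠ 0`. -/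
def MpReg [TopologicalSpace F] [FiniteDimensional F V] (ψ : AddChar F Circle)
    (ω : SymplecticForm F V) : Set (Mp ψ ω) :=
  {x | LinearMap.det ((x.g.1 : V →ₗ[F] V) - LinearMap.id) ≠ 0}

/-- `Θ_ℓ(g, t) = t(ℓ) γ(τ(Γ_g, Γ_1, ℓ ⊕ ℓ))`. -/
def Theta [TopologicalSpace F] [FiniteDimensional F V] {ψ : AddChar F Circle}
    {ω : SymplecticForm F V} (ℓ : Gr ω) (x : Mp ψ ω) : ℂ :=
  x.t ℓ * gammaTau ψ ![graph x.g, graph (1 : Sp ω), ℓ.double]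

end Symplectic

end Metaplectic

end

/-! The Weil index is multiplicative on orthogonal sums, inverted by q ↦ -q, unchanged by pullback
along a surjection, and unchanged by restriction to the orthogonal of an isotropic subspace
(`weilIndex_reduction`). These rules turn linear algebra of Lagrangians into identities between
numbers: cyclic invariance of τ, the chain rule τ(a,b,c) + τ(a,c,d) = τ(a,b,c,d) (`gammaTau_chain`),
and from these the cocycle relation.

Independence of ℓ: apply the cocycle relation to Γ_g, Γ_1, ℓ⊕ℓ, ℓ'⊕ℓ'. The class τ(Γ_1, ℓ⊕ℓ, ℓ'⊕ℓ')
vanishes because its form is zero, and τ(Γ_g, ℓ⊕ℓ, ℓ'⊕ℓ') = -τ(ℓ, gℓ, gℓ', ℓ')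
(`gammaTau_graph_prod`), which cancels exactly the factor by which t changes from ℓ to ℓ'.

Local constancy: the same computation with ℓ⊕ℓ' in place of ℓ'⊕ℓ' gives Θ_ℓ(g,t) = t(ℓ)γ(τ(ℓ,gℓ,ℓ'))
· γ(τ(Γ_g,Γ_1,ℓ⊕ℓ')) · γ(τ(Γ_1,ℓ⊕ℓ,ℓ⊕ℓ')). Near a given point choose ℓ' transversal to gℓ. The first
factor is locally constant by the definition of the topology of Mp(V), and the third does not
involve g. The second is the Weil index of a form on the fixed space ℓ⊕ℓ' that depends continuously
on g through (g-1)⁻¹ and has the fixed kernel {(x,x) : x ∈ ℓ ∩ ℓ'}. Such an index is locally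
constant, since elements of F close to 1 are squares (`eventually_weilIndex_eq`).

It remains to prove that the Weil index exists, is unique, and is a product over a diagonalization
(`exists_isDiagSymbol`). For finite and non-archimedean F it is the stable value of the integral of
f_q over large compact open subgroups, by completing the square. For ℝ it is the limit of Gaussian
integrals with a convergence factor. For ℂ it is the real case with as many plus as minus signs. -/

noncomputable section

/-! ### Formal rules for the Weil index: pullback, orthogonal sums, isotropic reduction -/

namespace Metaplectic

universe u v

/-- `γ₁ a` is the Weil index of the line with form `a x y`, in the sense that the Weil index of a
symmetric form is the product of the values of `γ₁` on any orthogonal family that spans up to the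
kernel. -/
structure IsWeilSymbol {F : Type u} [Field F] [TopologicalSpace F] (ψ : AddChar F Circle)
    (γ₁ : F → ℂ) : Prop where
  mul_neg : ∀ a, γ₁ a * γ₁ (-a) = 1
  weilIndex_eq : ∀ {A : Type v} [AddCommGroup A] [Module F A] (q : LinearMap.BilinForm F A)
    (hq : q.IsSymm) {ι : Type} [Fintype ι] (w : ι → A), (∀ i j, i ≠ j → q (w i) (w j) = 0) →
    Submodule.span F (Set.range w) ⊔ LinearMap.ker q = ⊤ →
    weilIndex ψ q hq = ∏ i, γ₁ (q (w i) (w i))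

namespace IsWeilSymbol

variable {F : Type u} [Field F] [TopologicalSpace F] {ψ : AddChar F Circle} {γ₁ : F → ℂ}
  {A B : Type v} [AddCommGroup A] [Module F A] [AddCommGroup B] [Module F B]

omit [TopologicalSpace F] in
lemma exists_orthogonal_family [FiniteDimensional F A] (h2 : (2 : F) ≠ 0)
    {q : LinearMap.BilinForm F A} (hq : q.IsSymm) :
    ∃ (n : ℕ) (w : Fin n → A), (∀ i j, i ≠ j → q (w i) (w j) = 0) ∧
      Submodule.span F (Set.range w) = ⊤ := by
  have : Invertible (2 : F) := invertibleOfNonzero h2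
  obtain ⟨b, hb⟩ := LinearMap.BilinForm.exists_orthogonal_basis
    (LinearMap.BilinForm.isSymm_iff.1 hq)
  exact ⟨_, b, fun i j hij => hb hij, b.span_eq⟩

lemma weilIndex_eq_one (h : IsWeilSymbol.{u, v} ψ γ₁) {q : LinearMap.BilinForm F A}
    (hq : q.IsSymm) (h0 : q = 0) : weilIndex ψ q hq = 1 := by
  rw [h.weilIndex_eq q hq (ι := Fin 0) Fin.elim0 (fun i => i.elim0)]
  · simp
  · subst h0; simp

variable [FiniteDimensional F A]

lemma weilIndex_mul_neg (h : IsWeilSymbol.{u, v} ψ γ₁) (h2 : (2 : F) ≠ 0)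
    {q q' : LinearMap.BilinForm F A} (hq : q.IsSymm) (hq' : q'.IsSymm)
    (hneg : ∀ x y, q' x y = - q x y) : weilIndex ψ q hq * weilIndex ψ q' hq' = 1 := by
  obtain ⟨n, w, hw, hs⟩ := exists_orthogonal_family h2 hq
  rw [h.weilIndex_eq q hq w hw (by rw [hs, top_sup_eq]),
    h.weilIndex_eq q' hq' w (fun i j hij => by rw [hneg, hw i j hij, neg_zero])
      (by rw [hs, top_sup_eq]), ← Finset.prod_mul_distrib]
  exact Finset.prod_eq_one fun i _ => by rw [hneg, h.mul_neg]

/-- Lifts of an orthogonal family that spans `A` are orthogonal in `B`, have the same values, and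
span `B` up to ker f, which lies in the kernel of `q'`. -/
lemma weilIndex_pullback (h : IsWeilSymbol.{u, v} ψ γ₁) (h2 : (2 : F) ≠ 0)
    {q : LinearMap.BilinForm F A} (hq : q.IsSymm) {q' : LinearMap.BilinForm F B}
    (hq' : q'.IsSymm) (f : B →ₗ[F] A) (hf : Function.Surjective f)
    (hqf : ∀ x y, q' x y = q (f x) (f y)) : weilIndex ψ q' hq' = weilIndex ψ q hq := by
  obtain ⟨n, w, hw, hs⟩ := exists_orthogonal_family h2 hq
  choose g hg using hf
  rw [h.weilIndex_eq q hq w hw (by rw [hs, top_sup_eq]),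
    h.weilIndex_eq q' hq' (fun i => g (w i)) (fun i j hij => by rw [hqf, hg, hg, hw i j hij])]
  · simp [hqf, hg]
  · rw [eq_top_iff]
    have hk : LinearMap.ker f ≤ LinearMap.ker q' := fun x hx => by
      rw [LinearMap.mem_ker] at hx ⊢
      ext y
      simp [hqf, hx]
    refine le_trans ?_ (sup_le_sup_left hk _)
    rw [← Submodule.comap_map_eq, Submodule.map_span, ← Set.range_comp]
    have : (f ∘ fun i => g (w i)) = w := by ext i; simp [hg]
    rw [this, hs, Submodule.comap_top]

lemma weilIndex_prod [FiniteDimensional F B] (h : IsWeilSymbol.{u, v} ψ γ₁) (h2 : (2 : F) ≠ 0)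
    {q₁ : LinearMap.BilinForm F A} (hq₁ : q₁.IsSymm) {q₂ : LinearMap.BilinForm F B}
    (hq₂ : q₂.IsSymm) {q : LinearMap.BilinForm F (A × B)} (hq : q.IsSymm)
    (hqq : ∀ x y, q x y = q₁ x.1 y.1 + q₂ x.2 y.2) :
    weilIndex ψ q hq = weilIndex ψ q₁ hq₁ * weilIndex ψ q₂ hq₂ := by
  obtain ⟨n, w, hw, hs⟩ := exists_orthogonal_family h2 hq₁
  obtain ⟨m, z, hz, hs'⟩ := exists_orthogonal_family h2 hq₂
  rw [h.weilIndex_eq q₁ hq₁ w hw (by rw [hs, top_sup_eq]),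
    h.weilIndex_eq q₂ hq₂ z hz (by rw [hs', top_sup_eq]),
    h.weilIndex_eq q hq (Sum.elim (fun i => (w i, (0 : B))) (fun i => ((0 : A), z i)))]
  · simp [hqq]
  · rintro (i | i) (j | j) hij
    · simp [hqq, hw i j (by simpa using hij)]
    · simp [hqq]
    · simp [hqq]
    · simp [hqq, hz i j (by simpa using hij)]
  · rw [eq_top_iff]
    refine le_trans ?_ le_sup_left
    rw [Set.Sum.elim_range, Submodule.span_union]
    have e1 : (Set.range fun i => (w i, (0 : B))) = LinearMap.inl F A B '' Set.range w := by
      rw [← Set.range_comp]; rfl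
    have e2 : (Set.range fun i => ((0 : A), z i)) = LinearMap.inr F A B '' Set.range z := by
      rw [← Set.range_comp]; rfl
    rw [e1, e2, ← Submodule.map_span, ← Submodule.map_span, hs, hs', Submodule.map_top,
      Submodule.map_top, LinearMap.sup_range_inl_inr]

/-- If `m` is not in the kernel, it lies in a hyperbolic plane. An orthogonal family for the
orthogonal `K` of that plane serves both forms: the plane contributes γ₁(2)γ₁(-2) = 1 to `q`, and on
mᗮ = K ⊕ Fm the vector `m` falls into the kernel. -/
lemma weilIndex_restrict_ker (h : IsWeilSymbol.{u, v} ψ γ₁) (h2 : (2 : F) ≠ 0)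
    {q : LinearMap.BilinForm F A} (hq : q.IsSymm) {m : A} (hm : q m m = 0)
    {q' : LinearMap.BilinForm F (LinearMap.ker (q m))} (hq' : q'.IsSymm)
    (hqq : ∀ x y, q' x y = q x y) : weilIndex ψ q' hq' = weilIndex ψ q hq := by
  by_cases hker : q m = 0
  · refine h.weilIndex_pullback h2 hq hq' (LinearMap.ker (q m)).subtype ?_ hqq
    intro x
    exact ⟨⟨x, by simp [hker]⟩, rfl⟩
  obtain ⟨n₀, hn₀⟩ : ∃ n, q m n ≠ 0 := by
    by_contra! hcon
    exact hker (LinearMap.ext hcon)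
  -- The partner of `m` in a hyperbolic pair: scale so that the pairing is 1, then subtract a
  -- multiple of `m` to make the vector isotropic.
  obtain ⟨n, hmn, hnn⟩ : ∃ n, q m n = 1 ∧ q n n = 0 := by
    have h1 : q m ((q m n₀)⁻¹ • n₀) = 1 := by simp [hn₀]
    set n₁ := (q m n₀)⁻¹ • n₀
    refine ⟨n₁ - (q n₁ n₁ / 2) • m, by simp [h1, hm], ?_⟩
    simp only [map_sub, LinearMap.sub_apply, map_smul, LinearMap.smul_apply, smul_eq_mul,
      hm, h1, hq.eq n₁ m]
    field_simp
    ring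
  have hnm : q n m = 1 := by rw [← hmn]; exact hq.eq m n |>.symm
  let K : Submodule F A := LinearMap.ker (q m) ⊓ LinearMap.ker (q n)
  let qK : LinearMap.BilinForm F K := q.compl₁₂ K.subtype K.subtype
  have hqK : qK.IsSymm := ⟨fun x y => hq.eq x y⟩
  obtain ⟨k, w, hw, hs⟩ := exists_orthogonal_family h2 hqK
  have hwm : ∀ i, q m (w i) = 0 := fun i => (w i).2.1
  have hwn : ∀ i, q n (w i) = 0 := fun i => (w i).2.2
  have hwm' : ∀ i, q (w i) m = 0 := fun i => (hq.eq _ _).trans (hwm i)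
  have hwn' : ∀ i, q (w i) n = 0 := fun i => (hq.eq _ _).trans (hwn i)
  have hww : ∀ i j, i ≠ j → q (w i) (w j) = 0 := fun i j hij => hw i j hij
  have hspan : ∀ x ∈ K, x ∈ Submodule.span F (Set.range fun i => (w i : A)) := by
    intro x hx
    have : (⟨x, hx⟩ : K) ∈ Submodule.span F (Set.range w) := by rw [hs]; trivial
    have := Submodule.mem_map_of_mem (f := K.subtype) this
    rw [Submodule.map_span, ← Set.range_comp] at this
    exact this
  rw [h.weilIndex_eq q hq (ι := Fin 2 ⊕ Fin k) (Sum.elim ![m + n, m - n] fun i => (w i : A)),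
    h.weilIndex_eq q' hq' (ι := Fin k) fun i => ⟨(w i : A), hwm i⟩]
  · have h4 : q (m + n) (m + n) = 2 := by simp [hm, hnn, hmn, hnm]; norm_num
    have h5 : q (m - n) (m - n) = - 2 := by simp [hm, hnn, hmn, hnm]; norm_num
    rw [Fintype.prod_sum_type]
    simp only [Sum.elim_inl, Fin.prod_univ_two, Matrix.cons_val_zero, Matrix.cons_val_one,
      Sum.elim_inr, h4, h5, h.mul_neg, one_mul, hqq]
  · intro i j hij
    rw [hqq]; exact hww i j hij
  · rw [eq_top_iff]
    rintro ⟨x, hx⟩ -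
    have hx' : q m x = 0 := hx
    have hxK : x - q n x • m ∈ K := ⟨by simp [hx', hm], by simp [hnm]⟩
    have hmK : (⟨m, hm⟩ : LinearMap.ker (q m)) ∈ LinearMap.ker q' := by
      rw [LinearMap.mem_ker]
      ext y
      simp [hqq]
    have h6 : (⟨x - q n x • m, hxK.1⟩ : LinearMap.ker (q m)) ∈
        Submodule.span F (Set.range fun i => (⟨(w i : A), hwm i⟩ : LinearMap.ker (q m))) := by
      have h7 := hspan _ hxK
      have h8 : (Set.range fun i => (w i : A)) = (LinearMap.ker (q m)).subtype ''
          (Set.range fun i => (⟨(w i : A), hwm i⟩ : LinearMap.ker (q m))) := by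
        rw [← Set.range_comp]; rfl
      rw [h8, ← Submodule.map_span] at h7
      obtain ⟨y, hy, hy'⟩ := h7
      have h10 : (⟨x - q n x • m, hxK.1⟩ : LinearMap.ker (q m)) = y := Subtype.ext hy'.symm
      rw [h10]
      exact hy
    have h9 : (⟨x, hx⟩ : LinearMap.ker (q m)) =
        ⟨x - q n x • m, hxK.1⟩ + q n x • ⟨m, hm⟩ := by
      ext; simp
    rw [h9]
    exact Submodule.add_mem_sup h6 (Submodule.smul_mem _ _ hmK)
  · rintro (i | i) (j | j) hij
    · fin_cases i <;> fin_cases j <;> simp_all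
    · fin_cases i <;> simp [hwm, hwn]
    · fin_cases j <;> simp [hwm', hwn']
    · exact hww i j (by simpa using hij)
  · rw [eq_top_iff]
    intro x _
    refine Submodule.mem_sup_left ?_
    rw [Set.Sum.elim_range, Submodule.span_union]
    have hxK : x - q n x • m - q m x • n ∈ K :=
      ⟨by simp [hm, hmn], by simp [hnm, hnn]⟩
    have e : x = ((q n x / 2 + q m x / 2) • (m + n) + (q n x / 2 - q m x / 2) • (m - n)) +
        (x - q n x • m - q m x • n) := by
      have e1 : q n x = q n x / 2 + q n x / 2 := by field_simp; ring
      have e2 : q m x = q m x / 2 + q m x / 2 := by field_simp; ring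
      generalize hα : q n x / 2 = α at *
      generalize hβ : q m x / 2 = β at *
      rw [e1, e2]
      module
    rw [e]
    refine Submodule.add_mem_sup ?_ (hspan _ hxK)
    refine Submodule.add_mem _ (Submodule.smul_mem _ _ (Submodule.subset_span ⟨0, rfl⟩))
      (Submodule.smul_mem _ _ (Submodule.subset_span ⟨1, rfl⟩))

/-- In the Witt group q equals the form induced on Jᗮ/J for isotropic J. Here Jᗮ is presented as the
image of `f`, which need not be injective. -/
lemma weilIndex_reduction [FiniteDimensional F B] (h : IsWeilSymbol.{u, v} ψ γ₁)
    (h2 : (2 : F) ≠ 0) {q : LinearMap.BilinForm F A} (hq : q.IsSymm)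
    {q' : LinearMap.BilinForm F B} (hq' : q'.IsSymm) (f : B →ₗ[F] A)
    (hqf : ∀ x y, q' x y = q (f x) (f y)) (J : Submodule F A)
    (hJ : ∀ x ∈ J, ∀ y ∈ J, q x y = 0)
    (hf : ∀ x, x ∈ LinearMap.range f ↔ ∀ m ∈ J, q m x = 0) :
    weilIndex ψ q' hq' = weilIndex ψ q hq := by
  -- Induction on a finite set of vectors of `J`: inside tᗮ the new vector `a` is still isotropic,
  -- and its orthogonal there is the orthogonal of `insert a t`, so `weilIndex_restrict_ker`
  -- applies.
  have key : ∀ t : Finset A, ↑t ⊆ (J : Set A) → ∀ (S : Submodule F A)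
      (_ : ∀ x, x ∈ S ↔ ∀ m ∈ t, q m x = 0) (qS : LinearMap.BilinForm F S) (hqS : qS.IsSymm)
      (_ : ∀ x y, qS x y = q x y), weilIndex ψ qS hqS = weilIndex ψ q hq := by
    classical
    intro t
    induction t using Finset.induction_on with
    | empty =>
      intro _ S hS qS hqS hqq
      exact h.weilIndex_pullback h2 hq hqS S.subtype (fun x => ⟨⟨x, (hS x).2 (by simp)⟩, rfl⟩) hqq
    | insert a t ha ih =>
      intro htJ S hS qS hqS hqq
      let T : Submodule F A := ⨅ m ∈ t, LinearMap.ker (q m)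
      have hT : ∀ x, x ∈ T ↔ ∀ m ∈ t, q m x = 0 := by intro x; simp [T, Submodule.mem_iInf]
      let qT : LinearMap.BilinForm F T := q.compl₁₂ T.subtype T.subtype
      have hqT : qT.IsSymm := ⟨fun x y => hq.eq x y⟩
      have haJ : a ∈ J := htJ (by simp)
      have htJ' : ↑t ⊆ (J : Set A) := fun x hx => htJ (by simp [Finset.mem_coe.1 hx])
      rw [← ih htJ' T hT qT hqT fun _ _ => rfl]
      let a' : T := ⟨a, (hT a).2 fun m hm => hJ m (htJ' hm) a haJ⟩
      let q₀ : LinearMap.BilinForm F (LinearMap.ker (qT a')) :=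
        qT.compl₁₂ (LinearMap.ker (qT a')).subtype (LinearMap.ker (qT a')).subtype
      have hq₀ : q₀.IsSymm := ⟨fun x y => hqT.eq x y⟩
      rw [← h.weilIndex_restrict_ker h2 hqT (m := a') (hJ a haJ a haJ) hq₀ fun _ _ => rfl]
      have hST : ∀ x ∈ S, x ∈ T := fun x hx =>
        (hT x).2 fun m hm => (hS x).1 hx m (by simp [hm])
      have hSa : ∀ x ∈ S, q a x = 0 := fun x hx => (hS x).1 hx a (by simp)
      let g : S →ₗ[F] LinearMap.ker (qT a') :=
        LinearMap.codRestrict _ (LinearMap.codRestrict T S.subtype fun x => hST x x.2)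
          fun x => hSa x x.2
      refine h.weilIndex_pullback h2 hq₀ hqS g ?_ hqq
      rintro ⟨⟨x, hxT⟩, hx⟩
      refine ⟨⟨x, (hS x).2 fun m hm => ?_⟩, rfl⟩
      rcases Finset.mem_insert.1 hm with rfl | hm
      · exact hx
      · exact (hT x).1 hxT m hm
  obtain ⟨t, ht⟩ := (IsNoetherian.noetherian J : J.FG)
  let qS : LinearMap.BilinForm F (LinearMap.range f) :=
    q.compl₁₂ (LinearMap.range f).subtype (LinearMap.range f).subtype
  have hqS : qS.IsSymm := ⟨fun x y => hq.eq x y⟩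
  rw [← key t (by rw [← ht]; exact Submodule.subset_span) (LinearMap.range f) ?_ qS hqS
    fun _ _ => rfl]
  · exact h.weilIndex_pullback h2 hqS hq' f.rangeRestrict f.surjective_rangeRestrict hqf
  · intro x
    rw [hf x]
    constructor
    · intro hx m hm
      exact hx m (by rw [← ht]; exact Submodule.subset_span hm)
    · intro hx m hm
      rw [← ht] at hm
      induction hm using Submodule.span_induction with
      | mem m hm => exact hx m hm
      | zero => simp
      | add a b _ _ ha hb => simp [ha, hb]
      | smul c a _ ha => simp [ha]

end IsWeilSymbol

end Metaplectic

namespace Metaplectic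

universe u v

/-! ### Maslov spaces of three and four Lagrangians -/

section Maslov

variable {F : Type u} [Field F] {V : Type v} [AddCommGroup V] [Module F V] {ω : SymplecticForm F V}

lemma SymplecticForm.neg (ω : SymplecticForm F V) (x y : V) : ω.form x y = - ω.form y x := by
  rw [ω.alt.neg_eq]

/-- Since ℓ and ℓ' are their own orthogonals, (ℓ + ℓ')ᗮ ⊆ ℓ ∩ ℓ'; take orthogonals once more. -/
lemma orthogonal_inf_le [FiniteDimensional F V] (ℓ ℓ' : Gr ω) :
    ω.form.orthogonal (ℓ.1 ⊓ ℓ'.1) ≤ ℓ.1 ⊔ ℓ'.1 := by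
  have h1 : ω.form.orthogonal (ℓ.1 ⊔ ℓ'.1) ≤ ℓ.1 ⊓ ℓ'.1 := by
    refine le_inf ?_ ?_
    · refine (LinearMap.BilinForm.orthogonal_le le_sup_left).trans_eq ℓ.2
    · refine (LinearMap.BilinForm.orthogonal_le le_sup_right).trans_eq ℓ'.2
  refine (LinearMap.BilinForm.orthogonal_le h1).trans_eq ?_
  exact LinearMap.BilinForm.orthogonal_orthogonal ω.nondeg ω.alt.isRefl _

/-- The Lagrangian `a ⊕ b` of `V̄ ⊕ V`. -/
def Gr.prod (a b : Gr ω) : Gr ω.double :=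
  ⟨a.1.prod b.1, by
    ext x
    constructor
    · intro hx
      refine ⟨?_, ?_⟩
      · change x.1 ∈ a.1
        rw [← a.2]
        intro y hy
        have h : ω.double.form (y, 0) x = 0 := hx (y, 0) ⟨hy, b.1.zero_mem⟩
        simpa [SymplecticForm.double_apply] using h
      · change x.2 ∈ b.1
        rw [← b.2]
        intro y hy
        have h : ω.double.form (0, y) x = 0 := hx (0, y) ⟨a.1.zero_mem, hy⟩
        simpa [SymplecticForm.double_apply] using h
    · intro hx y hy
      change ω.double.form y x = 0
      rw [SymplecticForm.double_apply, a.isotropic hy.1 hx.1, b.isotropic hy.2 hx.2, sub_zero]⟩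

lemma Gr.prod_self (ℓ : Gr ω) : Gr.prod ℓ ℓ = ℓ.double := rfl

/-- A linear map into a Maslov space, given by its components. -/
def maslovLift {B : Type*} [AddCommGroup B] [Module F B] {n : ℕ} {L : Fin n → Gr ω}
    (f : Fin n → B →ₗ[F] V) (hmem : ∀ i x, f i x ∈ (L i).1) (hsum : ∀ x, ∑ i, f i x = 0) :
    B →ₗ[F] maslovSpace L :=
  LinearMap.codRestrict _ (LinearMap.pi f) fun x => ⟨fun i => hmem i x, hsum x⟩

/-- The `i`-th coordinate on a Maslov space. -/
def maslovCoord {n : ℕ} (L : Fin n → Gr ω) (i : Fin n) : maslovSpace L →ₗ[F] V :=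
  (LinearMap.proj i).comp (maslovSpace L).subtype

lemma maslovCoord_apply {n : ℕ} (L : Fin n → Gr ω) (i : Fin n) (v : maslovSpace L) :
    maslovCoord L i v = v.1 i := rfl

variable {a b c d : Gr ω}

/-- The two terms that pair with w₁ add up to -⟨v₁, w₁⟩, which vanishes on the Lagrangian `a`. -/
lemma maslovForm_three (v w : maslovSpace ![a, b, c]) :
    maslovForm _ v w = ω.form (v.1 2) (w.1 1) := by
  have h : ω.form (v.1 1) (w.1 0) + ω.form (v.1 2) (w.1 0) = 0 := by
    have h1 : v.1 1 + v.1 2 = - v.1 0 := by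
      have := v.2.2
      rw [Fin.sum_univ_three] at this
      rw [eq_neg_iff_add_eq_zero, ← this]; abel
    have h0 := a.isotropic (v.2.1 0) (w.2.1 0)
    rw [← LinearMap.add_apply, ← map_add, h1, map_neg, LinearMap.neg_apply, h0, neg_zero]
  rw [maslovForm_apply]
  simp [Fin.sum_univ_three]
  rw [← add_assoc, h, zero_add]

lemma maslovForm_four (v w : maslovSpace ![a, b, c, d]) :
    maslovForm _ v w = ω.form (v.1 1) (w.1 0) + (ω.form (v.1 2) (w.1 0) + ω.form (v.1 2) (w.1 1)) +
      (ω.form (v.1 3) (w.1 0) + ω.form (v.1 3) (w.1 1) + ω.form (v.1 3) (w.1 2)) := by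
  rw [maslovForm_apply]
  simp [Fin.sum_univ_four]

lemma maslovSpace_sum_three (v : maslovSpace ![a, b, c]) : v.1 0 + v.1 1 + v.1 2 = 0 := by
  rw [← Fin.sum_univ_three]; exact v.2.2

lemma maslovSpace_sum_four (v : maslovSpace ![a, b, c, d]) :
    v.1 0 + v.1 1 + v.1 2 + v.1 3 = 0 := by
  rw [← Fin.sum_univ_four]; exact v.2.2

end Maslov

/-! ### Identities for γ(τ), the cocycle relation, and independence of ℓ -/

section Gamma

variable {F : Type u} [Field F] [TopologicalSpace F] {ψ : AddChar F Circle} {γ₁ : F → ℂ}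
  {V : Type v} [AddCommGroup V] [Module F V] [FiniteDimensional F V] {ω : SymplecticForm F V}

lemma IsWeilSymbol.gammaTau_rotate_three (h : IsWeilSymbol.{u, v} ψ γ₁) (h2 : (2 : F) ≠ 0)
    (a b c : Gr ω) : gammaTau ψ ![a, b, c] = gammaTau ψ ![b, c, a] := by
  let f : maslovSpace ![a, b, c] →ₗ[F] maslovSpace ![b, c, a] :=
    maslovLift ![maslovCoord _ 1, maslovCoord _ 2, maslovCoord _ 0]
      (by
        intro i x
        fin_cases i
        · exact x.2.1 1
        · exact x.2.1 2
        · exact x.2.1 0)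
      (by
        intro x
        rw [Fin.sum_univ_three, ← maslovSpace_sum_three x]
        simp [maslovCoord_apply]; abel)
  refine h.weilIndex_pullback h2 _ _ f ?_ ?_
  · intro y
    refine ⟨⟨![y.1 2, y.1 0, y.1 1], ?_, ?_⟩, ?_⟩
    · intro i
      fin_cases i
      · exact y.2.1 2
      · exact y.2.1 0
      · exact y.2.1 1
    · rw [Fin.sum_univ_three, ← maslovSpace_sum_three y]
      simp; abel
    · ext i
      fin_cases i <;> rfl
  · intro v w
    rw [maslovForm_three, maslovForm_three]
    change ω.form (v.1 2) (w.1 1) = ω.form (v.1 0) (w.1 2)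
    have hv : v.1 0 = - v.1 1 - v.1 2 := by
      linear_combination (norm := module) maslovSpace_sum_three v
    have hw : w.1 2 = - w.1 0 - w.1 1 := by
      linear_combination (norm := module) maslovSpace_sum_three w
    have h0 := a.isotropic (v.2.1 0) (w.2.1 0)
    have h1 := b.isotropic (v.2.1 1) (w.2.1 1)
    have h3 := c.isotropic (v.2.1 2) (w.2.1 2)
    rw [hw] at h3 ⊢
    rw [hv] at h0 ⊢
    simp only [map_sub, map_neg, LinearMap.sub_apply, LinearMap.neg_apply] at h0 h3 ⊢
    linear_combination h0 - h1

/-- Rotating the coordinates exchanges the terms ⟨vᵢ, w₁⟩, i > 1, for ⟨v₁, wⱼ⟩, j > 1. Each group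
sums to -⟨v₁, w₁⟩ = 0. -/
lemma IsWeilSymbol.gammaTau_rotate_four (h : IsWeilSymbol.{u, v} ψ γ₁) (h2 : (2 : F) ≠ 0)
    (a b c d : Gr ω) : gammaTau ψ ![a, b, c, d] = gammaTau ψ ![b, c, d, a] := by
  let f : maslovSpace ![a, b, c, d] →ₗ[F] maslovSpace ![b, c, d, a] :=
    maslovLift ![maslovCoord _ 1, maslovCoord _ 2, maslovCoord _ 3, maslovCoord _ 0]
      (by
        intro i x
        fin_cases i
        · exact x.2.1 1
        · exact x.2.1 2
        · exact x.2.1 3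
        · exact x.2.1 0)
      (by
        intro x
        rw [Fin.sum_univ_four, ← maslovSpace_sum_four x]
        simp [maslovCoord_apply]; abel)
  refine h.weilIndex_pullback h2 _ _ f ?_ ?_
  · intro y
    refine ⟨⟨![y.1 3, y.1 0, y.1 1, y.1 2], ?_, ?_⟩, ?_⟩
    · intro i
      fin_cases i
      · exact y.2.1 3
      · exact y.2.1 0
      · exact y.2.1 1
      · exact y.2.1 2
    · rw [Fin.sum_univ_four, ← maslovSpace_sum_four y]
      simp; abel
    · ext i
      fin_cases i <;> rfl
  · intro v w
    rw [maslovForm_four, maslovForm_four]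
    change _ = ω.form (v.1 2) (w.1 1) + (ω.form (v.1 3) (w.1 1) + ω.form (v.1 3) (w.1 2)) +
      (ω.form (v.1 0) (w.1 1) + ω.form (v.1 0) (w.1 2) + ω.form (v.1 0) (w.1 3))
    have h0 := a.isotropic (v.2.1 0) (w.2.1 0)
    have hv : ω.form (v.1 0 + v.1 1 + v.1 2 + v.1 3) (w.1 0) = 0 := by
      rw [maslovSpace_sum_four v]; simp
    have hw : ω.form (v.1 0) (w.1 0 + w.1 1 + w.1 2 + w.1 3) = 0 := by
      rw [maslovSpace_sum_four w]; simp
    simp only [map_add, LinearMap.add_apply] at hv hw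
    linear_combination hv - hw

/-- Two triangles (a,b,c) and (a,c,d) are glued along the diagonal by adding their coordinates in
`a` and in `c`. A closed quadrilateral splits into such triangles exactly when its `b`-coordinate
lies in a + c = (a ∩ c)ᗮ, that is, when it is orthogonal to the isotropic space `J` of vectors (-x,
0, x, 0) with x ∈ a ∩ c. So `weilIndex_reduction` applies. -/
lemma IsWeilSymbol.gammaTau_chain (h : IsWeilSymbol.{u, v} ψ γ₁) (h2 : (2 : F) ≠ 0)
    (a b c d : Gr ω) :
    gammaTau ψ ![a, b, c] * gammaTau ψ ![a, c, d] = gammaTau ψ ![a, b, c, d] := by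
  let p₁ := LinearMap.fst F (maslovSpace ![a, b, c]) (maslovSpace ![a, c, d])
  let p₂ := LinearMap.snd F (maslovSpace ![a, b, c]) (maslovSpace ![a, c, d])
  let q : LinearMap.BilinForm F (maslovSpace ![a, b, c] × maslovSpace ![a, c, d]) :=
    (maslovForm _).compl₁₂ p₁ p₁ + (maslovForm _).compl₁₂ p₂ p₂
  have hqapp : ∀ x y, q x y = maslovForm _ x.1 y.1 + maslovForm _ x.2 y.2 := fun _ _ => rfl
  have hq : q.IsSymm := ⟨fun x y => by
    rw [hqapp, hqapp, (maslovForm_isSymm _).eq x.1, (maslovForm_isSymm _).eq x.2]⟩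
  let f : (maslovSpace ![a, b, c] × maslovSpace ![a, c, d]) →ₗ[F] maslovSpace ![a, b, c, d] :=
    maslovLift ![maslovCoord _ 0 ∘ₗ p₁ + maslovCoord _ 0 ∘ₗ p₂, maslovCoord _ 1 ∘ₗ p₁,
        maslovCoord _ 2 ∘ₗ p₁ + maslovCoord _ 1 ∘ₗ p₂, maslovCoord _ 2 ∘ₗ p₂]
      (by
        intro i x
        fin_cases i
        · exact a.1.add_mem (x.1.2.1 0) (x.2.2.1 0)
        · exact x.1.2.1 1
        · exact c.1.add_mem (x.1.2.1 2) (x.2.2.1 1)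
        · exact x.2.2.1 2)
      (by
        intro x
        have h1 := maslovSpace_sum_three x.1
        have h3 := maslovSpace_sum_three x.2
        rw [Fin.sum_univ_four]
        change (x.1.1 0 + x.2.1 0) + x.1.1 1 + (x.1.1 2 + x.2.1 1) + x.2.1 2 = 0
        linear_combination (norm := module) h1 + h3)
  have hf0 : ∀ x, (f x).1 0 = x.1.1 0 + x.2.1 0 := fun _ => rfl
  have hf1 : ∀ x, (f x).1 1 = x.1.1 1 := fun _ => rfl
  have hf2 : ∀ x, (f x).1 2 = x.1.1 2 + x.2.1 1 := fun _ => rfl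
  have hf3 : ∀ x, (f x).1 3 = x.2.1 2 := fun _ => rfl
  rw [gammaTau, gammaTau, ← h.weilIndex_prod h2 _ _ hq hqapp]
  let J : Submodule F (maslovSpace ![a, b, c, d]) :=
    LinearMap.ker (maslovCoord _ 1) ⊓ LinearMap.ker (maslovCoord _ 3)
  have hJ : ∀ m ∈ J, ∀ w, maslovForm ![a, b, c, d] m w = ω.form (m.1 2) (w.1 1) := by
    intro m hm w
    have h1 : m.1 1 = 0 := hm.1
    have h3 : m.1 3 = 0 := hm.2
    have hs := maslovSpace_sum_four m
    have h20 : m.1 2 = - m.1 0 := by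
      rw [h1, h3] at hs
      linear_combination (norm := module) hs
    have h0 := a.isotropic (m.2.1 0) (w.2.1 0)
    rw [maslovForm_four, h1, h3]
    have h5 : ω.form (m.1 2) (w.1 0) = 0 := by rw [h20]; simp [h0]
    simp [h5]
  refine h.weilIndex_reduction h2 (maslovForm_isSymm _) hq f ?_ J ?_ ?_
  · intro v w
    rw [hqapp, maslovForm_three, maslovForm_three, maslovForm_four]
    simp only [hf0, hf1, hf2, hf3, map_add, LinearMap.add_apply]
    have e1 : ω.form (v.1.1 0 + v.1.1 1 + v.1.1 2) (w.1.1 0 + w.2.1 0) = 0 := by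
      rw [maslovSpace_sum_three]; simp
    have e2 : ω.form (v.2.1 0 + v.2.1 1 + v.2.1 2) (w.1.1 0 + w.2.1 0) = 0 := by
      rw [maslovSpace_sum_three]; simp
    have e3 : ω.form (v.2.1 0 + v.2.1 1 + v.2.1 2) (w.1.1 1 + w.1.1 2) = 0 := by
      rw [maslovSpace_sum_three]; simp
    have e4 : ω.form (v.2.1 0) (w.1.1 0 + w.1.1 1 + w.1.1 2) = 0 := by
      rw [maslovSpace_sum_three]; simp
    have a1 := a.isotropic (v.1.2.1 0) (w.1.2.1 0)
    have a2 := a.isotropic (v.1.2.1 0) (w.2.2.1 0)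
    have a3 := a.isotropic (v.2.2.1 0) (w.1.2.1 0)
    have a4 := a.isotropic (v.2.2.1 0) (w.2.2.1 0)
    have c1 := c.isotropic (v.2.2.1 1) (w.1.2.1 2)
    simp only [map_add, LinearMap.add_apply] at e1 e2 e3 e4
    linear_combination a1 + a2 + a4 + c1 - e1 - e2 - e3 + e4
  · intro x hx y hy
    rw [hJ x hx]
    have : y.1 1 = 0 := hy.1
    rw [this]; simp
  · intro w
    constructor
    · rintro ⟨x, rfl⟩ m hm
      rw [hJ m hm, hf1]
      have e1 : ω.form (m.1 2) (x.1.1 0 + x.1.1 1 + x.1.1 2) = 0 := by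
        rw [maslovSpace_sum_three]; simp
      have h1 : m.1 1 = 0 := hm.1
      have h3 : m.1 3 = 0 := hm.2
      have hs := maslovSpace_sum_four m
      have h20 : m.1 2 = - m.1 0 := by
        rw [h1, h3] at hs
        linear_combination (norm := module) hs
      have h5 : ω.form (m.1 2) (x.1.1 0) = 0 := by
        rw [h20]; simp [a.isotropic (m.2.1 0) (x.1.2.1 0)]
      have h6 := c.isotropic (m.2.1 2) (x.1.2.1 2)
      simp only [map_add] at e1
      linear_combination e1 - h5 - h6
    · intro hw
      have hw1 : w.1 1 ∈ a.1 ⊔ c.1 := by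
        refine orthogonal_inf_le a c ?_
        rintro x ⟨hxa, hxc⟩
        let m : maslovSpace ![a, b, c, d] := ⟨![-x, 0, x, 0], by
          intro i
          fin_cases i
          · exact a.1.neg_mem hxa
          · exact b.1.zero_mem
          · exact hxc
          · exact d.1.zero_mem, by simp [Fin.sum_univ_four]⟩
        have hm : m ∈ J := ⟨rfl, rfl⟩
        have := hw m hm
        rw [hJ m hm] at this
        exact this
      obtain ⟨x, hx, z, hz, hxz⟩ := Submodule.mem_sup.1 hw1
      -- With w₁ = x + z (counting from 0), x ∈ a and z ∈ c, the first triangle closes up w₁; the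
      -- second is what remains of `w`.
      refine ⟨(⟨![-x, w.1 1, -z], ?_, ?_⟩, ⟨![w.1 0 + x, w.1 2 + z, w.1 3], ?_, ?_⟩), ?_⟩
      · intro i
        fin_cases i
        · exact a.1.neg_mem hx
        · exact w.2.1 1
        · exact c.1.neg_mem hz
      · rw [Fin.sum_univ_three]
        change -x + w.1 1 + -z = 0
        rw [← hxz]; abel
      · intro i
        fin_cases i
        · exact a.1.add_mem (w.2.1 0) hx
        · exact c.1.add_mem (w.2.1 2) hz
        · exact w.2.1 3
      · rw [Fin.sum_univ_three]
        change (w.1 0 + x) + (w.1 2 + z) + w.1 3 = 0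
        rw [← maslovSpace_sum_four w, ← hxz]; abel
      · refine Subtype.ext (funext fun i => ?_)
        fin_cases i
        · exact (hf0 _).trans (by simp)
        · exact (hf1 _).trans (by simp)
        · exact (hf2 _).trans (by simp)
        · exact (hf3 _).trans (by simp)

/-- The cocycle property of the Maslov index. -/
lemma IsWeilSymbol.gammaTau_cocycle (h : IsWeilSymbol.{u, v} ψ γ₁) (h2 : (2 : F) ≠ 0)
    (a b c d : Gr ω) :
    gammaTau ψ ![a, b, c] * gammaTau ψ ![a, c, d] =
      gammaTau ψ ![a, b, d] * gammaTau ψ ![b, c, d] := by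
  rw [h.gammaTau_chain h2, h.gammaTau_rotate_four h2, ← h.gammaTau_chain h2 b c d a,
    h.gammaTau_rotate_three h2 a b d, mul_comm]

/-- Adding the two coordinates in `a` is a surjective isometry. -/
lemma IsWeilSymbol.gammaTau_merge (h : IsWeilSymbol.{u, v} ψ γ₁) (h2 : (2 : F) ≠ 0)
    (a b c : Gr ω) : gammaTau ψ ![a, a, b, c] = gammaTau ψ ![a, b, c] := by
  let f : maslovSpace ![a, a, b, c] →ₗ[F] maslovSpace ![a, b, c] :=
    maslovLift ![maslovCoord _ 0 + maslovCoord _ 1, maslovCoord _ 2, maslovCoord _ 3]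
      (by
        intro i x
        fin_cases i
        · exact a.1.add_mem (x.2.1 0) (x.2.1 1)
        · exact x.2.1 2
        · exact x.2.1 3)
      (by
        intro x
        rw [Fin.sum_univ_three]
        exact maslovSpace_sum_four x)
  refine h.weilIndex_pullback h2 _ _ f ?_ ?_
  · intro y
    refine ⟨⟨![y.1 0, 0, y.1 1, y.1 2], ?_, ?_⟩, ?_⟩
    · intro i
      fin_cases i
      · exact y.2.1 0
      · exact a.1.zero_mem
      · exact y.2.1 1
      · exact y.2.1 2
    · rw [Fin.sum_univ_four]
      simpa using maslovSpace_sum_three y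
    · ext i
      fin_cases i
      · exact add_zero _
      · rfl
      · rfl
  · intro v w
    rw [maslovForm_three, maslovForm_four]
    change _ = ω.form (v.1 3) (w.1 2)
    have hv : ω.form (v.1 0 + v.1 1 + v.1 2 + v.1 3) (w.1 0 + w.1 1) = 0 := by
      rw [maslovSpace_sum_four v]; simp
    have a1 := a.isotropic (v.2.1 0) (w.2.1 0)
    have a2 := a.isotropic (v.2.1 1) (w.2.1 1)
    have a3 : ω.form (v.1 0) (w.1 1) = 0 := a.isotropic (v.2.1 0) (w.2.1 1)
    simp only [map_add, LinearMap.add_apply] at hv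
    linear_combination hv - a1 - a2 - a3

/-- In a triple summing to zero, applying `g` to the first components eliminates the graph
coordinate and leaves a relation between vectors of ga, gc, d and b. The two Maslov forms correspond
up to sign, the sign coming from the negated form on the first factor of V̄ ⊕ V. -/
lemma IsWeilSymbol.gammaTau_graph_prod (h : IsWeilSymbol.{u, v} ψ γ₁) (h2 : (2 : F) ≠ 0)
    (g : Sp ω) (a b c d : Gr ω) :
    gammaTau ψ ![graph g, Gr.prod a b, Gr.prod c d] *
      gammaTau ψ ![a.map g, c.map g, d, b] = 1 := by
  let p (i : Fin 3) := LinearMap.fst F V V ∘ₗ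
    maslovCoord ![graph g, Gr.prod a b, Gr.prod c d] i
  let r (i : Fin 3) := LinearMap.snd F V V ∘ₗ
    maslovCoord ![graph g, Gr.prod a b, Gr.prod c d] i
  have hsum : ∀ x : maslovSpace ![graph g, Gr.prod a b, Gr.prod c d],
      g.1 (x.1 1).1 + g.1 (x.1 2).1 = (x.1 1).2 + (x.1 2).2 := by
    intro x
    have hg : (x.1 0).2 = g.1 (x.1 0).1 := (LinearMap.mem_graph_iff _ _).1 (x.2.1 0)
    have hs := maslovSpace_sum_three x
    have hs1 : (x.1 0).1 + (x.1 1).1 + (x.1 2).1 = 0 := congrArg Prod.fst hs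
    have hs2 : (x.1 0).2 + (x.1 1).2 + (x.1 2).2 = 0 := congrArg Prod.snd hs
    have hs3 := congrArg g.1 hs1
    rw [map_add, map_add, map_zero] at hs3
    rw [hg] at hs2
    linear_combination (norm := module) hs3 - hs2
  let f : maslovSpace ![graph g, Gr.prod a b, Gr.prod c d] →ₗ[F]
      maslovSpace ![a.map g, c.map g, d, b] :=
    maslovLift ![(g.1 : V →ₗ[F] V) ∘ₗ p 1, (g.1 : V →ₗ[F] V) ∘ₗ p 2, - r 2, - r 1]
      (by
        intro i x
        fin_cases i
        · exact ⟨_, (x.2.1 1).1, rfl⟩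
        · exact ⟨_, (x.2.1 2).1, rfl⟩
        · exact d.1.neg_mem (x.2.1 2).2
        · exact b.1.neg_mem (x.2.1 1).2)
      (by
        intro x
        rw [Fin.sum_univ_four]
        change g.1 (x.1 1).1 + g.1 (x.1 2).1 + -(x.1 2).2 + -(x.1 1).2 = 0
        rw [hsum x]; abel)
  have hf0 : ∀ x, (f x).1 0 = g.1 (x.1 1).1 := fun _ => rfl
  have hf1 : ∀ x, (f x).1 1 = g.1 (x.1 2).1 := fun _ => rfl
  have hf2 : ∀ x, (f x).1 2 = -(x.1 2).2 := fun _ => rfl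
  have hf3 : ∀ x, (f x).1 3 = -(x.1 1).2 := fun _ => rfl
  have hn : (-maslovForm ![a.map g, c.map g, d, b]).IsSymm :=
    (maslovForm_isSymm _).neg
  have key : gammaTau ψ ![graph g, Gr.prod a b, Gr.prod c d] =
      weilIndex ψ (-maslovForm ![a.map g, c.map g, d, b]) hn := by
    refine h.weilIndex_pullback h2 _ _ f ?_ ?_
    · intro y
      obtain ⟨a', ha', hga⟩ := y.2.1 0
      obtain ⟨c', hc', hgc⟩ := y.2.1 1
      have hga' : g.1 a' = y.1 0 := hga
      have hgc' : g.1 c' = y.1 1 := hgc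
      -- The graph coordinate is forced by the vanishing of the sum; it lies on Γ_g because `y` sums
      -- to zero.
      refine ⟨⟨![(-(a' + c'), y.1 2 + y.1 3), (a', - y.1 3), (c', - y.1 2)], ?_, ?_⟩, ?_⟩
      · intro i
        fin_cases i
        · refine (LinearMap.mem_graph_iff _ _).2 ?_
          change y.1 2 + y.1 3 = g.1 (-(a' + c'))
          rw [map_neg, map_add, hga', hgc', ← sub_eq_zero, ← maslovSpace_sum_four y]
          abel
        · exact ⟨ha', b.1.neg_mem (y.2.1 3)⟩
        · exact ⟨hc', d.1.neg_mem (y.2.1 2)⟩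
      · rw [Fin.sum_univ_three]
        refine Prod.ext ?_ ?_
        · change -(a' + c') + a' + c' = 0
          abel
        · change (y.1 2 + y.1 3) + - y.1 3 + - y.1 2 = 0
          abel
      · refine Subtype.ext (funext fun i => ?_)
        fin_cases i
        · exact hga'
        · exact hgc'
        · exact (hf2 _).trans (neg_neg _)
        · exact (hf3 _).trans (neg_neg _)
    · intro v w
      rw [LinearMap.neg_apply, LinearMap.neg_apply, maslovForm_three, maslovForm_four,
        SymplecticForm.double_apply, hf0, hf1, hf2, hf3, hf1 w, hf2 w]
      have e1 : ω.form (g.1 (v.1 2).1) (g.1 (w.1 1).1) = ω.form (v.1 2).1 (w.1 1).1 := g.2 _ _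
      have e2 : ω.form ((v.1 2).2 + (v.1 1).2) (g.1 (w.1 1).1 + g.1 (w.1 2).1) =
        ω.form ((v.1 2).2 + (v.1 1).2) ((w.1 1).2 + (w.1 2).2) := by rw [hsum]
      have e3 := d.isotropic (v.2.1 2).2 (w.2.1 2).2
      have e4 := b.isotropic (v.2.1 1).2 (w.2.1 1).2
      rw [e1]
      simp only [map_add, map_neg, LinearMap.add_apply, LinearMap.neg_apply] at e2 ⊢
      linear_combination -e2 - e3 - e4
  rw [key, mul_comm]
  exact h.weilIndex_mul_neg h2 _ _ fun _ _ => rfl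

omit [FiniteDimensional F V] in
-- The graph coordinate has equal components, so in a triple summing to zero the component
-- differences of the other two coordinates are opposite and lie in ℓ ∩ ℓ'. Hence the Maslov form is
-- already zero.
lemma IsWeilSymbol.gammaTau_graph_one_double (h : IsWeilSymbol.{u, v} ψ γ₁)
    (ℓ ℓ' : Gr ω) :
    gammaTau ψ ![graph (1 : Sp ω), ℓ.double, ℓ'.double] = 1 := by
  refine h.weilIndex_eq_one _ ?_
  ext v w
  rw [maslovForm_three, SymplecticForm.double_apply]
  have hv : (v.1 0).2 = (v.1 0).1 := (LinearMap.mem_graph_iff _ _).1 (v.2.1 0)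
  have hw : (w.1 0).2 = (w.1 0).1 := (LinearMap.mem_graph_iff _ _).1 (w.2.1 0)
  have hs := maslovSpace_sum_three v
  have hs1 : (v.1 0).1 + (v.1 1).1 + (v.1 2).1 = 0 := congrArg Prod.fst hs
  have hs2 : (v.1 0).2 + (v.1 1).2 + (v.1 2).2 = 0 := congrArg Prod.snd hs
  have hs' := maslovSpace_sum_three w
  have hs1' : (w.1 0).1 + (w.1 1).1 + (w.1 2).1 = 0 := congrArg Prod.fst hs'
  have hs2' : (w.1 0).2 + (w.1 1).2 + (w.1 2).2 = 0 := congrArg Prod.snd hs'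
  rw [hv] at hs2
  rw [hw] at hs2'
  -- The form ⟨s, q⟩ - ⟨r, p⟩ is written as ⟨s - r, q⟩ + ⟨r, q - p⟩. Here s - r and q lie in ℓ,
  -- while r and q - p lie in ℓ'.
  have d1 : (v.1 2).2 - (v.1 2).1 = (v.1 1).1 - (v.1 1).2 := by
    linear_combination (norm := module) hs2 - hs1
  have d2 : (w.1 1).2 - (w.1 1).1 = (w.1 2).1 - (w.1 2).2 := by
    linear_combination (norm := module) hs2' - hs1'
  have e1 : ω.form ((v.1 2).2 - (v.1 2).1) (w.1 1).2 = 0 := by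
    rw [d1]
    exact ℓ.isotropic (ℓ.1.sub_mem (v.2.1 1).1 (v.2.1 1).2) (w.2.1 1).2
  have e2 : ω.form (v.1 2).1 ((w.1 1).2 - (w.1 1).1) = 0 := by
    rw [d2]
    exact ℓ'.isotropic (v.2.1 2).1 (ℓ'.1.sub_mem (w.2.1 2).1 (w.2.1 2).2)
  simp only [map_sub, LinearMap.sub_apply] at e1 e2
  change _ = (0 : F)
  linear_combination e1 + e2

theorem IsWeilSymbol.Theta_eq (h : IsWeilSymbol.{u, v} ψ γ₁) (h2 : (2 : F) ≠ 0)
    (ℓ ℓ' : Gr ω) (x : Mp ψ ω) : Theta ℓ x = Theta ℓ' x := by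
  have hc := h.gammaTau_cocycle h2 (graph x.g) (graph (1 : Sp ω)) ℓ.double ℓ'.double
  rw [h.gammaTau_graph_one_double, mul_one] at hc
  have hd := h.gammaTau_graph_prod h2 x.g ℓ ℓ ℓ' ℓ'
  rw [Gr.prod_self, Gr.prod_self, ← h.gammaTau_rotate_four h2] at hd
  rw [Theta, Theta, x.change ℓ ℓ', ← hc]
  -- By `hd`, the factor from the change of `t` and γ(τ(Γ_g, ℓ⊕ℓ, ℓ'⊕ℓ')) are inverse to each other.
  linear_combination -(x.t ℓ * gammaTau ψ ![graph x.g, graph 1, ℓ.double]) * hd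

end Gamma

end Metaplectic

namespace Metaplectic

universe u v

/-! ### Local constancy of the Weil index in families of forms -/

section Deformation

open Filter Topology

variable {F : Type u} [Field F] [TopologicalSpace F] {ψ : AddChar F Circle} {γ₁ : F → ℂ}
  {A : Type v} [AddCommGroup A] [Module F A] [FiniteDimensional F A]

/-- Splitting off the line spanned by an anisotropic vector `e`. -/
lemma IsWeilSymbol.weilIndex_split (h : IsWeilSymbol.{u, v} ψ γ₁) (h2 : (2 : F) ≠ 0)
    {q : LinearMap.BilinForm F A} (hq : q.IsSymm) {e : A} (he : q e e ≠ 0) (S : Submodule F A)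
    (hS : ∀ x, ∃ c : F, x - c • e ∈ S) {q' : LinearMap.BilinForm F S} (hq' : q'.IsSymm)
    (hqq : ∀ x y, q' x y = q x y - q x e * q y e * (q e e)⁻¹) :
    weilIndex ψ q hq = γ₁ (q e e) * weilIndex ψ q' hq' := by
  obtain ⟨n, w, hw, hs⟩ := IsWeilSymbol.exists_orthogonal_family h2 hq'
  -- The projection of `w i` to eᗮ; `q'` is `q` evaluated after this projection. Only S + Fe = A is
  -- required, not S = eᗮ, so that one `S` can serve a whole family of forms.
  let z : Fin n → A := fun i => (w i : A) - (q (w i) e * (q e e)⁻¹) • e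
  have hze : ∀ i, q (z i) e = 0 := by
    intro i
    simp only [z, map_sub, LinearMap.sub_apply, map_smul, LinearMap.smul_apply, smul_eq_mul]
    field_simp
    ring
  have hzz : ∀ i j, q (z i) (z j) = q' (w i) (w j) := by
    intro i j
    have h1 : q (z i) (z j) = q (z i) (w j) := by
      conv_lhs => rw [show z j = (w j : A) - (q (w j) e * (q e e)⁻¹) • e from rfl]
      rw [map_sub, map_smul, hze, smul_zero, sub_zero]
    rw [h1, hqq]
    simp only [z, map_sub, LinearMap.sub_apply, map_smul, LinearMap.smul_apply, smul_eq_mul]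
    rw [hq.eq e (w j)]
    ring
  rw [h.weilIndex_eq q' hq' w hw (by rw [hs, top_sup_eq]),
    h.weilIndex_eq q hq (ι := Unit ⊕ Fin n) (Sum.elim (fun _ => e) z)]
  · simp [hzz]
  · rintro (i | i) (j | j) hij
    · exact absurd (by simp) hij
    · exact (hq.eq _ _).trans (hze j)
    · exact hze i
    · exact (hzz i j).trans (hw i j (by simpa using hij))
  · rw [eq_top_iff]
    intro x _
    refine Submodule.mem_sup_left ?_
    have heT : e ∈ Submodule.span F (Set.range (Sum.elim (fun _ : Unit => e) z)) :=
      Submodule.subset_span ⟨Sum.inl (), rfl⟩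
    have hwT : ∀ i, (w i : A) ∈ Submodule.span F (Set.range (Sum.elim (fun _ : Unit => e) z)) := by
      intro i
      have h1 : (w i : A) = z i + (q (w i) e * (q e e)⁻¹) • e := by simp [z]
      rw [h1]
      exact Submodule.add_mem _ (Submodule.subset_span ⟨Sum.inr i, rfl⟩)
        (Submodule.smul_mem _ _ heT)
    have hST : S ≤ Submodule.span F (Set.range (Sum.elim (fun _ : Unit => e) z)) := by
      have h1 : S = Submodule.map S.subtype (Submodule.span F (Set.range w)) := by
        rw [hs, Submodule.map_top, Submodule.range_subtype]
      rw [h1, Submodule.map_span, Submodule.span_le]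
      rintro _ ⟨_, ⟨i, rfl⟩, rfl⟩
      exact hwT i
    obtain ⟨c, hc⟩ := hS x
    have := Submodule.add_mem _ (hST hc) (Submodule.smul_mem _ c heT)
    simpa using this

omit [FiniteDimensional F A] in
-- The vectors `e` and s·e span the same line, and both compute the Weil index of `q` on it.
lemma IsWeilSymbol.apply_sq_mul (h : IsWeilSymbol.{u, v} ψ γ₁)
    {q : LinearMap.BilinForm F A} (hq : q.IsSymm) (e : A) {s : F} (hs : s ≠ 0) :
    γ₁ (s * s * q e e) = γ₁ (q e e) := by
  let S : Submodule F A := Submodule.span F {e}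
  let q' : LinearMap.BilinForm F S := q.compl₁₂ S.subtype S.subtype
  have hq' : q'.IsSymm := ⟨fun x y => hq.eq x y⟩
  have heS : e ∈ S := Submodule.mem_span_singleton_self e
  have key : ∀ c : F, c ≠ 0 → Submodule.span F (Set.range fun _ : Unit => c • (⟨e, heS⟩ : S)) = ⊤ := by
    intro c hc
    rw [eq_top_iff]
    rintro ⟨x, hx⟩ -
    obtain ⟨a, rfl⟩ := Submodule.mem_span_singleton.1 hx
    rw [Set.range_const]
    refine Submodule.mem_span_singleton.2 ⟨a * c⁻¹, ?_⟩
    ext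
    simp [smul_smul, hc]
  have h1 := h.weilIndex_eq q' hq' (ι := Unit) (fun _ => s • (⟨e, heS⟩ : S))
    (fun i j hij => absurd rfl hij) (by rw [key s hs, top_sup_eq])
  have h3 := h.weilIndex_eq q' hq' (ι := Unit) (fun _ => (1 : F) • (⟨e, heS⟩ : S))
    (fun i j hij => absurd rfl hij) (by rw [key 1 one_ne_zero, top_sup_eq])
  rw [h1] at h3
  simpa [q', mul_assoc] using h3

/-- The Weil index is locally constant in continuous families of symmetric forms of constant
kernel. -/
lemma IsWeilSymbol.eventually_weilIndex_eq [IsTopologicalRing F] [ContinuousInv₀ F]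
    (h : IsWeilSymbol.{u, v} ψ γ₁) (h2 : (2 : F) ≠ 0)
    (hsq : ∀ᶠ x : F in 𝓝 1, ∃ s, s ≠ 0 ∧ x = s * s) {X : Type*} (l : Filter X) :
    ∀ (n : ℕ) (A : Type v) [AddCommGroup A] [Module F A] [FiniteDimensional F A],
      Module.finrank F A = n → ∀ (q : X → LinearMap.BilinForm F A) (hq : ∀ x, (q x).IsSymm)
      (q₀ : LinearMap.BilinForm F A) (hq₀ : q₀.IsSymm),
      (∀ v w, Tendsto (fun x => q x v w) l (𝓝 (q₀ v w))) →
      (∀ᶠ x in l, ∀ v, q₀ v = 0 → q x v = 0) →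
      ∀ᶠ x in l, weilIndex ψ (q x) (hq x) = weilIndex ψ q₀ hq₀ := by
  intro n
  induction n using Nat.strong_induction_on with
  | _ n ih =>
  intro A _ _ _ hn q hq q₀ hq₀ hlim hker
  by_cases h0 : q₀ = 0
  · filter_upwards [hker] with x hx
    rw [h.weilIndex_eq_one hq₀ h0, h.weilIndex_eq_one (hq x)]
    exact LinearMap.ext fun v => hx v (by rw [h0]; rfl)
  obtain ⟨e, he⟩ : ∃ e, q₀ e e ≠ 0 := by
    have : Invertible (2 : F) := invertibleOfNonzero h2
    obtain ⟨e, he⟩ := LinearMap.BilinForm.exists_bilinForm_self_ne_zero h0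
      (LinearMap.BilinForm.isSymm_iff.1 hq₀)
    exact ⟨e, he⟩
  let S : Submodule F A := LinearMap.ker (q₀ e)
  have hS : ∀ x, ∃ c : F, x - c • e ∈ S := fun x => ⟨q₀ e x * (q₀ e e)⁻¹, by
    simp [S, he]⟩
  have hSn : Module.finrank F S < n := by
    rw [← hn]
    refine Submodule.finrank_lt fun htop => he ?_
    have : e ∈ S := by rw [htop]; trivial
    exact this
  -- `S` is the orthogonal of `e` for `q₀` but not for `q x`; the correction term makes up for this,
  -- is continuous in the form, and vanishes for `q₀`.
  let red (B : LinearMap.BilinForm F A) : LinearMap.BilinForm F S :=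
    B.compl₁₂ S.subtype S.subtype -
      (B e e)⁻¹ • (LinearMap.mul F F).compl₁₂ ((B.flip e) ∘ₗ S.subtype) ((B.flip e) ∘ₗ S.subtype)
  have hred : ∀ B x y, red B x y = B x y - B x e * B y e * (B e e)⁻¹ := by
    intro B x y
    simp [red]; ring
  have hreds : ∀ B : LinearMap.BilinForm F A, B.IsSymm → (red B).IsSymm := fun B hB =>
    ⟨fun x y => by rw [hred, hred, hB.eq x y]; ring⟩
  have hsplit₀ := h.weilIndex_split h2 hq₀ he S hS (hreds _ hq₀) (hred q₀)
  have hrec := ih _ hSn S rfl (fun x => red (q x)) (fun x => hreds _ (hq x)) (red q₀)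
    (hreds _ hq₀) (fun v w => by
      simp only [hred]
      exact (hlim _ _).sub (((hlim _ _).mul (hlim _ _)).mul ((hlim e e).inv₀ he))) (by
      -- Kernel condition for the reduced forms: a vector in the kernel of `red q₀` is orthogonal to
      -- `S` and to `e`, hence in the kernel of `q₀`, hence in that of `q x`.
      filter_upwards [hker] with x hx v hv
      have h3 : q₀ v = 0 := by
        ext y
        obtain ⟨c, hc⟩ := hS y
        have h4 : red q₀ v ⟨_, hc⟩ = 0 := by rw [hv]; rfl
        have h5 : q₀ v e = 0 := (hq₀.eq _ _).trans v.2
        rw [hred, h5] at h4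
        simpa [h5] using h4
      ext y
      rw [hred, hx v h3]
      simp)
  -- The ratio is eventually a nonzero square, so the split-off lines have equal Weil index.
  have hratio : Tendsto (fun x => q x e e * (q₀ e e)⁻¹) l (𝓝 1) := by
    have := (hlim e e).mul_const (q₀ e e)⁻¹
    rwa [mul_inv_cancel₀ he] at this
  filter_upwards [hrec, hratio.eventually hsq] with x hx hx'
  obtain ⟨s, hs, hs'⟩ := hx'
  have h6 : q x e e = s * s * q₀ e e := by rw [← hs']; field_simp
  have hxe : q x e e ≠ 0 := by rw [h6]; exact mul_ne_zero (mul_ne_zero hs hs) he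
  rw [h.weilIndex_split h2 (hq x) hxe S hS (hreds _ (hq x)) (hred (q x)), hx, hsplit₀, h6,
    h.apply_sq_mul hq₀ e hs]

end Deformation

/-! ### The regular set det(g - 1) ≠ 0: Cayley form and local constancy of Θ -/

section Regular

open Filter Topology

variable {F : Type u} [Field F] [TopologicalSpace F] {ψ : AddChar F Circle} {γ₁ : F → ℂ}
  {V : Type v} [AddCommGroup V] [Module F V] [FiniteDimensional F V] {ω : SymplecticForm F V}

omit [TopologicalSpace F] in
/-- Every Lagrangian subspace has a Lagrangian complement. -/
lemma exists_transversal (ℓ : Gr ω) : ∃ ℓ' : Gr ω, ℓ.1 ⊓ ℓ'.1 = ⊥ := by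
  let P : Set (Submodule F V) := {M | (∀ x ∈ M, ∀ y ∈ M, ω.form x y = 0) ∧ ℓ.1 ⊓ M = ⊥}
  have hP : P.Nonempty := ⟨⊥, by simp +contextual, inf_bot_eq _⟩
  obtain ⟨M, hM, hmax⟩ := wellFounded_gt.has_min P hP
  refine ⟨⟨M, le_antisymm ?_ fun x hx y hy => hM.1 y hy x hx⟩, hM.2⟩
  -- `M` is a maximal isotropic subspace meeting ℓ trivially. A vector of Mᗮ outside ℓ + M could be
  -- adjoined to it.
  have hle : ω.form.orthogonal M ≤ ℓ.1 ⊔ M := by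
    intro v hv
    by_contra hvn
    have hvM : ∀ x ∈ M, ω.form x v = 0 := fun x hx => hv x hx
    refine hmax (M ⊔ Submodule.span F {v}) ⟨?_, ?_⟩ ?_
    · intro x hx y hy
      obtain ⟨x', hx', a, ha, rfl⟩ := Submodule.mem_sup.1 hx
      obtain ⟨y', hy', b, hb, rfl⟩ := Submodule.mem_sup.1 hy
      obtain ⟨a, rfl⟩ := Submodule.mem_span_singleton.1 ha
      obtain ⟨b, rfl⟩ := Submodule.mem_span_singleton.1 hb
      have h1 : ω.form v y' = 0 := by rw [ω.neg, hvM y' hy', neg_zero]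
      simp [hM.1 x' hx' y' hy', hvM x' hx', h1, ω.alt.self_eq_zero]
    · rw [eq_bot_iff]
      rintro x ⟨hxl, hx⟩
      obtain ⟨x', hx', a, ha, rfl⟩ := Submodule.mem_sup.1 hx
      obtain ⟨a, rfl⟩ := Submodule.mem_span_singleton.1 ha
      by_cases ha0 : a = 0
      · subst ha0
        rw [zero_smul, add_zero] at hxl ⊢
        rw [← hM.2]
        exact ⟨hxl, hx'⟩
      · refine absurd ?_ hvn
        have h1 : v = a⁻¹ • (x' + a • v) - a⁻¹ • x' := by
          rw [smul_add, smul_smul, inv_mul_cancel₀ ha0]; module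
        rw [h1]
        exact Submodule.sub_mem _ (Submodule.mem_sup_left (ℓ.1.smul_mem _ hxl))
          (Submodule.mem_sup_right (M.smul_mem _ hx'))
    · refine lt_of_le_of_ne le_sup_left fun heq => hvn ?_
      have : v ∈ M := by
        rw [heq]
        exact Submodule.mem_sup_right (Submodule.mem_span_singleton_self v)
      exact Submodule.mem_sup_right this
  intro v hv
  obtain ⟨x, hx, m, hm, rfl⟩ := Submodule.mem_sup.1 (hle hv)
  have h1 : ∀ y ∈ M, ω.form y x = 0 := by
    intro y hy
    have h3 : ω.form y (x + m) = 0 := hv y hy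
    rwa [map_add, hM.1 y hy m hm, add_zero] at h3
  -- The ℓ-component `x` of a vector of Mᗮ is orthogonal to ℓ and to `M`, hence to Mᗮ ⊆ ℓ + M. So it
  -- lies in Mᗮᗮ = M.
  have h3 : x ∈ ω.form.orthogonal (ω.form.orthogonal M) := by
    intro y hy
    obtain ⟨x', hx', m', hm', rfl⟩ := Submodule.mem_sup.1 (hle hy)
    change ω.form (x' + m') x = 0
    rw [map_add, LinearMap.add_apply, ℓ.isotropic hx' hx, h1 m' hm', add_zero]
  rw [LinearMap.BilinForm.orthogonal_orthogonal ω.nondeg ω.alt.isRefl] at h3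
  exact M.add_mem h3 hm

/-- The value of `Θ` in terms of an auxiliary Lagrangian `ℓ'`. -/
lemma IsWeilSymbol.Theta_eq_mul (h : IsWeilSymbol.{u, v} ψ γ₁) (h2 : (2 : F) ≠ 0)
    (ℓ ℓ' : Gr ω) (x : Mp ψ ω) :
    Theta ℓ x = x.t ℓ * gammaTau ψ ![ℓ, ℓ.map x.g, ℓ'] *
      (gammaTau ψ ![graph x.g, graph (1 : Sp ω), Gr.prod ℓ ℓ'] *
        gammaTau ψ ![graph (1 : Sp ω), ℓ.double, Gr.prod ℓ ℓ']) := by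
  have hc := h.gammaTau_cocycle h2 (graph x.g) (graph (1 : Sp ω)) ℓ.double (Gr.prod ℓ ℓ')
  -- The quadruple here is (gℓ, gℓ, ℓ', ℓ), which merges to a triple and rotates to (ℓ, gℓ, ℓ').
  have hd := h.gammaTau_graph_prod h2 x.g ℓ ℓ ℓ ℓ'
  rw [Gr.prod_self, h.gammaTau_merge h2,
    ← h.gammaTau_rotate_three h2 ℓ (ℓ.map x.g) ℓ'] at hd
  rw [Theta, ← hc]
  linear_combination -(x.t ℓ * gammaTau ψ ![graph x.g, graph 1, ℓ.double]) * hd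

/-- The form on `ℓ ⊕ ℓ'` which represents `τ(Γ_g, Γ_1, ℓ ⊕ ℓ')` when `R = (g - 1)⁻¹`. -/
def cayleyForm (ω : SymplecticForm F V) (D : Submodule F (V × V)) (R : V →ₗ[F] V) :
    LinearMap.BilinForm F D :=
  let δ := (LinearMap.snd F V V - LinearMap.fst F V V) ∘ₗ D.subtype
  ω.form.compl₁₂ δ (R ∘ₗ δ - LinearMap.fst F V V ∘ₗ D.subtype)

omit [TopologicalSpace F] [FiniteDimensional F V] in
lemma cayleyForm_apply (D : Submodule F (V × V)) (R : V →ₗ[F] V) (v w : D) :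
    cayleyForm ω D R v w =
      ω.form (v.1.2 - v.1.1) (R (w.1.2 - w.1.1) - w.1.1) := rfl

omit [TopologicalSpace F] [FiniteDimensional F V] in
/-- The isomorphism of `ℓ ⊕ ℓ'` with the Maslov space of `Γ_g, Γ_1, ℓ ⊕ ℓ'`. -/
lemma exists_cayleyForm_pullback (g : Sp ω) (D : Gr ω.double) {R : V →ₗ[F] V}
    (hR : ∀ y, g.1 (R y) - R y = y) :
    ∃ f : D.1 →ₗ[F] maslovSpace ![graph g, graph (1 : Sp ω), D],
      (∀ v, (f v).1 0 = (-R (v.1.2 - v.1.1), -g.1 (R (v.1.2 - v.1.1)))) ∧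
      (∀ v, (f v).1 2 = v) ∧
      (∀ v w, cayleyForm ω D.1 R v w = maslovForm _ (f v) (f w)) := by
  let δ : D.1 →ₗ[F] V := (LinearMap.snd F V V - LinearMap.fst F V V) ∘ₗ D.1.subtype
  -- Solving (p, gp) + (s, s) + v = 0 gives (g - 1)p = -(v₂ - v₁), hence p = -R(v₂ - v₁) and s =
  -- R(v₂ - v₁) - v₁, which is `σ v`.
  let σ : D.1 →ₗ[F] V := R ∘ₗ δ - LinearMap.fst F V V ∘ₗ D.1.subtype
  have hσ : ∀ v, σ v = R (v.1.2 - v.1.1) - v.1.1 := fun _ => rfl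
  let f : D.1 →ₗ[F] maslovSpace ![graph g, graph (1 : Sp ω), D] :=
    maslovLift ![(-(R ∘ₗ δ)).prod (-((g.1 : V →ₗ[F] V) ∘ₗ R ∘ₗ δ)), σ.prod σ, D.1.subtype]
      (by
        intro i x
        fin_cases i
        · refine (LinearMap.mem_graph_iff _ _).2 ?_
          change -(g.1 (R (δ x))) = g.1 (-(R (δ x)))
          rw [map_neg]
        · exact (LinearMap.mem_graph_iff _ _).2 rfl
        · exact x.2)
      (by
        intro x
        rw [Fin.sum_univ_three]
        refine Prod.ext ?_ ?_
        · change -(R (x.1.2 - x.1.1)) + (R (x.1.2 - x.1.1) - x.1.1) + x.1.1 = 0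
          abel
        · change -(g.1 (R (x.1.2 - x.1.1))) + (R (x.1.2 - x.1.1) - x.1.1) + x.1.2 = 0
          linear_combination (norm := module) - hR (x.1.2 - x.1.1))
  refine ⟨f, fun _ => rfl, fun _ => rfl, fun v w => ?_⟩
  rw [maslovForm_three, cayleyForm_apply]
  change _ = ω.form v.1.2 (σ w) - ω.form v.1.1 (σ w)
  rw [hσ, ← LinearMap.sub_apply, ← map_sub]

omit [TopologicalSpace F] [FiniteDimensional F V] in
lemma cayleyForm_isSymm (g : Sp ω) (D : Gr ω.double) {R : V →ₗ[F] V}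
    (hR : ∀ y, g.1 (R y) - R y = y) : (cayleyForm ω D.1 R).IsSymm := by
  obtain ⟨f, -, -, hf⟩ := exists_cayleyForm_pullback g D hR
  exact ⟨fun x y => by rw [hf, hf, (maslovForm_isSymm _).eq]⟩

omit [TopologicalSpace F] [FiniteDimensional F V] in
-- The point is that the kernel does not depend on `g`. If `v` is in the kernel, its graph
-- coordinate is orthogonal to the Lagrangian `D`, hence lies in Γ_g ∩ D = 0, so R(v₂ - v₁) = 0.
lemma cayleyForm_eq_zero_iff (g : Sp ω) (D : Gr ω.double) {R : V →ₗ[F] V}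
    (hR : ∀ y, g.1 (R y) - R y = y) (hD : (graph g).1 ⊓ D.1 = ⊥) (v : D.1) :
    cayleyForm ω D.1 R v = 0 ↔ v.1.2 = v.1.1 := by
  obtain ⟨f, hf0, hf2, hf⟩ := exists_cayleyForm_pullback g D hR
  constructor
  · intro hv
    have h1 : ∀ w : D.1, ω.double.form w ((f v).1 0) = 0 := by
      intro w
      have h2 : cayleyForm ω D.1 R v w = 0 := by rw [hv]; rfl
      rw [(cayleyForm_isSymm g D hR).eq, hf, maslovForm_three, hf2] at h2
      have h3 : (f v).1 0 = - (f v).1 1 - (f v).1 2 := by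
        linear_combination (norm := module) maslovSpace_sum_three (f v)
      rw [h3, map_sub, map_neg, h2, hf2, D.isotropic w.2 v.2]
      simp
    have h4 : (f v).1 0 ∈ (graph g).1 ⊓ D.1 := by
      refine ⟨(f v).2.1 0, ?_⟩
      have h5 : ω.double.form.orthogonal D.1 ≤ D.1 := D.2.le
      exact h5 fun w hw => h1 ⟨w, hw⟩
    rw [hD, Submodule.mem_bot, hf0] at h4
    have h5 : R (v.1.2 - v.1.1) = 0 := neg_eq_zero.1 (congrArg Prod.fst h4)
    have h6 := hR (v.1.2 - v.1.1)
    rw [h5, map_zero, sub_zero] at h6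
    exact sub_eq_zero.1 h6.symm
  · intro hv
    ext w
    rw [cayleyForm_apply, hv]
    simp

/-- As g - 1 is injective, Γ_g ∩ Γ_1 = 0, so the third coordinate determines the whole triple and
the pullback map is onto. -/
lemma IsWeilSymbol.gammaTau_graph_eq_cayleyForm (h : IsWeilSymbol.{u, v} ψ γ₁)
    (h2 : (2 : F) ≠ 0) (g : Sp ω) (D : Gr ω.double) {R : V →ₗ[F] V}
    (hR : ∀ y, g.1 (R y) - R y = y) :
    gammaTau ψ ![graph g, graph (1 : Sp ω), D] =
      weilIndex ψ (cayleyForm ω D.1 R) (cayleyForm_isSymm g D hR) := by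
  obtain ⟨f, -, hf2, hf⟩ := exists_cayleyForm_pullback g D hR
  refine (h.weilIndex_pullback h2 _ _ f ?_ hf).symm
  intro y
  have hy0 : (y.1 0).2 = g.1 (y.1 0).1 := (LinearMap.mem_graph_iff _ _).1 (y.2.1 0)
  have hy1 : (y.1 1).2 = (y.1 1).1 := (LinearMap.mem_graph_iff _ _).1 (y.2.1 1)
  have hinj : ∀ z, g.1 z - z = 0 → z = 0 := by
    let T : V →ₗ[F] V := (g.1 : V →ₗ[F] V) - LinearMap.id
    have hsurj : Function.Surjective T := fun y => ⟨R y, hR y⟩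
    have := LinearMap.injective_iff_surjective.2 hsurj
    exact fun z hz => this (hz.trans (map_zero T).symm)
  refine ⟨⟨y.1 2, y.2.1 2⟩, ?_⟩
  set v : D.1 := ⟨y.1 2, y.2.1 2⟩
  have e2 : (f v).1 2 = y.1 2 := hf2 v
  set z := f v - y with hz
  have hz2 : z.1 2 = 0 := sub_eq_zero.2 e2
  have hs := maslovSpace_sum_three z
  have hz0 : (z.1 0).2 = g.1 (z.1 0).1 := (LinearMap.mem_graph_iff _ _).1 (z.2.1 0)
  have hz1 : (z.1 1).2 = (z.1 1).1 := (LinearMap.mem_graph_iff _ _).1 (z.2.1 1)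
  rw [hz2, add_zero] at hs
  have hs1 : (z.1 0).1 + (z.1 1).1 = 0 := congrArg Prod.fst hs
  have hs2 : (z.1 0).2 + (z.1 1).2 = 0 := congrArg Prod.snd hs
  rw [hz0, hz1] at hs2
  have h3 : (z.1 0).1 = 0 := hinj _ (by linear_combination (norm := module) hs2 - hs1)
  rw [h3, zero_add] at hs1
  rw [h3, map_zero] at hz0
  rw [hs1] at hz1
  refine sub_eq_zero.1 (Subtype.ext (funext fun i => ?_))
  fin_cases i
  · exact Prod.ext h3 hz0
  · exact Prod.ext hs1 hz1
  · exact hz2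

variable [IsTopologicalRing F] [ContinuousInv₀ F]

/-- `(g - 1)⁻¹` is a continuous function on the set where `det (g - 1) ≠ 0`. -/
lemma exists_inverse_sub_one (ψ : AddChar F Circle) (ω : SymplecticForm F V) :
    ∃ R : MpReg ψ ω → V →ₗ[F] V, (∀ x y, x.1.g.1 (R x y) - R x y = y) ∧
      ∀ v w, Continuous fun x => ω.form v (R x w) := by
  let b := Module.finBasis F V
  let N (x : MpReg ψ ω) : Matrix _ _ F :=
    LinearMap.toMatrix b b ((x.1.g.1 : V →ₗ[F] V) - LinearMap.id)
  have hN : ∀ x, IsUnit (N x).det := by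
    intro x
    rw [LinearMap.det_toMatrix]
    exact isUnit_iff_ne_zero.2 x.2
  have hgc : ∀ φ : (V →ₗ[F] V) →ₗ[F] F, Continuous fun x : MpReg ψ ω => φ x.1.g.1 := by
    intro φ
    let : TopologicalSpace (V →ₗ[F] V) := moduleTopology F (V →ₗ[F] V)
    have : IsModuleTopology F (V →ₗ[F] V) := ⟨rfl⟩
    have h1 : Continuous φ := IsModuleTopology.continuous_of_linearMap φ
    have h3 : Continuous fun g : Sp ω => (g.1 : V →ₗ[F] V) := continuous_induced_dom
    have h4 : Continuous fun x : Mp ψ ω => x.g :=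
      continuous_iff_le_induced.2 inf_le_left
    exact h1.comp (h3.comp (h4.comp continuous_subtype_val))
  have hNc : Continuous N := by
    refine continuous_matrix fun i j => ?_
    have h1 : (fun x => N x i j) = fun x : MpReg ψ ω =>
        ((LinearMap.proj j ∘ₗ LinearMap.proj i ∘ₗ (Matrix.ofLinearEquiv F).symm.toLinearMap) ∘ₗ
          (LinearMap.toMatrix b b).toLinearMap) (x.1.g.1 : V →ₗ[F] V) -
        LinearMap.toMatrix b b LinearMap.id i j := by
      ext x
      simp [N]
    rw [h1]
    exact (hgc _).sub continuous_const
  refine ⟨fun x => Matrix.toLin b b (N x)⁻¹, fun x y => ?_, fun v w => ?_⟩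
  · have h1 : Matrix.toLin b b (N x) ∘ₗ Matrix.toLin b b (N x)⁻¹ = LinearMap.id := by
      rw [← Matrix.toLin_mul, Matrix.mul_nonsing_inv _ (hN x), Matrix.toLin_one]
    have h3 := LinearMap.congr_fun h1 y
    rw [LinearMap.comp_apply, Matrix.toLin_toMatrix] at h3
    exact h3
  · have h1 : Continuous fun x => (N x)⁻¹ := by
      -- Cramer's rule makes the inverse visibly continuous where the determinant is nonzero.
      have h3 : (fun x => (N x)⁻¹) = fun x => ((N x).det)⁻¹ • (N x).adjugate := by
        ext1 x
        rw [Matrix.inv_def, Ring.inverse_eq_inv']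
      rw [h3]
      exact (hNc.matrix_det.inv₀ fun x => (hN x).ne_zero).smul hNc.matrix_adjugate
    simp only [Matrix.toLin_apply, map_sum, map_smul, smul_eq_mul]
    refine continuous_finsetSum _ fun i _ => ?_
    exact ((continuous_apply i).comp (h1.matrix_mulVec continuous_const)).mul continuous_const

/-- In `Theta_eq_mul` with ℓ' transversal to gℓ at the base point, the first factor is constant on
the open set `S`, the second is the index of a continuous family of Cayley forms of constant kernel,
and the third is independent of the point. -/
theorem IsWeilSymbol.isLocallyConstant_Theta (h : IsWeilSymbol.{u, v} ψ γ₁) (h2 : (2 : F) ≠ 0)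
    (hsq : ∀ᶠ x : F in 𝓝 1, ∃ s, s ≠ 0 ∧ x = s * s) (ℓ : Gr ω) :
    IsLocallyConstant (fun x : MpReg ψ ω => Theta ℓ x.1) := by
  rw [IsLocallyConstant.iff_eventually_eq]
  intro x₀
  obtain ⟨ℓ', hℓ'⟩ := exists_transversal (ℓ.map x₀.1.g)
  obtain ⟨R, hR, hRc⟩ := exists_inverse_sub_one ψ ω
  let D := Gr.prod ℓ ℓ'
  have hD : ∀ g : Sp ω, (ℓ.map g).1 ⊓ ℓ'.1 = ⊥ → (graph g).1 ⊓ D.1 = ⊥ := by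
    intro g hg
    rw [eq_bot_iff]
    rintro ⟨a, b⟩ ⟨hab, ha, hb⟩
    have hab' : b = g.1 a := (LinearMap.mem_graph_iff _ _).1 hab
    subst hab'
    have h3 : g.1 a ∈ (ℓ.map g).1 ⊓ ℓ'.1 := ⟨⟨a, ha, rfl⟩, hb⟩
    rw [hg, Submodule.mem_bot] at h3
    have h4 : a = 0 := by simpa using h3
    simp [h4]
  let S : Set (Mp ψ ω) := {x : Mp ψ ω | (ℓ.map x.g).1 ⊓ ℓ'.1 = ⊥ ∧
        x.t ℓ * gammaTau ψ ![ℓ, ℓ.map x.g, ℓ'] =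
          x₀.1.t ℓ * gammaTau ψ ![ℓ, ℓ.map x₀.1.g, ℓ']}
  have hS : IsOpen S := by
    refine IsOpen.mono ?_ inf_le_right
    exact TopologicalSpace.isOpen_generateFrom_of_mem ⟨ℓ, ℓ', _, rfl⟩
  have hSx : ∀ᶠ x in 𝓝 x₀, x.1 ∈ S :=
    (hS.preimage continuous_subtype_val).mem_nhds ⟨hℓ', rfl⟩
  have hev := h.eventually_weilIndex_eq h2 hsq (𝓝 x₀) _ D.1 rfl
    (fun x => cayleyForm ω D.1 (R x)) (fun x => cayleyForm_isSymm x.1.g D (hR x))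
    (cayleyForm ω D.1 (R x₀)) (cayleyForm_isSymm x₀.1.g D (hR x₀)) (fun v w => by
      simp only [cayleyForm_apply, map_sub (ω.form _)]
      exact (((hRc _ _).tendsto x₀).sub tendsto_const_nhds)) (by
      filter_upwards [hSx] with x hx v hv
      rw [cayleyForm_eq_zero_iff x₀.1.g D (hR x₀) (hD _ hℓ')] at hv
      rwa [cayleyForm_eq_zero_iff x.1.g D (hR x) (hD _ hx.1)])
  filter_upwards [hSx, hev] with x hx hx'
  rw [h.Theta_eq_mul h2 ℓ ℓ', h.Theta_eq_mul h2 ℓ ℓ', hx.2,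
    h.gammaTau_graph_eq_cayleyForm h2 x.1.g D (hR x), hx',
    ← h.gammaTau_graph_eq_cayleyForm h2 x₀.1.g D (hR x₀)]

end Regular

end Metaplectic

namespace Metaplectic

universe u v

/-! ### Weil constants: transport and uniqueness -/

section WeilConst

open scoped ComplexConjugate

variable {A B : Type*} [AddCommGroup A] [TopologicalSpace A] [AddCommGroup B] [TopologicalSpace B]

lemma IsSchwartzBruhat.comp (E : A ≃ₜ+ B) {φ : B → ℂ} (hφ : IsSchwartzBruhat φ) :
    IsSchwartzBruhat fun x => φ (E x) := by
  rcases hφ with ⟨h1, h2⟩ | ⟨n, e, f, rfl⟩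
  · exact Or.inl ⟨h1.comp_continuous E.continuous, h2.comp_homeomorph E.toHomeomorph⟩
  · exact Or.inr ⟨n, E.trans e, f, rfl⟩

variable [MeasurableSpace A] [MeasurableSpace B]

/-- The Fourier transform attached to a kernel `χ`. -/
def kernelTransform (χ : A → A → ℂ) (μ : Measure A) (φ : A → ℂ) (x : A) : ℂ :=
  ∫ y, φ y * χ x y ∂μ

/-- The number `c` relates the Fourier transform of `f` to the conjugate of `f`, for the Fourier
transform with kernel `χ` and its self-dual measure. -/
def IsWeilConst (χ : A → A → ℂ) (f : A → ℂ) (c : ℂ) : Prop :=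
  ∃ μ : Measure A, (μ.IsAddHaarMeasure ∧ ∀ φ : A → ℂ, IsSchwartzBruhat φ →
    ∀ x, kernelTransform χ μ (kernelTransform χ μ φ) x = φ (-x)) ∧
    ∀ φ : A → ℂ, IsSchwartzBruhat φ →
      ∫ x, f x * kernelTransform χ μ φ x ∂μ = c * ∫ x, conj (f x) * φ x ∂μ

/-- The notion involves a kernel and a function instead of a form over `F`, so it moves along any
additive homeomorphism, such as ℂⁿ ≅ ℝ²ⁿ or a real rescaling. -/
lemma IsWeilConst.comp [BorelSpace A] [BorelSpace B] [IsTopologicalAddGroup A]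
    [IsTopologicalAddGroup B] (E : A ≃ₜ+ B) {χ : B → B → ℂ} {f : B → ℂ} {c : ℂ}
    (h : IsWeilConst χ f c) :
    IsWeilConst (fun x y => χ (E x) (E y)) (fun x => f (E x)) c := by
  obtain ⟨μ, ⟨hμ, hinv⟩, hc⟩ := h
  have hint : ∀ g : A → ℂ, ∫ x, g x ∂(μ.map E.symm) = ∫ x, g (E.symm x) ∂μ := fun g =>
    E.symm.toHomeomorph.measurableEmbedding.integral_map g
  have hker : ∀ φ : A → ℂ, ∀ x : A, kernelTransform (fun x y => χ (E x) (E y)) (μ.map E.symm) φ x =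
      kernelTransform χ μ (fun y => φ (E.symm y)) (E x) := by
    intro φ x
    rw [kernelTransform, hint]
    simp [kernelTransform]
  refine ⟨μ.map E.symm, ⟨E.symm.isAddHaarMeasure_map μ, fun φ hφ x => ?_⟩, fun φ hφ => ?_⟩
  · rw [hker]
    simp only [hker, E.apply_symm_apply]
    rw [hinv _ (hφ.comp E.symm)]
    simp
  · rw [hint, hint]
    simp only [hker, E.apply_symm_apply]
    exact hc _ (hφ.comp E.symm)

lemma isWeilConst_comp_iff [BorelSpace A] [BorelSpace B] [IsTopologicalAddGroup A]
    [IsTopologicalAddGroup B] (E : A ≃ₜ+ B) {χ : B → B → ℂ} {f : B → ℂ} {c : ℂ}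
    {χ' : A → A → ℂ} {f' : A → ℂ} (hχ : ∀ x y, χ' x y = χ (E x) (E y))
    (hf : ∀ x, f' x = f (E x)) :
    IsWeilConst χ' f' c ↔ IsWeilConst χ f c := by
  have e1 : χ' = fun x y => χ (E x) (E y) := by ext; apply hχ
  have e2 : f' = fun x => f (E x) := by ext; apply hf
  subst e1 e2
  refine ⟨fun h => ?_, fun h => h.comp E⟩
  have := h.comp E.symm
  simpa using this

/-- Two self-dual measures differ by a factor k, and the double transform scales by k², so k = 1.
Then one test function with nonzero integral determines `c`. -/
lemma IsWeilConst.unique [BorelSpace A] [IsTopologicalAddGroup A] [LocallyCompactSpace A]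
    [SecondCountableTopology A] {χ : A → A → ℂ} {f : A → ℂ} {c c' : ℂ}
    (hne : ∀ μ : Measure A, μ.IsAddHaarMeasure →
      ∃ φ, IsSchwartzBruhat φ ∧ ∫ x, conj (f x) * φ x ∂μ ≠ 0)
    (h : IsWeilConst χ f c) (h' : IsWeilConst χ f c') : c = c' := by
  obtain ⟨μ, ⟨hμ, hinv⟩, hc⟩ := h
  obtain ⟨ν, ⟨hν, hinv'⟩, hc'⟩ := h'
  obtain ⟨φ, hφ, hφ0⟩ := hne μ hμ
  obtain ⟨x, hx⟩ : ∃ x, φ x ≠ 0 := by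
    by_contra! hcon
    exact hφ0 (by simp [hcon])
  have hk := Measure.isAddLeftInvariant_eq_smul ν μ
  set k := Measure.addHaarScalarFactor ν μ
  have hker : ∀ g : A → ℂ, kernelTransform χ ν g = fun x => k • kernelTransform χ μ g x := by
    intro g
    ext x
    rw [kernelTransform, hk, integral_smul_nnreal_measure]
    rfl
  have h1 : kernelTransform χ ν (kernelTransform χ ν φ) (-x) =
      k • k • kernelTransform χ μ (kernelTransform χ μ φ) (-x) := by
    rw [hker, hker φ]
    simp only [kernelTransform, smul_mul_assoc, NNReal.smul_def]
    rw [integral_smul]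
  rw [hinv' φ hφ, hinv φ hφ, neg_neg, smul_smul, NNReal.smul_def] at h1
  have h2 : ((k * k : NNReal) : ℝ) = 1 := by
    have h3 : ((1 : ℝ) - ((k * k : NNReal) : ℝ)) • φ x = 0 := by
      rw [sub_smul, one_smul, ← h1, sub_self]
    rcases smul_eq_zero.1 h3 with h4 | h4
    · linarith
    · exact absurd h4 hx
  have h3 : k = 1 := by
    have h4 : k * k = 1 := by exact_mod_cast h2
    have h5 : k ^ 2 = 1 := by rw [sq, h4]
    exact (pow_eq_one_iff_of_nonneg zero_le two_ne_zero).1 h5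
  rw [h3, one_smul] at hk
  rw [hk] at hc'
  have h6 := (hc φ hφ).symm.trans (hc' φ hφ)
  exact mul_right_cancel₀ hφ0 h6

end WeilConst

/-! ### From diagonal forms to arbitrary symmetric forms -/

section Diagonal

variable {F : Type u} [Field F] [TopologicalSpace F] (ψ : AddChar F Circle)

omit [TopologicalSpace F] in
lemma isWeilIndex_iff {A : Type*} [AddCommGroup A] [Module F A] [TopologicalSpace A]
    [MeasurableSpace A] (q : LinearMap.BilinForm F A) (c : ℂ) :
    IsWeilIndex ψ q c ↔ IsWeilConst (fun x y => (ψ (q x y) : ℂ)) (quadChar ψ q) c := by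
  have h : ∀ x, quadChar ψ (-q) x = (starRingEnd ℂ) (quadChar ψ q x) := by
    intro x
    simp only [quadChar, LinearMap.neg_apply, mul_neg]
    rw [AddChar.map_neg_eq_inv, Circle.coe_inv_eq_conj]
  simp only [IsWeilIndex, IsSelfDual, IsWeilConst, h]
  rfl

/-- The bicharacter `ψ (∑ aᵢ xᵢ yᵢ)`. -/
def diagChar {ι : Type*} [Fintype ι] (a : ι → F) (x y : ι → F) : ℂ := ψ (∑ i, a i * x i * y i)

/-- The function `ψ (½ ∑ aᵢ xᵢ ²)`. -/
def diagQuad {ι : Type*} [Fintype ι] (a : ι → F) (x : ι → F) : ℂ :=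
  ψ (2⁻¹ * ∑ i, a i * x i * x i)

/-- A family of constants `γ₁ a` computes the Weil indices of all diagonal forms. -/
def IsDiagSymbol (γ₁ : F → ℂ) : Prop :=
  γ₁ 0 = 1 ∧ (∀ a, γ₁ a * γ₁ (-a) = 1) ∧
  ∀ (n : ℕ) (a : Fin n → F), (∀ i, a i ≠ 0) → ∀ c : ℂ,
    (letI : MeasurableSpace (Fin n → F) := borel _
    IsWeilConst (diagChar ψ a) (diagQuad ψ a) c) ↔ c = ∏ i, γ₁ (a i)

variable {ψ}

lemma weilIndex_eq_of_basis [IsTopologicalRing F] {γ₁ : F → ℂ} (h : IsDiagSymbol ψ γ₁)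
    {Q : Type v} [AddCommGroup Q] [Module F Q] [TopologicalSpace Q] [IsModuleTopology F Q]
    [MeasurableSpace Q] [BorelSpace Q] (q : LinearMap.BilinForm F Q) {n : ℕ}
    (b : Module.Basis (Fin n) F Q) (hb : ∀ i j, i ≠ j → q (b i) (b j) = 0)
    (hb' : ∀ i, q (b i) (b i) ≠ 0) (c : ℂ) :
    IsWeilIndex ψ q c ↔ c = ∏ i, γ₁ (q (b i) (b i)) := by
  have : IsTopologicalAddGroup Q := IsModuleTopology.topologicalAddGroup F Q
  let : MeasurableSpace (Fin n → F) := borel _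
  have : BorelSpace (Fin n → F) := ⟨rfl⟩
  rw [isWeilIndex_iff, ← h.2.2 n (fun i => q (b i) (b i)) hb' c]
  let E : Q ≃ₜ+ (Fin n → F) :=
    { b.equivFun.toAddEquiv with
      continuous_toFun := IsModuleTopology.continuous_of_linearMap b.equivFun.toLinearMap
      continuous_invFun := IsModuleTopology.continuous_of_linearMap b.equivFun.symm.toLinearMap }
  have hE : ∀ x, E x = b.equivFun x := fun _ => rfl
  have key : ∀ x y, q x y = ∑ i, q (b i) (b i) * E x i * E y i := by
    intro x y
    conv_lhs => rw [← b.sum_equivFun x, ← b.sum_equivFun y]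
    simp only [map_sum, LinearMap.sum_apply, map_smul, LinearMap.smul_apply, smul_eq_mul, hE]
    refine Finset.sum_congr rfl fun i _ => ?_
    rw [Finset.sum_eq_single i]
    · ring
    · intro j _ hj
      rw [hb j i hj]; simp
    · simp
  refine isWeilConst_comp_iff E (fun x y => ?_) (fun x => ?_)
  · rw [diagChar, key]
  · rw [diagQuad, quadChar, key]

/-- The anisotropic members of the family form an orthogonal basis of the nondegenerate quotient.
The isotropic members are orthogonal to everything, hence in the kernel, and contribute γ₁(0) = 1.
-/
theorem IsDiagSymbol.isWeilSymbol [IsTopologicalRing F] {γ₁ : F → ℂ} (h : IsDiagSymbol ψ γ₁) :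
    IsWeilSymbol.{u, v} ψ γ₁ where
  mul_neg := h.2.1
  weilIndex_eq := by
    classical
    intro A _ _ q hq ι _ w hw hs
    let P := {i : ι // q (w i) (w i) ≠ 0}
    let π := (LinearMap.ker q).mkQ
    have hqπ : ∀ x y, nondegQuotient q hq (π x) (π y) = q x y := fun _ _ => rfl
    have hli : LinearIndependent F fun i : P => π (w i) := by
      rw [Fintype.linearIndependent_iff]
      intro g hg i
      have h1 : nondegQuotient q hq (∑ j, g j • π (w j)) (π (w i)) = 0 := by rw [hg]; simp
      simp only [map_sum, LinearMap.sum_apply, map_smul, LinearMap.smul_apply, smul_eq_mul,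
        hqπ] at h1
      rw [Finset.sum_eq_single i (fun j _ hj => by
        rw [hw j i fun hji => hj (Subtype.ext hji), mul_zero]) (by simp)] at h1
      exact (mul_eq_zero.1 h1).resolve_right i.2
    have hker : ∀ i, q (w i) (w i) = 0 → w i ∈ LinearMap.ker q := by
      intro i hi
      rw [LinearMap.mem_ker]
      ext y
      have hy : y ∈ Submodule.span F (Set.range w) ⊔ LinearMap.ker q := by rw [hs]; trivial
      obtain ⟨y₁, hy₁, y₂, hy₂, rfl⟩ := Submodule.mem_sup.1 hy
      have h2 : q (w i) y₂ = 0 := by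
        rw [hq.eq, LinearMap.mem_ker.1 hy₂]; rfl
      rw [map_add, h2, add_zero]
      change q (w i) y₁ = 0
      clear hy h2
      induction hy₁ using Submodule.span_induction with
      | mem x hx =>
        obtain ⟨j, rfl⟩ := hx
        by_cases hij : i = j
        · subst hij; exact hi
        · exact hw i j hij
      | zero => simp
      | add x y hx hy hx' hy' =>
        rw [map_add, hx', hy', add_zero]
      | smul c x hx hx' => rw [map_smul, hx', smul_zero]
    have hspan : ⊤ ≤ Submodule.span F (Set.range fun i : P => π (w i)) := by
      have h1 : Submodule.map π (Submodule.span F (Set.range w) ⊔ LinearMap.ker q) = ⊤ := by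
        rw [hs, Submodule.map_top, Submodule.range_mkQ]
      rw [← h1, Submodule.map_sup, Submodule.map_span]
      refine sup_le (Submodule.span_le.2 ?_) ?_
      · rintro _ ⟨_, ⟨i, rfl⟩, rfl⟩
        by_cases hi : q (w i) (w i) = 0
        · have : π (w i) = 0 := (Submodule.Quotient.mk_eq_zero _).2 (hker i hi)
          rw [this]
          exact Submodule.zero_mem _
        · exact Submodule.subset_span ⟨⟨i, hi⟩, rfl⟩
      · rw [show π = (LinearMap.ker q).mkQ from rfl, Submodule.mkQ_map_self]
        exact bot_le
    let b₀ : Module.Basis P F (A ⧸ LinearMap.ker q) := Module.Basis.mk hli hspan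
    let b := b₀.reindex (Fintype.equivFin P)
    have hb : ∀ i, b i = π (w ((Fintype.equivFin P).symm i)) := fun i => by simp [b, b₀]
    let : TopologicalSpace (A ⧸ LinearMap.ker q) := moduleTopology F _
    let : MeasurableSpace (A ⧸ LinearMap.ker q) := borel _
    have : BorelSpace (A ⧸ LinearMap.ker q) := ⟨rfl⟩
    have : IsModuleTopology F (A ⧸ LinearMap.ker q) := ⟨rfl⟩
    have hiff := weilIndex_eq_of_basis h (nondegQuotient q hq) b
      (fun i j hij => by
        rw [hb, hb, hqπ]
        exact hw _ _ fun h' => hij ((Fintype.equivFin P).symm.injective (Subtype.ext h')))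
      (fun i => by
        rw [hb, hqπ]
        exact ((Fintype.equivFin P).symm i).2)
    -- `hiff` gives both existence and uniqueness, so the choice made in `weilIndex` is this
    -- product.
    have h1 : weilIndex ψ q hq = ∏ i, γ₁ (nondegQuotient q hq (b i) (b i)) :=
      (hiff _).1 (Classical.epsilon_spec ⟨_, (hiff _).2 rfl⟩)
    rw [h1]
    simp only [hb, hqπ]
    rw [Equiv.prod_comp (Fintype.equivFin P).symm (fun i : P => γ₁ (q (w i) (w i))),
      ← Finset.prod_subtype (Finset.univ.filter fun i => q (w i) (w i) ≠ 0) (by simp)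
        (fun i => γ₁ (q (w i) (w i))), Finset.prod_filter_of_ne]
    intro i _ hi h0
    exact hi (by rw [h0, h.1])

end Diagonal

end Metaplectic

namespace Metaplectic

/-! ### Topological properties of the fields -/

section FieldFacts

open Filter Topology

/-- The topological properties of the fields under consideration. -/
structure IsNiceField (F : Type*) [Field F] [TopologicalSpace F] : Prop where
  t2 : T2Space F
  continuousInv : ContinuousInv₀ F
  secondCountable : SecondCountableTopology F
  locallyCompact : LocallyCompactSpace F
  squares : ∀ᶠ x : F in 𝓝 1, ∃ s, s ≠ 0 ∧ x = s * s

/-- Squaring has derivative 2 ≠ 0 at 1, so by the inverse function theorem it carries neighbourhoods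
of 1 onto neighbourhoods of 1. -/
lemma eventually_sq_of_normed (F : Type*) [NontriviallyNormedField F] [CompleteSpace F]
    (h2 : (2 : F) ≠ 0) : ∀ᶠ x : F in 𝓝 1, ∃ s, s ≠ 0 ∧ x = s * s := by
  have h : HasStrictDerivAt (fun s : F => s * s) (1 * 1 + 1 * 1) 1 :=
    (hasStrictDerivAt_id (1 : F)).mul (hasStrictDerivAt_id (1 : F))
  have h1 := h.map_nhds_eq (by rw [one_mul, one_add_one_eq_two]; exact h2)
  simp only [one_mul] at h1
  rw [← h1, eventually_map]
  filter_upwards [isOpen_ne.mem_nhds (one_ne_zero : (1 : F) ≠ 0)] with s hs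
  exact ⟨s, hs, rfl⟩

lemma isNiceField_of_normed (F : Type*) [NontriviallyNormedField F] [ProperSpace F]
    (h2 : (2 : F) ≠ 0) : IsNiceField F :=
  ⟨inferInstance, inferInstance, inferInstance, inferInstance, eventually_sq_of_normed F h2⟩

lemma IsNiceField.of_homeomorph {F K : Type*} [Field F] [TopologicalSpace F] [Field K]
    [TopologicalSpace K] (h : IsNiceField K) (e : F ≃+* K) (he : IsHomeomorph e) :
    IsNiceField F := by
  obtain ⟨_, _, _, _, hsq⟩ := h
  let E : F ≃ₜ K := he.homeomorph e
  refine ⟨E.symm.t2Space, ?_, E.secondCountableTopology, E.isClosedEmbedding.locallyCompactSpace,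
    ?_⟩
  · refine ⟨fun x hx => ?_⟩
    have h1 : (fun y : F => y⁻¹) = fun y => E.symm ((e y)⁻¹) := by
      ext y
      rw [← map_inv₀]
      exact (E.symm_apply_apply y⁻¹).symm
    change ContinuousAt (fun y : F => y⁻¹) x
    rw [h1]
    exact E.symm.continuous.continuousAt.comp
      (ContinuousAt.inv₀ he.continuous.continuousAt (by simpa using hx))
  · have h1 : Tendsto e (𝓝 1) (𝓝 1) := by
      have := he.continuous.tendsto 1
      rwa [map_one] at this
    filter_upwards [h1.eventually hsq] with x ⟨s, hs, hx⟩
    refine ⟨e.symm s, by simpa using hs, e.injective ?_⟩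
    simpa using hx

lemma isNiceField_of_finite (F : Type*) [Field F] [TopologicalSpace F] [Finite F]
    [DiscreteTopology F] : IsNiceField F :=
  ⟨inferInstance, ⟨fun _ _ => continuous_of_discreteTopology.continuousAt⟩, inferInstance,
    inferInstance, by
      rw [nhds_discrete, eventually_pure]
      exact ⟨1, one_ne_zero, (mul_one 1).symm⟩⟩

open ValuativeRel Valued.integer in
lemma isNiceField_of_nonarchimedean (F : Type*) [Field F] [TopologicalSpace F] [ValuativeRel F]
    [IsNonarchimedeanLocalField F] (h2 : (2 : F) ≠ 0) :
    IsNiceField F ∧ (𝓝[≠] (0 : F)).NeBot := by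
  let := IsTopologicalAddGroup.rightUniformSpace F
  have := isUniformAddGroup_of_addCommGroup (G := F)
  -- A rank one structure turns the valuation into a norm, for which `F` is proper.
  let : (Valued.v (R := F)).RankOne :=
  { hom' := IsRankLeOne.nonempty.some.emb (R := F).comp MonoidWithZeroHom.ValueGroup₀.embedding
    strictMono' := IsRankLeOne.nonempty.some.strictMono.comp
        MonoidWithZeroHom.ValueGroup₀.embedding_strictMono }
  open scoped Valued in
  have : ProperSpace F := .of_nontriviallyNormedField_of_weaklyLocallyCompactSpace F
  open scoped Valued in
  exact ⟨isNiceField_of_normed F h2, inferInstance⟩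

theorem IsLocalOrFinite.isNiceField {F : Type*} [Field F] [TopologicalSpace F]
    (hF : IsLocalOrFinite F) (h2 : (2 : F) ≠ 0) : IsNiceField F := by
  rcases hF with ⟨_, _⟩ | ⟨e, he⟩ | ⟨e, he⟩ | ⟨_, _⟩
  · exact isNiceField_of_finite F
  · exact (isNiceField_of_normed ℝ two_ne_zero).of_homeomorph e he
  · exact (isNiceField_of_normed ℂ two_ne_zero).of_homeomorph e he
  · exact (isNiceField_of_nonarchimedean F h2).1

end FieldFacts

/-! ### Dual compact open subgroups of the field -/

section BaseLattice

open Filter Topology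

variable {F : Type*} [Field F] [TopologicalSpace F]

/-- A pair of compact open subgroups of `F` which are dual to each other with respect to `ψ`, and
whose multiples are cofinal. -/
structure IsBaseLattice (ψ : AddChar F Circle) (N N' : AddSubgroup F) : Prop where
  compact : IsCompact (N : Set F)
  isOpen : IsOpen (N : Set F)
  compact' : IsCompact (N' : Set F)
  isOpen' : IsOpen (N' : Set F)
  mem_iff' : ∀ y, y ∈ N' ↔ ∀ x ∈ N, ψ (x * y) = 1
  mem_iff : ∀ x, x ∈ N ↔ ∀ y ∈ N', ψ (x * y) = 1
  cofinal : ∀ U ∈ 𝓝 (0 : F), ∀ K : Set F, IsCompact K → ∃ c : F, c ≠ 0 ∧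
    (∀ x ∈ N, c * x ∈ U) ∧ ∀ x ∈ K, c * x ∈ N'

/-- The annihilator of `N` with respect to `ψ (x y)`. -/
def annihilator (ψ : AddChar F Circle) (N : AddSubgroup F) : AddSubgroup F where
  carrier := {y | ∀ x ∈ N, ψ (x * y) = 1}
  zero_mem' := fun x _ => by simp
  add_mem' := fun {a b} ha hb x hx => by
    rw [mul_add, AddChar.map_add_eq_mul, ha x hx, hb x hx, one_mul]
  neg_mem' := fun {a} ha x hx => by
    rw [mul_neg, AddChar.map_neg_eq_inv, ha x hx, inv_one]

omit [TopologicalSpace F] in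
lemma mem_annihilator {ψ : AddChar F Circle} {N : AddSubgroup F} {y : F} :
    y ∈ annihilator ψ N ↔ ∀ x ∈ N, ψ (x * y) = 1 := Iff.rfl

omit [TopologicalSpace F] in
lemma annihilator_annihilator_annihilator (ψ : AddChar F Circle) (N : AddSubgroup F) :
    annihilator ψ (annihilator ψ (annihilator ψ N)) = annihilator ψ N := by
  refine le_antisymm (fun y hy => mem_annihilator.2 fun x hx => ?_)
    fun y hy => mem_annihilator.2 fun x hx => ?_
  · refine mem_annihilator.1 hy x (mem_annihilator.2 fun z hz => ?_)
    rw [mul_comm]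
    exact mem_annihilator.1 hz x hx
  · rw [mul_comm]
    exact mem_annihilator.1 hx y hy

lemma isBaseLattice_of_finite [Finite F] [DiscreteTopology F] {ψ : AddChar F Circle}
    (hψ : ψ ≠ 1) : IsBaseLattice ψ ⊥ ⊤ where
  compact := Set.toFinite _ |>.isCompact
  isOpen := isOpen_discrete _
  compact' := Set.toFinite _ |>.isCompact
  isOpen' := isOpen_discrete _
  mem_iff' y := by simp
  mem_iff x := by
    constructor
    · intro hx y _
      rw [AddSubgroup.mem_bot.1 hx]; simp
    · intro hx
      rw [AddSubgroup.mem_bot]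
      by_contra h0
      refine hψ (DFunLike.ext _ _ fun y => ?_)
      have := hx (x⁻¹ * y) trivial
      rwa [mul_inv_cancel_left₀ h0] at this
  cofinal U hU K _ := ⟨1, one_ne_zero, fun x hx => by
    rw [AddSubgroup.mem_bot.1 hx, mul_zero]; exact mem_of_mem_nhds hU, fun _ _ => trivial⟩

/-- A subgroup of the circle contained in the right half plane is trivial. -/
lemma circle_eq_one_of_pow_re_pos (z : Circle) (hz : ∀ n : ℕ, 0 < ((z ^ n : Circle) : ℂ).re) :
    z = 1 := by
  -- In the right half plane |w + 1|² ≥ 2, so squaring at least doubles |w - 1|². Iterating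
  -- contradicts the bound |w - 1|² ≤ 2 unless z = 1.
  have hstep : ∀ w : Circle, 0 < (w : ℂ).re →
      2 * Complex.normSq (w - 1) ≤ Complex.normSq ((w * w : Circle) - 1) := by
    intro w hw
    have h1 : ((w * w : Circle) : ℂ) - 1 = (w - 1) * (w + 1) := by
      rw [Circle.coe_mul]; ring
    have h2 : 2 ≤ Complex.normSq ((w : ℂ) + 1) := by
      rw [Complex.normSq_add, Circle.normSq_coe]
      simp
      linarith
    rw [h1, map_mul, mul_comm]
    exact mul_le_mul_of_nonneg_left h2 (Complex.normSq_nonneg _)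
  have hpow : ∀ k : ℕ, 2 ^ k * Complex.normSq ((z : ℂ) - 1) ≤
      Complex.normSq ((z ^ 2 ^ k : Circle) - 1) := by
    intro k
    induction k with
    | zero => simp
    | succ k ih =>
      rw [pow_succ 2 k, pow_succ 2 k, pow_mul z, pow_two (z ^ 2 ^ k)]
      have := hstep _ (hz (2 ^ k))
      linarith
  have hbound : ∀ w : Circle, 0 < (w : ℂ).re → Complex.normSq ((w : ℂ) - 1) ≤ 2 := by
    intro w hw
    rw [Complex.normSq_sub, Circle.normSq_coe]
    simp
    linarith
  by_contra hne
  have hpos : 0 < Complex.normSq ((z : ℂ) - 1) := by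
    rw [Complex.normSq_pos, sub_ne_zero]
    exact fun h => hne (Circle.ext h)
  obtain ⟨k, hk⟩ := pow_unbounded_of_one_lt (2 / Complex.normSq ((z : ℂ) - 1)) one_lt_two
  rw [div_lt_iff₀ hpos] at hk
  linarith [hpow k, hbound _ (hz (2 ^ k))]

variable [IsTopologicalRing F]

/-- The circle has no small subgroups: for y near 0 the compact subgroup `N` is sent by x ↦ ψ(xy)
into the right half plane, and the image is a subgroup. -/
lemma isOpen_annihilator {ψ : AddChar F Circle} (hψ : Continuous ψ) {N : AddSubgroup F}
    (hN : IsCompact (N : Set F)) : IsOpen (annihilator ψ N : Set F) := by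
  refine AddSubgroup.isOpen_of_mem_nhds _ (g := 0) ?_
  let W : Set (F × F) := {p | 0 < ((ψ (p.1 * p.2) : Circle) : ℂ).re}
  have hW : IsOpen W := isOpen_lt continuous_const
    (Complex.continuous_re.comp (continuous_subtype_val.comp
      (hψ.comp (continuous_fst.mul continuous_snd))))
  obtain ⟨U, V, -, hV, hNU, h0V, hUV⟩ := generalized_tube_lemma hN (isCompact_singleton (x := (0 : F)))
    hW (by rintro ⟨x, y⟩ ⟨-, hy⟩; simp only [Set.mem_singleton_iff] at hy; simp [W, hy])
  filter_upwards [hV.mem_nhds (h0V rfl)] with y hy x hx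
  refine circle_eq_one_of_pow_re_pos _ fun n => ?_
  have h1 : ((n • x, y) : F × F) ∈ W := hUV ⟨hNU (N.nsmul_mem hx n), hy⟩
  have h3 : ψ (x * y) ^ n = ψ (n • x * y) := by
    rw [smul_mul_assoc, AddChar.map_nsmul_eq_pow]
  rw [h3]
  exact h1

lemma isClosed_annihilator {ψ : AddChar F Circle} (hψ : Continuous ψ) (N : AddSubgroup F) :
    IsClosed (annihilator ψ N : Set F) := by
  have : (annihilator ψ N : Set F) = ⋂ x ∈ N, {y | ψ (x * y) = 1} := by
    ext y
    simp [mem_annihilator]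
  rw [this]
  exact isClosed_biInter fun x _ =>
    isClosed_eq (hψ.comp (continuous_const.mul continuous_id)) continuous_const

/-- `N` is the annihilator of `O` and N' that of `N`. Starting from an annihilator makes the
biduality of `N` formal. -/
lemma exists_isBaseLattice_of_compact_subring [(𝓝[≠] (0 : F)).NeBot] [ContinuousInv₀ F]
    {ψ : AddChar F Circle} (hψc : Continuous ψ) (hψ : ψ ≠ 1) (O : Subring F)
    (hO : IsCompact (O : Set F)) (hval : ∀ x, x ∉ O → x⁻¹ ∈ O) :
    ∃ N N' : AddSubgroup F, IsBaseLattice ψ N N' := by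
  let N := annihilator ψ O.toAddSubgroup
  have hNopen : IsOpen (N : Set F) := isOpen_annihilator hψc hO
  obtain ⟨z, hz⟩ : ∃ z, ψ z ≠ 1 := by
    by_contra! hcon
    exact hψ (DFunLike.ext _ _ hcon)
  have hz0 : z ≠ 0 := fun h => hz (by rw [h, AddChar.map_zero_eq_one])
  -- If z⁻¹y ∉ O then zy⁻¹ ∈ O, and y ∈ N would give ψ(z) = 1.
  have hNz : (N : Set F) ⊆ (fun x => z * x) '' (O : Set F) := by
    intro y hy
    refine ⟨z⁻¹ * y, ?_, mul_inv_cancel_left₀ hz0 y⟩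
    by_contra hcon
    have hy0 : y ≠ 0 := fun h => hcon (by rw [h, mul_zero]; exact O.zero_mem)
    have h1 := hy _ (hval _ hcon)
    rw [mul_inv, inv_inv, mul_assoc, inv_mul_cancel₀ hy0, mul_one] at h1
    exact hz h1
  have hNcpt : IsCompact (N : Set F) :=
    (hO.image (continuous_const.mul continuous_id)).of_isClosed_subset
      (isClosed_annihilator hψc _) hNz
  have hsmall : ∀ U ∈ 𝓝 (0 : F), ∀ K : Set F, IsCompact K → ∀ᶠ c in 𝓝 (0 : F), ∀ x ∈ K, c * x ∈ U := by
    intro U hU K hK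
    obtain ⟨U', hU', hU'o, h0⟩ := mem_nhds_iff.1 hU
    obtain ⟨S, T, hS, -, h0S, hKT, hST⟩ := generalized_tube_lemma
      (isCompact_singleton (x := (0 : F))) hK (hU'o.preimage continuous_mul)
      (by rintro ⟨x, y⟩ ⟨hx, -⟩; simp only [Set.mem_singleton_iff] at hx; simp [hx, h0])
    filter_upwards [hS.mem_nhds (h0S rfl)] with c hc x hx
    exact hU' (hST (⟨hc, hKT hx⟩ : (c, x) ∈ S ×ˢ T))
  obtain ⟨n, hn0, hn⟩ : ∃ n : F, n ≠ 0 ∧ n ∈ N := by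
    have h1 : ∀ᶠ n in 𝓝[≠] (0 : F), n ∈ N :=
      nhdsWithin_le_nhds (hNopen.mem_nhds N.zero_mem)
    obtain ⟨n, hn, hn0⟩ := (h1.and self_mem_nhdsWithin).exists
    exact ⟨n, hn0, hn⟩
  let N' := annihilator ψ N
  have hN'open : IsOpen (N' : Set F) := isOpen_annihilator hψc hNcpt
  -- `N` is an `O`-module containing `n`, so y ∈ N' forces ψ(xny) = 1 for all x ∈ O, that is, ny ∈
  -- N.
  have hN'n : (N' : Set F) ⊆ (fun x => n⁻¹ * x) '' (N : Set F) := by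
    intro y hy
    refine ⟨n * y, fun x hx => ?_, by simp [inv_mul_cancel_left₀ hn0]⟩
    rw [← mul_assoc]
    refine hy _ fun w hw => ?_
    rw [← mul_assoc]
    exact hn _ (O.mul_mem hw hx)
  have hN'cpt : IsCompact (N' : Set F) :=
    (hNcpt.image (continuous_const.mul continuous_id)).of_isClosed_subset
      (isClosed_annihilator hψc _) hN'n
  refine ⟨N, N', hNcpt, hNopen, hN'cpt, hN'open, fun y => Iff.rfl, fun x => ?_, ?_⟩
  · have h1 := annihilator_annihilator_annihilator ψ O.toAddSubgroup
    have h2 : x ∈ N ↔ x ∈ annihilator ψ N' := by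
      rw [show annihilator ψ N' = N from h1]
    rw [h2, mem_annihilator]
    simp only [mul_comm x]
  · intro U hU K hK
    have h1 := (hsmall U hU N hNcpt).and (hsmall N' (hN'open.mem_nhds N'.zero_mem) K hK)
    have h2 : ∀ᶠ c in 𝓝[≠] (0 : F), (∀ x ∈ (N : Set F), c * x ∈ U) ∧ ∀ x ∈ K, c * x ∈ (N' : Set F) :=
      nhdsWithin_le_nhds h1
    obtain ⟨c, hc, hc0⟩ := (h2.and self_mem_nhdsWithin).exists
    exact ⟨c, hc0, hc.1, hc.2⟩

open ValuativeRel in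
lemma exists_isBaseLattice_of_nonarchimedean [ValuativeRel F] [IsNonarchimedeanLocalField F]
    (h2 : (2 : F) ≠ 0) {ψ : AddChar F Circle} (hψc : Continuous ψ) (hψ : ψ ≠ 1) :
    ∃ N N' : AddSubgroup F, IsBaseLattice ψ N N' := by
  obtain ⟨h, _⟩ := isNiceField_of_nonarchimedean F h2
  have := h.t2
  have := h.continuousInv
  refine exists_isBaseLattice_of_compact_subring hψc hψ (𝒪[F]) ?_ ?_
  · exact isCompact_iff_compactSpace.mpr (inferInstance : CompactSpace 𝒪[F])
  · intro x hx
    have h1 : 1 < valuation F x := not_le.1 hx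
    change valuation F x⁻¹ ≤ 1
    rw [map_inv₀]
    exact inv_le_one_of_one_le₀ h1.le

end BaseLattice

end Metaplectic

namespace Metaplectic

/-! ### Quadratic characters on groups with many dual pairs of compact open subgroups -/

section DualSystem

open Filter Topology
open scoped ComplexConjugate

variable {A : Type*} [AddCommGroup A] [TopologicalSpace A]

/-- `f` is a continuous character of the second degree on `A` with associated symmetric
bicharacter `χ`. -/
structure IsQuadratic (χ : A → A → ℂ) (f : A → ℂ) : Prop where
  symm : ∀ x y, χ x y = χ y x
  add : ∀ x y z, χ x (y + z) = χ x y * χ x z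
  norm_χ : ∀ x y, ‖χ x y‖ = 1
  cont : Continuous fun p : A × A => χ p.1 p.2
  map_add : ∀ x y, f (x + y) = f x * f y * χ x y
  norm_f : ∀ x, ‖f x‖ = 1
  cont_f : Continuous f

namespace IsQuadratic

variable {χ : A → A → ℂ} {f : A → ℂ} (h : IsQuadratic χ f)
include h

lemma ne_zero (x y : A) : χ x y ≠ 0 := norm_ne_zero_iff.1 (by rw [h.norm_χ]; exact one_ne_zero)

lemma zero_right (x : A) : χ x 0 = 1 := by
  have := h.add x 0 0
  rw [add_zero] at this
  exact (mul_eq_left₀ (h.ne_zero x 0)).1 this.symm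

lemma zero_left (x : A) : χ 0 x = 1 := by rw [h.symm, h.zero_right]

lemma add_left (x y z : A) : χ (x + y) z = χ x z * χ y z := by
  rw [h.symm, h.add, h.symm z x, h.symm z y]

lemma neg_left (x y : A) : χ (-x) y = conj (χ x y) := by
  have h1 : χ (-x) y * χ x y = 1 := by rw [← h.add_left, neg_add_cancel, h.zero_left]
  rw [eq_comm, ← Complex.inv_eq_conj (h.norm_χ x y)]
  exact (eq_inv_of_mul_eq_one_left h1).symm

lemma f_ne_zero (x : A) : f x ≠ 0 := norm_ne_zero_iff.1 (by rw [h.norm_f]; exact one_ne_zero)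

lemma f_zero : f 0 = 1 := by
  have := h.map_add 0 0
  rw [add_zero, h.zero_right, mul_one] at this
  exact (mul_eq_left₀ (h.f_ne_zero 0)).1 this.symm

lemma conj_mul_f (x : A) : conj (f x) * f x = 1 := by
  rw [mul_comm, Complex.mul_conj, Complex.normSq_eq_norm_sq, h.norm_f]; simp

/-- Completing the square. -/
lemma f_mul_χ (x y : A) : f x * χ x y = conj (f y) * f (x + y) := by
  rw [h.map_add]
  linear_combination -(f x * χ x y) * h.conj_mul_f y

lemma conj' : IsQuadratic (fun x y => conj (χ x y)) (fun x => conj (f x)) where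
  symm x y := by rw [h.symm]
  add x y z := by rw [h.add, map_mul]
  norm_χ x y := by rw [RCLike.norm_conj, h.norm_χ]
  cont := Complex.continuous_conj.comp h.cont
  map_add x y := by simp only [h.map_add, map_mul]
  norm_f x := by rw [RCLike.norm_conj, h.norm_f]
  cont_f := Complex.continuous_conj.comp h.cont_f

end IsQuadratic

/-- `L` and `L'` are compact open subgroups which are dual to each other. -/
structure IsDualPair (χ : A → A → ℂ) (L L' : AddSubgroup A) : Prop where
  compact : IsCompact (L : Set A)
  isOpen : IsOpen (L : Set A)
  compact' : IsCompact (L' : Set A)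
  isOpen' : IsOpen (L' : Set A)
  mem_iff' : ∀ y, y ∈ L' ↔ ∀ x ∈ L, χ x y = 1
  mem_iff : ∀ x, x ∈ L ↔ ∀ y ∈ L', χ x y = 1

variable [IsTopologicalAddGroup A]

lemma exists_uniform_of_isLocallyConstant {φ : A → ℂ} (h : IsLocallyConstant φ)
    (hc : HasCompactSupport φ) :
    ∃ U ∈ 𝓝 (0 : A), ∀ x, ∀ u ∈ U, φ (x + u) = φ x := by
  let W : Set (A × A) := {p | φ (p.1 + p.2) - φ p.1 = 0}
  have hW : IsOpen W := by
    have h1 : IsLocallyConstant fun p : A × A => φ (p.1 + p.2) :=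
      h.comp_continuous continuous_add
    have h2 : IsLocallyConstant fun p : A × A => φ p.1 := h.comp_continuous continuous_fst
    exact (h1.sub h2).isOpen_fiber 0
  obtain ⟨S, T, -, hT, hKS, h0T, hST⟩ := generalized_tube_lemma hc.isCompact
    (isCompact_singleton (x := (0 : A))) hW
    (by rintro ⟨x, y⟩ ⟨-, hy⟩; simp only [Set.mem_singleton_iff] at hy; simp [W, hy])
  have hT0 : T ∈ 𝓝 (0 : A) := hT.mem_nhds (h0T rfl)
  have hT' : -T ∈ 𝓝 (0 : A) := neg_mem_nhds_zero A hT0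
  -- Symmetric, so that the case where only x + u lies in the support reduces to translation by -u.
  refine ⟨T ∩ -T, inter_mem hT0 hT', fun x u hu => ?_⟩
  by_cases hx : x ∈ tsupport φ
  · exact sub_eq_zero.1 (hST (⟨hKS hx, hu.1⟩ : (x, u) ∈ S ×ˢ T))
  by_cases hxu : x + u ∈ tsupport φ
  · have h1 := sub_eq_zero.1 (hST (⟨hKS hxu, hu.2⟩ : (x + u, -u) ∈ S ×ˢ T))
    simp only [add_neg_cancel_right] at h1
    exact h1.symm
  · rw [image_eq_zero_of_notMem_tsupport hx, image_eq_zero_of_notMem_tsupport hxu]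

variable [MeasurableSpace A] [BorelSpace A]

/-- The indicator function of a subgroup. -/
def ind (L : AddSubgroup A) : A → ℂ := Set.indicator (L : Set A) 1

omit [TopologicalSpace A] [IsTopologicalAddGroup A] [MeasurableSpace A] [BorelSpace A] in
lemma ind_of_mem {L : AddSubgroup A} {x : A} (hx : x ∈ L) : ind L x = 1 :=
  Set.indicator_of_mem (s := (L : Set A)) hx 1

omit [TopologicalSpace A] [IsTopologicalAddGroup A] [MeasurableSpace A] [BorelSpace A] in
lemma ind_of_notMem {L : AddSubgroup A} {x : A} (hx : x ∉ L) : ind L x = 0 :=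
  Set.indicator_of_notMem (s := (L : Set A)) hx 1

omit [TopologicalSpace A] [IsTopologicalAddGroup A] [MeasurableSpace A] [BorelSpace A] in
lemma ind_add {L : AddSubgroup A} (x : A) {l : A} (hl : l ∈ L) : ind L (x + l) = ind L x := by
  by_cases hx : x ∈ L
  · rw [ind_of_mem hx, ind_of_mem (L.add_mem hx hl)]
  · rw [ind_of_notMem hx, ind_of_notMem fun h => hx ((L.add_mem_cancel_right hl).1 h)]

omit [MeasurableSpace A] [BorelSpace A] in
lemma isLocallyConstant_of_add {L : AddSubgroup A} (hL : IsOpen (L : Set A)) {φ : A → ℂ}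
    (h : ∀ x, ∀ l ∈ L, φ (x + l) = φ x) : IsLocallyConstant φ := by
  rw [IsLocallyConstant.iff_eventually_eq]
  intro x
  have h1 : ∀ᶠ y in 𝓝 x, y - x ∈ (L : Set A) := by
    have h2 : Continuous fun y : A => y - x := by fun_prop
    exact h2.continuousAt (hL.mem_nhds (by simp [L.zero_mem]))
  filter_upwards [h1] with y hy
  rw [← h x _ hy, add_sub_cancel]

omit [MeasurableSpace A] [BorelSpace A] in
lemma hasCompactSupport_of_subgroup [T2Space A] {L : AddSubgroup A} (hL : IsCompact (L : Set A))
    {φ : A → ℂ} (h : ∀ x ∉ L, φ x = 0) : HasCompactSupport φ :=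
  HasCompactSupport.intro hL h

omit [MeasurableSpace A] [BorelSpace A] in
lemma isLocallyConstant_ind {L : AddSubgroup A} (hL : IsOpen (L : Set A)) :
    IsLocallyConstant (ind L) :=
  isLocallyConstant_of_add hL fun x _ hl => ind_add x hl

/-- A cofinal system of dual pairs of compact open subgroups of reciprocal volumes. -/
structure IsDualSystem (χ : A → A → ℂ) (μ : Measure A)
    (P : AddSubgroup A → AddSubgroup A → Prop) : Prop where
  haar : μ.IsAddHaarMeasure
  dual : ∀ L L', P L L' → IsDualPair χ L L'
  vol : ∀ L L', P L L' → μ.real L * μ.real L' = 1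
  cofinal : ∀ U ∈ 𝓝 (0 : A), ∀ K : Set A, IsCompact K → ∃ L L', P L L' ∧ ↑L ⊆ U ∧ K ⊆ L'

/-- The integral of `f` over all sufficiently large subgroups of the system is `c`. -/
def IsStable (f : A → ℂ) (μ : Measure A) (P : AddSubgroup A → AddSubgroup A → Prop) (c : ℂ) :
    Prop :=
  ∃ U ∈ 𝓝 (0 : A), ∃ K : Set A, IsCompact K ∧ ∀ L L', P L L' → ↑L ⊆ U → K ⊆ L' →
    ∫ x, ind L' x * f x ∂μ = c

variable [T2Space A] {χ : A → A → ℂ} {f : A → ℂ} {μ : Measure A}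
  {P : AddSubgroup A → AddSubgroup A → Prop}

omit [IsTopologicalAddGroup A] [T2Space A] in
lemma integral_ind [μ.IsAddHaarMeasure] {L : AddSubgroup A} (hL : IsOpen (L : Set A)) :
    ∫ x, ind L x ∂μ = μ.real L := by
  rw [ind, integral_indicator hL.measurableSet]
  simp

omit [T2Space A] in
-- Translation by l ∈ L multiplies the transform at `x` by χ(x,l), and outside L' some l makes this
-- different from 1.
lemma kernelTransform_eq_zero [μ.IsAddHaarMeasure] (h : IsQuadratic χ f) {φ : A → ℂ}
    {L L' : AddSubgroup A} (hL : IsDualPair χ L L') (hφ : ∀ x, ∀ l ∈ L, φ (x + l) = φ x)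
    {x : A} (hx : x ∉ L') : kernelTransform χ μ φ x = 0 := by
  rw [hL.mem_iff'] at hx
  push Not at hx
  obtain ⟨l, hl, hlx⟩ := hx
  have h1 : kernelTransform χ μ φ x = χ x l * kernelTransform χ μ φ x := by
    conv_lhs => rw [kernelTransform, ← integral_add_right_eq_self _ l]
    rw [kernelTransform, ← integral_const_mul]
    congr 1
    ext y
    rw [hφ y l hl, h.add]; ring
  rw [h.symm] at hlx
  have h2 : (1 - χ x l) * kernelTransform χ μ φ x = 0 := by linear_combination h1
  exact (mul_eq_zero.1 h2).resolve_left fun h3 => hlx (sub_eq_zero.1 h3).symm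

omit [IsTopologicalAddGroup A] [BorelSpace A] [T2Space A] in
lemma kernelTransform_add [μ.IsAddHaarMeasure] (h : IsQuadratic χ f) {φ : A → ℂ}
    {L L' : AddSubgroup A} (hL : IsDualPair χ L L') (hφ : ∀ x ∉ L', φ x = 0)
    (x : A) {l : A} (hl : l ∈ L) :
    kernelTransform χ μ φ (x + l) = kernelTransform χ μ φ x := by
  rw [kernelTransform, kernelTransform]
  congr 1
  ext y
  by_cases hy : y ∈ L'
  · rw [h.add_left, (hL.mem_iff l).1 hl y hy, mul_one]
  · rw [hφ y hy, zero_mul, zero_mul]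

omit [BorelSpace A] [IsTopologicalAddGroup A] in
lemma integral_swap_of_subgroup [OpensMeasurableSpace A] [μ.IsAddHaarMeasure]
    {L' : AddSubgroup A} (hL : IsCompact (L' : Set A)) {g : A → A → ℂ}
    (hg : Continuous fun p : A × A => g p.1 p.2) (h0 : ∀ x y, x ∉ L' → g x y = 0)
    (h0' : ∀ x y, y ∉ L' → g x y = 0) :
    ∫ x, ∫ y, g x y ∂μ ∂μ = ∫ y, ∫ x, g x y ∂μ ∂μ := by
  refine integral_integral_swap_of_hasCompactSupport hg ?_
  refine HasCompactSupport.intro (hL.prod hL) ?_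
  rintro ⟨x, y⟩ hxy
  by_cases hx : x ∈ L'
  · exact h0' x y fun hy => hxy ⟨hx, hy⟩
  · exact h0 x y hx

omit [T2Space A] in
lemma kernelTransform_ind [μ.IsAddHaarMeasure] (h : IsQuadratic χ f)
    {L L' : AddSubgroup A} (hL : IsDualPair χ L L') (x : A) :
    kernelTransform χ μ (ind L') x = μ.real L' * ind L x := by
  have hL' : IsDualPair χ L' L := ⟨hL.compact', hL.isOpen', hL.compact, hL.isOpen,
    fun y => (hL.mem_iff y).trans (by simp only [h.symm y]),
    fun y => (hL.mem_iff' y).trans (by simp only [h.symm y])⟩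
  by_cases hx : x ∈ L
  · rw [ind_of_mem hx, mul_one, ← integral_ind hL.isOpen', kernelTransform]
    congr 1
    ext y
    by_cases hy : y ∈ L'
    · rw [(hL.mem_iff x).1 hx y hy, mul_one]
    · rw [ind_of_notMem hy, zero_mul]
  · rw [ind_of_notMem hx, mul_zero]
    exact kernelTransform_eq_zero h hL' (fun y l hl => ind_add y hl) hx

/-- The inner transform lives on L', so the indicator of L' may be inserted and Fubini applied. The
transform of that indicator is vol(L') times the indicator of `L`, which averages φ over a coset on
which it is constant. -/
lemma kernelTransform_kernelTransform [μ.IsAddHaarMeasure] (h : IsQuadratic χ f) {φ : A → ℂ}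
    {L L' : AddSubgroup A} (hL : IsDualPair χ L L') (hvol : μ.real L * μ.real L' = 1)
    (hφ : ∀ x, ∀ l ∈ L, φ (x + l) = φ x) (hφ' : ∀ x ∉ L', φ x = 0) (x : A) :
    kernelTransform χ μ (kernelTransform χ μ φ) x = φ (-x) := by
  have hφc : Continuous φ := (isLocallyConstant_of_add hL.isOpen hφ).continuous
  have hic : Continuous (ind L') := (isLocallyConstant_ind hL.isOpen').continuous
  have e1 : kernelTransform χ μ (kernelTransform χ μ φ) x =
      ∫ y, ∫ z, ind L' y * φ z * χ (x + z) y ∂μ ∂μ := by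
    rw [kernelTransform]
    congr 1
    ext y
    by_cases hy : y ∈ L'
    · rw [kernelTransform, ← integral_mul_const]
      congr 1
      ext z
      rw [ind_of_mem hy, h.add_left, h.symm y z]; ring
    · rw [kernelTransform_eq_zero h hL hφ hy]
      simp [ind_of_notMem hy]
  have hχc : Continuous fun p : A × A => χ (x + p.2) p.1 := h.cont.comp
    (by fun_prop : Continuous fun p : A × A => (x + p.2, p.1))
  rw [e1, integral_swap_of_subgroup hL.compact'
    (((hic.comp continuous_fst).mul (hφc.comp continuous_snd)).mul hχc)
    (fun y z hy => by rw [ind_of_notMem hy]; simp) (fun y z hz => by rw [hφ' z hz]; simp)]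
  have e2 : ∀ z, ∫ y, ind L' y * φ z * χ (x + z) y ∂μ = φ (-x) * μ.real L' * ind L (x + z) := by
    intro z
    have e3 : ∀ y, ind L' y * φ z * χ (x + z) y = φ z * (ind L' y * χ (x + z) y) :=
      fun y => by ring
    simp only [e3]
    rw [integral_const_mul]
    change φ z * kernelTransform χ μ (ind L') (x + z) = _
    rw [kernelTransform_ind h hL]
    by_cases hz : x + z ∈ L
    · have := hφ (-x) _ hz
      rw [neg_add_cancel_left] at this
      rw [this]; ring
    · rw [ind_of_notMem hz]; ring
  simp only [e2]
  rw [integral_const_mul, integral_add_left_eq_self (fun z => ind L z) x, integral_ind hL.isOpen]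
  have : (μ.real L : ℂ) * μ.real L' = 1 := by exact_mod_cast hvol
  linear_combination φ (-x) * this

/-- After Fubini, completing the square turns the integral over x ∈ L' into that of f(x + y), and y
∈ L' can be translated away. -/
lemma integral_mul_kernelTransform [μ.IsAddHaarMeasure] (h : IsQuadratic χ f) {φ : A → ℂ}
    {L L' : AddSubgroup A} (hL : IsDualPair χ L L')
    (hφ : ∀ x, ∀ l ∈ L, φ (x + l) = φ x) (hφ' : ∀ x ∉ L', φ x = 0) :
    ∫ x, f x * kernelTransform χ μ φ x ∂μ =
      (∫ x, ind L' x * f x ∂μ) * ∫ x, conj (f x) * φ x ∂μ := by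
  have hφc : Continuous φ := (isLocallyConstant_of_add hL.isOpen hφ).continuous
  have hic : Continuous (ind L') := (isLocallyConstant_ind hL.isOpen').continuous
  have e1 : ∀ x, f x * kernelTransform χ μ φ x = ∫ y, ind L' x * f x * φ y * χ x y ∂μ := by
    intro x
    by_cases hx : x ∈ L'
    · rw [kernelTransform, ← integral_const_mul, ind_of_mem hx]
      congr 1
      ext y
      ring
    · rw [kernelTransform_eq_zero h hL hφ hx]
      simp [ind_of_notMem hx]
  simp only [e1]
  rw [integral_swap_of_subgroup hL.compact' ((((hic.comp continuous_fst).mul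
    (h.cont_f.comp continuous_fst)).mul (hφc.comp continuous_snd)).mul h.cont)
    (fun y z hy => by rw [ind_of_notMem hy]; simp) (fun y z hz => by rw [hφ' z hz]; simp),
    ← integral_const_mul]
  congr 1
  ext y
  by_cases hy : y ∈ L'
  · have e2 : ∀ x, ind L' x * f x * φ y * χ x y =
        conj (f y) * φ y * (ind L' (x + y) * f (x + y)) := by
      intro x
      rw [ind_add x hy]
      linear_combination ind L' x * φ y * h.f_mul_χ x y
    simp only [e2]
    rw [integral_const_mul, integral_add_right_eq_self (fun x => ind L' x * f x) y]
    ring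
  · simp [hφ' y hy]

omit [IsTopologicalAddGroup A] [BorelSpace A] in
-- In the archimedean alternative `A` is connected, so its compact open subgroup is everything, and
-- a compact ℝⁿ is trivial.
lemma IsDualSystem.isLocallyConstant (hP : IsDualSystem χ μ P) {φ : A → ℂ}
    (hφ : IsSchwartzBruhat φ) : IsLocallyConstant φ ∧ HasCompactSupport φ := by
  rcases hφ with h | ⟨n, e, g, rfl⟩
  · exact h
  have : ConnectedSpace A := Function.Surjective.connectedSpace e.symm.surjective e.symm.continuous
  obtain ⟨L, L', hLL, -, -⟩ := hP.cofinal Set.univ univ_mem ∅ isCompact_empty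
  have hL := hP.dual L L' hLL
  have hLtop : (L : Set A) = Set.univ :=
    IsClopen.eq_univ ⟨hL.compact.isClosed, hL.isOpen⟩ ⟨0, L.zero_mem⟩
  have : CompactSpace A := ⟨by rw [← hLtop]; exact hL.compact⟩
  have : CompactSpace (EuclideanSpace ℝ (Fin n)) := e.toHomeomorph.compactSpace
  have hsub : Subsingleton (EuclideanSpace ℝ (Fin n)) := by
    by_contra hns
    rw [not_subsingleton_iff_nontrivial] at hns
    exact NormedSpace.noncompactSpace ℝ (EuclideanSpace ℝ (Fin n)) |>.1 isCompact_univ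
  have : Subsingleton A := e.injective.subsingleton
  exact ⟨IsLocallyConstant.of_constant _ fun x y => by rw [Subsingleton.elim x y],
    HasCompactSupport.of_compactSpace _⟩

omit [BorelSpace A] in
lemma IsDualSystem.exists_pair (hP : IsDualSystem χ μ P) {φ : A → ℂ}
    (hφ : IsSchwartzBruhat φ) {U : Set A} (hU : U ∈ 𝓝 0) {K : Set A} (hK : IsCompact K) :
    ∃ L L', P L L' ∧ ↑L ⊆ U ∧ K ⊆ L' ∧ (∀ x, ∀ l ∈ L, φ (x + l) = φ x) ∧ ∀ x ∉ L', φ x = 0 := by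
  obtain ⟨h1, h2⟩ := hP.isLocallyConstant hφ
  obtain ⟨W, hW, hφW⟩ := exists_uniform_of_isLocallyConstant h1 h2
  obtain ⟨L, L', hLL, hLU, hKL⟩ := hP.cofinal (U ∩ W) (inter_mem hU hW) (K ∪ tsupport φ)
    (hK.union h2.isCompact)
  refine ⟨L, L', hLL, fun x hx => (hLU hx).1, fun x hx => hKL (Or.inl hx),
    fun x l hl => hφW x l (hLU hl).2, fun x hx => ?_⟩
  exact image_eq_zero_of_notMem_tsupport fun hx' => hx (hKL (Or.inr hx'))

/-- Take the indicator of a subgroup so small that Re f > 1/2 on it. -/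
lemma IsDualSystem.exists_integral_ne_zero (hP : IsDualSystem χ μ P) (h : IsQuadratic χ f)
    (ν : Measure A) (hν : ν.IsAddHaarMeasure) :
    ∃ φ, IsSchwartzBruhat φ ∧ ∫ x, conj (f x) * φ x ∂ν ≠ 0 := by
  have hU : {x | 1 / 2 < (f x).re} ∈ 𝓝 (0 : A) := by
    refine (isOpen_lt continuous_const (Complex.continuous_re.comp h.cont_f)).mem_nhds ?_
    change 1 / 2 < (f 0).re
    rw [h.f_zero]; norm_num
  obtain ⟨L, L', hLL, hLU, -⟩ := hP.cofinal _ hU ∅ isCompact_empty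
  have hL := hP.dual L L' hLL
  have hcs : HasCompactSupport (ind L) :=
    hasCompactSupport_of_subgroup hL.compact fun x hx => ind_of_notMem hx
  refine ⟨ind L, Or.inl ⟨isLocallyConstant_ind hL.isOpen, hcs⟩, fun h0 => ?_⟩
  have hint : Integrable (fun x => conj (f x) * ind L x) ν :=
    Continuous.integrable_of_hasCompactSupport
      ((Complex.continuous_conj.comp h.cont_f).mul (isLocallyConstant_ind hL.isOpen).continuous)
      hcs.mul_left
  have hre : ∫ x, (conj (f x) * ind L x).re ∂ν = 0 := by
    have h1 := integral_re hint
    simp only [RCLike.re_eq_complex_re] at h1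
    rw [h1, h0]; simp
  have hpos : 1 / 2 * ν.real L ≤ ∫ x, (conj (f x) * ind L x).re ∂ν := by
    rw [← integral_indicator_one hL.isOpen.measurableSet, ← integral_const_mul]
    refine integral_mono ?_ hint.re fun x => ?_
    · exact ((integrable_indicator_iff hL.isOpen.measurableSet).2
        (integrableOn_const (by exact hL.compact.measure_lt_top.ne))).const_mul _
    · by_cases hx : x ∈ L
      · have h2 : 1 / 2 < (f x).re := hLU hx
        simp [ind_of_mem hx, Set.indicator_of_mem (s := (L : Set A)) hx]
        linarith
      · simp [ind_of_notMem hx, Set.indicator_of_notMem (s := (L : Set A)) hx]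
  have hLpos : 0 < ν.real L := by
    rw [measureReal_def, ENNReal.toReal_pos_iff]
    exact ⟨hL.isOpen.measure_pos ν ⟨0, L.zero_mem⟩, hL.compact.measure_lt_top⟩
  linarith

lemma IsDualSystem.isWeilConst (hP : IsDualSystem χ μ P) (h : IsQuadratic χ f) {c : ℂ}
    (hc : IsStable f μ P c) : IsWeilConst χ f c := by
  have := hP.haar
  obtain ⟨U, hU, K, hK, hUK⟩ := hc
  refine ⟨μ, ⟨hP.haar, fun φ hφ x => ?_⟩, fun φ hφ => ?_⟩
  · obtain ⟨L, L', hLL, -, -, h1, h2⟩ := hP.exists_pair hφ univ_mem isCompact_empty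
    exact kernelTransform_kernelTransform h (hP.dual _ _ hLL) (hP.vol _ _ hLL) h1 h2 x
  · obtain ⟨L, L', hLL, hLU, hKL, h1, h2⟩ := hP.exists_pair hφ hU hK
    rw [integral_mul_kernelTransform h (hP.dual _ _ hLL) h1 h2, hUK L L' hLL hLU hKL]

/-- For one fixed φ, `integral_mul_kernelTransform` expresses the integral of `f` over L' as a
quotient that does not involve L'. -/
lemma IsDualSystem.exists_isStable (hP : IsDualSystem χ μ P) (h : IsQuadratic χ f) :
    ∃ c, IsStable f μ P c := by
  have hμ := hP.haar
  obtain ⟨φ, hφ, h0⟩ := hP.exists_integral_ne_zero h μ hP.haar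
  obtain ⟨h1, h2⟩ := hP.isLocallyConstant hφ
  obtain ⟨W, hW, hφW⟩ := exists_uniform_of_isLocallyConstant h1 h2
  refine ⟨(∫ x, f x * kernelTransform χ μ φ x ∂μ) / ∫ x, conj (f x) * φ x ∂μ, W, hW,
    tsupport φ, h2.isCompact, fun L L' hLL hLW hφL => ?_⟩
  rw [eq_div_iff h0, integral_mul_kernelTransform h (hP.dual _ _ hLL) fun x l hl =>
    hφW x l (hLW hl)]
  exact fun x hx => image_eq_zero_of_notMem_tsupport fun hx' => hx (hφL hx')

omit [IsTopologicalAddGroup A] [BorelSpace A] [T2Space A] in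
lemma IsDualSystem.conj' (hP : IsDualSystem χ μ P) :
    IsDualSystem (fun x y => conj (χ x y)) μ P where
  haar := hP.haar
  vol := hP.vol
  cofinal := hP.cofinal
  dual L L' hLL := by
    have hL := hP.dual L L' hLL
    have h1 : ∀ z : ℂ, conj z = 1 ↔ z = 1 := fun z =>
      map_eq_one_iff _ (starRingEnd ℂ).injective
    exact ⟨hL.compact, hL.isOpen, hL.compact', hL.isOpen', by simpa only [h1] using hL.mem_iff',
      by simpa only [h1] using hL.mem_iff⟩

/-- Apply `integral_mul_kernelTransform` to `f` and φ, then to the conjugate of `f` and the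
transform of φ. The conjugate kernel inverts the transform, so one returns to the same nonzero
integral, multiplied by c·c'. -/
lemma IsDualSystem.mul_eq_one (hP : IsDualSystem χ μ P) (h : IsQuadratic χ f) {c c' : ℂ}
    (hc : IsStable f μ P c) (hc' : IsStable (fun x => conj (f x)) μ P c') : c * c' = 1 := by
  have hμ := hP.haar
  obtain ⟨φ, hφ, h0⟩ := hP.exists_integral_ne_zero h μ hP.haar
  obtain ⟨U, hU, K, hK, hUK⟩ := hc
  obtain ⟨U', hU', K', hK', hUK'⟩ := hc'
  obtain ⟨L, L', hLL, hLU, hKL, h1, h2⟩ := hP.exists_pair hφ (inter_mem hU hU') (hK.union hK')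
  have hL := hP.dual _ _ hLL
  have e1 := integral_mul_kernelTransform (μ := μ) h hL h1 h2
  rw [hUK L L' hLL (fun x hx => (hLU hx).1) fun x hx => hKL (Or.inl hx)] at e1
  have e2 := integral_mul_kernelTransform (μ := μ) h.conj' (hP.conj'.dual _ _ hLL)
    (φ := kernelTransform χ μ φ) (fun x l hl => kernelTransform_add h hL h2 x hl)
    (fun x hx => kernelTransform_eq_zero h hL h1 hx)
  rw [hUK' L L' hLL (fun x hx => (hLU hx).2) fun x hx => hKL (Or.inr hx)] at e2
  simp only [Complex.conj_conj] at e2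
  have e3 : ∀ x, kernelTransform (fun x y => conj (χ x y)) μ (kernelTransform χ μ φ) x = φ x := by
    intro x
    have h3 := kernelTransform_kernelTransform h hL (hP.vol _ _ hLL) h1 h2 (-x)
    rw [neg_neg] at h3
    rw [← h3, kernelTransform, kernelTransform]
    simp only [h.neg_left]
  simp only [e3] at e2
  rw [e1] at e2
  refine mul_right_cancel₀ h0 ?_
  rw [one_mul]
  linear_combination -e2

end DualSystem

end Metaplectic

namespace Metaplectic

/-! ### Diagonal forms over finite and non-archimedean fields -/

section NonArchimedean

open Filter Topology
open scoped ComplexConjugate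

variable {F : Type*} [Field F] [TopologicalSpace F] {ψ : AddChar F Circle}

lemma isQuadratic_of_biadditive {A : Type*} [AddCommGroup A] [TopologicalSpace A]
    [IsTopologicalRing F] (hψ : Continuous ψ) (h2 : (2 : F) ≠ 0) {B : A → A → F}
    (hsymm : ∀ x y, B x y = B y x) (hadd : ∀ x y z, B x (y + z) = B x y + B x z)
    (hcont : Continuous fun p : A × A => B p.1 p.2) :
    IsQuadratic (fun x y => (ψ (B x y) : ℂ)) fun x => (ψ (2⁻¹ * B x x) : ℂ) where
  symm x y := by rw [hsymm]
  add x y z := by rw [hadd, AddChar.map_add_eq_mul, Circle.coe_mul]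
  norm_χ x y := Circle.norm_coe _
  cont := continuous_subtype_val.comp (hψ.comp hcont)
  map_add x y := by
    have h1 : (2 : F)⁻¹ * B (x + y) (x + y) = 2⁻¹ * B x x + 2⁻¹ * B y y + B x y := by
      rw [hadd, hsymm (x + y), hsymm (x + y), hadd, hadd, hsymm y x]
      field_simp
      ring
    rw [h1, AddChar.map_add_eq_mul, AddChar.map_add_eq_mul, Circle.coe_mul, Circle.coe_mul]
  norm_f x := Circle.norm_coe _
  cont_f := continuous_subtype_val.comp (hψ.comp (continuous_const.mul
    (hcont.comp (continuous_id.prodMk continuous_id))))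

/-- The bicharacter `ψ (a x y)` of the line. -/
def lineChar (ψ : AddChar F Circle) (a x y : F) : ℂ := ψ (a * x * y)

/-- The function `ψ (½ a x²)` on the line. -/
def lineQuad (ψ : AddChar F Circle) (a x : F) : ℂ := ψ (2⁻¹ * (a * x * x))

omit [TopologicalSpace F] in
lemma lineChar_neg (a x y : F) : lineChar ψ (-a) x y = conj (lineChar ψ a x y) := by
  rw [lineChar, lineChar, neg_mul, neg_mul, AddChar.map_neg_eq_inv, Circle.coe_inv_eq_conj]

omit [TopologicalSpace F] in
lemma lineQuad_neg (a x : F) : lineQuad ψ (-a) x = conj (lineQuad ψ a x) := by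
  rw [lineQuad, lineQuad, neg_mul, neg_mul, mul_neg, AddChar.map_neg_eq_inv,
    Circle.coe_inv_eq_conj]

omit [TopologicalSpace F] in
lemma coe_addChar_sum {ι : Type*} (s : Finset ι) (g : ι → F) :
    (ψ (∑ i ∈ s, g i) : ℂ) = ∏ i ∈ s, (ψ (g i) : ℂ) := by
  classical
  induction s using Finset.induction_on with
  | empty => simp
  | insert a s ha ih =>
    rw [Finset.sum_insert ha, Finset.prod_insert ha, AddChar.map_add_eq_mul, Circle.coe_mul, ih]

omit [TopologicalSpace F] in
lemma diagChar_eq {ι : Type*} [Fintype ι] (a x y : ι → F) :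
    diagChar ψ a x y = ∏ i, lineChar ψ (a i) (x i) (y i) := by
  rw [diagChar, coe_addChar_sum]
  rfl

omit [TopologicalSpace F] in
lemma diagQuad_eq {ι : Type*} [Fintype ι] (a x : ι → F) :
    diagQuad ψ a x = ∏ i, lineQuad ψ (a i) (x i) := by
  rw [diagQuad, Finset.mul_sum, coe_addChar_sum]
  rfl

/-- The subgroup `{x | c x ∈ N}`. -/
def scaled (c : F) (N : AddSubgroup F) : AddSubgroup F := N.comap (AddMonoidHom.mulLeft c)

omit [TopologicalSpace F] in
lemma mem_scaled {c : F} {N : AddSubgroup F} {x : F} : x ∈ scaled c N ↔ c * x ∈ N := Iff.rfl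

variable [IsTopologicalRing F]

lemma isOpen_scaled {N : AddSubgroup F} (hN : IsOpen (N : Set F)) (c : F) :
    IsOpen (scaled c N : Set F) :=
  hN.preimage (continuous_const.mul continuous_id)

lemma isCompact_scaled {N : AddSubgroup F} (hN : IsCompact (N : Set F)) {c : F} (hc : c ≠ 0) :
    IsCompact (scaled c N : Set F) :=
  (Homeomorph.mulLeft₀ c hc).isCompact_preimage.2 hN

lemma isQuadratic_line (hψ : Continuous ψ) (h2 : (2 : F) ≠ 0) (a : F) :
    IsQuadratic (lineChar ψ a) (lineQuad ψ a) :=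
  isQuadratic_of_biadditive hψ h2 (B := fun x y => a * x * y) (fun x y => by ring)
    (fun x y z => by ring) (by fun_prop)

lemma isQuadratic_diag (hψ : Continuous ψ) (h2 : (2 : F) ≠ 0) {ι : Type*} [Fintype ι]
    (a : ι → F) : IsQuadratic (diagChar ψ a) (diagQuad ψ a) :=
  isQuadratic_of_biadditive hψ h2 (B := fun x y : ι → F => ∑ i, a i * x i * y i)
    (fun x y => Finset.sum_congr rfl fun i _ => by ring)
    (fun x y z => by
      rw [← Finset.sum_add_distrib]
      exact Finset.sum_congr rfl fun i _ => by rw [Pi.add_apply]; ring) (by fun_prop)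

variable [MeasurableSpace F] [BorelSpace F] [LocallyCompactSpace F] [SecondCountableTopology F]

/-- The image of `μ` under multiplication by `c` is again a Haar measure, hence a multiple of `μ`.
-/
lemma exists_measureReal_scaled (μ : Measure F) [μ.IsAddHaarMeasure] {c : F} (hc : c ≠ 0) :
    ∃ k : ℝ, ∀ N : AddSubgroup F, IsOpen (N : Set F) →
      μ.real (scaled c N : Set F) = k * μ.real N := by
  let E : F ≃ₜ+ F :=
    { Homeomorph.mulLeft₀ c hc with
      map_add' := fun x y => mul_add c x y }
  have hE : ∀ x, E x = c * x := fun _ => rfl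
  have := E.isAddHaarMeasure_map μ
  obtain ⟨k, h1⟩ : ∃ k : NNReal, μ.map E = k • μ :=
    ⟨_, Measure.isAddLeftInvariant_eq_smul (μ.map E) μ⟩
  refine ⟨k, fun N hN => ?_⟩
  have h2 : (μ.map E) N = μ (scaled c N : Set F) :=
    Measure.map_apply E.continuous.measurable hN.measurableSet
  rw [measureReal_def, ← h2, h1]
  exact measureReal_nnreal_smul_apply k

/-- The system of dual pairs on the line with bicharacter `ψ (a x y)`. -/
def linePairs (a : F) (N N' : AddSubgroup F) (L L' : AddSubgroup F) : Prop :=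
  ∃ c : F, c ≠ 0 ∧ L = scaled c⁻¹ N ∧ L' = scaled (a * c) N'

lemma IsBaseLattice.exists_isDualSystem {N N' : AddSubgroup F}
    (hN : IsBaseLattice ψ N N') {a : F} (ha : a ≠ 0) :
    ∃ μ : Measure F, IsDualSystem (lineChar ψ a) μ (linePairs a N N') := by
  let μ₀ : Measure F := Measure.addHaar
  have hpos : ∀ L : AddSubgroup F, IsOpen (L : Set F) → IsCompact (L : Set F) →
      0 < μ₀.real (L : Set F) := by
    intro L hL hL'
    rw [measureReal_def, ENNReal.toReal_pos_iff]
    exact ⟨hL.measure_pos μ₀ ⟨0, L.zero_mem⟩, hL'.measure_lt_top⟩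
  -- Normalizing by √r makes the volumes reciprocal for c = 1. For other `c` the two volumes change
  -- by inverse factors.
  set r := μ₀.real (N : Set F) * μ₀.real (scaled a N' : Set F) with hr
  have hr0 : 0 < r := mul_pos (hpos N hN.isOpen hN.compact)
    (hpos _ (isOpen_scaled hN.isOpen' a) (isCompact_scaled hN.compact' ha))
  have hsr : 0 < (Real.sqrt r)⁻¹ := inv_pos.2 (Real.sqrt_pos.2 hr0)
  let μ : Measure F := ENNReal.ofReal (Real.sqrt r)⁻¹ • μ₀
  have hμ : μ.IsAddHaarMeasure :=
    Measure.IsAddHaarMeasure.smul _ (by simpa using hsr) ENNReal.ofReal_ne_top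
  have hμr : ∀ S : Set F, μ.real S = (Real.sqrt r)⁻¹ * μ₀.real S := by
    intro S
    rw [measureReal_ennreal_smul_apply, ENNReal.toReal_ofReal hsr.le]
  refine ⟨μ, hμ, ?_, ?_, ?_⟩
  · rintro L L' ⟨c, hc, rfl, rfl⟩
    refine ⟨isCompact_scaled hN.compact (inv_ne_zero hc), isOpen_scaled hN.isOpen _,
      isCompact_scaled hN.compact' (mul_ne_zero ha hc), isOpen_scaled hN.isOpen' _,
      fun y => ?_, fun x => ?_⟩
    · rw [mem_scaled, hN.mem_iff']
      constructor
      · intro h x hx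
        have := h _ (mem_scaled.1 hx)
        rw [lineChar, ← Circle.coe_one, Circle.coe_inj, ← this]
        congr 1
        field_simp
      · intro h x hx
        have := h (c * x) (by rwa [mem_scaled, inv_mul_cancel_left₀ hc])
        rw [lineChar, ← Circle.coe_one, Circle.coe_inj] at this
        rw [← this]
        congr 1
        ring
    · rw [mem_scaled, hN.mem_iff]
      constructor
      · intro h y hy
        have := h _ (mem_scaled.1 hy)
        rw [lineChar, ← Circle.coe_one, Circle.coe_inj, ← this]
        congr 1
        field_simp
      · intro h y hy
        have := h ((a * c)⁻¹ * y) (by rwa [mem_scaled, mul_inv_cancel_left₀ (mul_ne_zero ha hc)])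
        rw [lineChar, ← Circle.coe_one, Circle.coe_inj] at this
        rw [← this]
        congr 1
        field_simp
  · rintro L L' ⟨c, hc, rfl, rfl⟩
    obtain ⟨k, hk⟩ := exists_measureReal_scaled μ₀ hc
    obtain ⟨k', hk'⟩ := exists_measureReal_scaled μ₀ (inv_ne_zero hc)
    have hkk : k * k' = 1 := by
      have h1 : scaled c (scaled c⁻¹ N) = N := by
        ext x
        rw [mem_scaled, mem_scaled, inv_mul_cancel_left₀ hc]
      have h2 := hk (scaled c⁻¹ N) (isOpen_scaled hN.isOpen _)
      rw [h1, hk' N hN.isOpen] at h2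
      refine mul_right_cancel₀ (hpos N hN.isOpen hN.compact).ne' ?_
      linarith
    have h3 : scaled (a * c) N' = scaled c (scaled a N') := by
      ext x
      rw [mem_scaled, mem_scaled, mem_scaled, mul_assoc]
    rw [hμr, hμr, hk' N hN.isOpen, h3, hk _ (isOpen_scaled hN.isOpen' a)]
    have h4 : (Real.sqrt r)⁻¹ * (Real.sqrt r)⁻¹ * r = 1 := by
      rw [← mul_inv, Real.mul_self_sqrt hr0.le, inv_mul_cancel₀ hr0.ne']
    rw [hr] at h4
    linear_combination h4 + (Real.sqrt r)⁻¹ * (Real.sqrt r)⁻¹ * r * hkk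
  · intro U hU K hK
    obtain ⟨c, hc, h1, h3⟩ := hN.cofinal U hU ((fun x => a * x) '' K)
      (hK.image (continuous_const.mul continuous_id))
    refine ⟨_, _, ⟨c, hc, rfl, rfl⟩, fun x hx => ?_, fun x hx => ?_⟩
    · have := h1 _ (mem_scaled.1 hx)
      rwa [mul_inv_cancel_left₀ hc] at this
    · have := h3 _ ⟨x, hx, rfl⟩
      change a * c * x ∈ N'
      rwa [mul_assoc, mul_left_comm]

/-- Products of pairs of subgroups. -/
def prodPairs {ι : Type*} (P : ι → AddSubgroup F → AddSubgroup F → Prop)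
    (L L' : AddSubgroup (ι → F)) : Prop :=
  ∃ M M' : ι → AddSubgroup F, (∀ i, P i (M i) (M' i)) ∧ L = AddSubgroup.pi Set.univ M ∧
    L' = AddSubgroup.pi Set.univ M'

omit [TopologicalSpace F] [IsTopologicalRing F] [MeasurableSpace F] [BorelSpace F]
  [LocallyCompactSpace F] [SecondCountableTopology F] in
lemma single_mem_pi {ι : Type*} [DecidableEq ι] {M : ι → AddSubgroup F} {i : ι} {x : F}
    (hx : x ∈ M i) : Pi.single i x ∈ AddSubgroup.pi Set.univ M := by
  intro j _
  by_cases hij : j = i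
  · subst hij; simpa using hx
  · simp [hij]

lemma IsDualSystem.pi (hψ : Continuous ψ) (h2 : (2 : F) ≠ 0) {ι : Type*} [Fintype ι]
    {a : ι → F} {μ : ι → Measure F} {P : ι → AddSubgroup F → AddSubgroup F → Prop}
    (h : ∀ i, IsDualSystem (lineChar ψ (a i)) (μ i) (P i)) :
    IsDualSystem (diagChar ψ a) (Measure.pi μ) (prodPairs P) := by
  classical
  have hhaar := fun i => (h i).haar
  refine ⟨inferInstance, ?_, ?_, ?_⟩
  · rintro L L' ⟨M, M', hM, rfl, rfl⟩
    have hd := fun i => (h i).dual _ _ (hM i)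
    have hq := fun i => isQuadratic_line hψ h2 (a i)
    refine ⟨?_, ?_, ?_, ?_, ?_, ?_⟩
    · rw [AddSubgroup.coe_pi]; exact isCompact_univ_pi fun i => (hd i).compact
    · rw [AddSubgroup.coe_pi]; exact isOpen_set_pi Set.finite_univ fun i _ => (hd i).isOpen
    · rw [AddSubgroup.coe_pi]; exact isCompact_univ_pi fun i => (hd i).compact'
    · rw [AddSubgroup.coe_pi]; exact isOpen_set_pi Set.finite_univ fun i _ => (hd i).isOpen'
    · intro y
      constructor
      · intro hy x hx
        rw [diagChar_eq]
        exact Finset.prod_eq_one fun i _ =>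
          ((hd i).mem_iff' _).1 (hy i trivial) _ (hx i trivial)
      · intro hy i _
        refine ((hd i).mem_iff' _).2 fun x hx => ?_
        have h1 := hy _ (single_mem_pi hx)
        rw [diagChar_eq, Finset.prod_eq_single i (fun j _ hj => by
          rw [Pi.single_eq_of_ne hj, (hq j).zero_left]) (by simp), Pi.single_eq_same] at h1
        exact h1
    · intro x
      constructor
      · intro hx y hy
        rw [diagChar_eq]
        exact Finset.prod_eq_one fun i _ =>
          ((hd i).mem_iff _).1 (hx i trivial) _ (hy i trivial)
      · intro hx i _
        refine ((hd i).mem_iff _).2 fun y hy => ?_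
        have h1 := hx _ (single_mem_pi hy)
        rw [diagChar_eq, Finset.prod_eq_single i (fun j _ hj => by
          rw [Pi.single_eq_of_ne hj, (hq j).zero_right]) (by simp), Pi.single_eq_same] at h1
        exact h1
  · rintro L L' ⟨M, M', hM, rfl, rfl⟩
    simp only [measureReal_def, AddSubgroup.coe_pi, Measure.pi_pi, ENNReal.toReal_prod]
    rw [← Finset.prod_mul_distrib]
    exact Finset.prod_eq_one fun i _ => (h i).vol _ _ (hM i)
  · intro U hU K hK
    rw [nhds_pi, Filter.mem_pi] at hU
    obtain ⟨I, -, t, ht, htU⟩ := hU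
    choose M M' hM hMt hKM using fun i => (h i).cofinal (t i) (ht i) ((fun x => x i) '' K)
      (hK.image (continuous_apply i))
    refine ⟨_, _, ⟨M, M', hM, rfl, rfl⟩, fun x hx => ?_, fun x hx i _ => ?_⟩
    · exact htU fun i _ => hMt i (hx i trivial)
    · exact hKM i ⟨x, hx, rfl⟩

omit [LocallyCompactSpace F] [IsTopologicalRing F] [BorelSpace F]
  [SecondCountableTopology F] in
lemma IsStable.pi {ι : Type*} [Fintype ι]
    {a : ι → F} {μ : ι → Measure F} {P : ι → AddSubgroup F → AddSubgroup F → Prop}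
    [∀ i, SigmaFinite (μ i)] {c : ι → ℂ}
    (h : ∀ i, IsStable (lineQuad ψ (a i)) (μ i) (P i) (c i)) :
    IsStable (diagQuad ψ a) (Measure.pi μ) (prodPairs P) (∏ i, c i) := by
  classical
  choose U hU K hK hUK using h
  -- 0 is added to each compact set so that vectors supported on one coordinate lie in the product,
  -- which is how the conditions on single factors are recovered.
  refine ⟨Set.univ.pi U, set_pi_mem_nhds Set.finite_univ fun i _ => hU i,
    Set.univ.pi fun i => insert 0 (K i), isCompact_univ_pi fun i => (hK i).insert 0, ?_⟩
  rintro L L' ⟨M, M', hM, rfl, rfl⟩ hLU hKL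
  have h1 : ∀ x : ι → F, ind (AddSubgroup.pi Set.univ M') x * diagQuad ψ a x =
      ∏ i, (ind (M' i) (x i) * lineQuad ψ (a i) (x i)) := by
    intro x
    rw [diagQuad_eq, Finset.prod_mul_distrib]
    congr 1
    by_cases hx : x ∈ AddSubgroup.pi Set.univ M'
    · rw [ind_of_mem hx, Finset.prod_eq_one fun i _ => ind_of_mem (hx i trivial)]
    · rw [ind_of_notMem hx]
      obtain ⟨i, hi⟩ : ∃ i, x i ∉ M' i := by
        by_contra! hcon
        exact hx fun i _ => hcon i
      refine (Finset.prod_eq_zero (Finset.mem_univ i) ?_).symm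
      exact ind_of_notMem hi
  simp only [h1]
  rw [integral_fintype_prod_eq_prod (fun i x => ind (M' i) x * lineQuad ψ (a i) x)]
  refine Finset.prod_congr rfl fun i _ => hUK i _ _ (hM i) (fun x hx => ?_) fun x hx => ?_
  · have := hLU (single_mem_pi hx) i trivial
    simpa using this
  · have h3 : Pi.single i x ∈ AddSubgroup.pi Set.univ M' := by
      refine hKL fun j _ => ?_
      by_cases hij : j = i
      · subst hij
        simp [hx]
      · simp [hij]
    simpa using h3 i trivial

omit [MeasurableSpace F] [BorelSpace F] in
theorem IsBaseLattice.exists_isDiagSymbol [T2Space F] (hψ : Continuous ψ) (h2 : (2 : F) ≠ 0)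
    {N N' : AddSubgroup F} (hN : IsBaseLattice ψ N N') : ∃ γ₁, IsDiagSymbol ψ γ₁ := by
  classical
  let : MeasurableSpace F := borel F
  have : BorelSpace F := ⟨rfl⟩
  have hex : ∀ a : F, ∃ (c : ℂ) (μ : Measure F), a ≠ 0 →
      IsDualSystem (lineChar ψ a) μ (linePairs a N N') ∧
      IsStable (lineQuad ψ a) μ (linePairs a N N') c := by
    intro a
    by_cases ha : a = 0
    · exact ⟨1, 0, fun h => absurd ha h⟩
    · obtain ⟨μ, hμ⟩ := hN.exists_isDualSystem ha
      obtain ⟨c, hc⟩ := hμ.exists_isStable (isQuadratic_line hψ h2 a)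
      exact ⟨c, μ, fun _ => ⟨hμ, hc⟩⟩
  choose γ μ hγ using hex
  refine ⟨fun a => if a = 0 then 1 else γ a, by simp, fun a => ?_, fun n a ha c => ?_⟩
  · by_cases ha : a = 0
    · simp [ha]
    beta_reduce
    rw [if_neg ha, if_neg (neg_ne_zero.2 ha)]
    have hq := isQuadratic_line hψ h2 a
    obtain ⟨hP, hs⟩ := hγ a ha
    obtain ⟨hP', hs'⟩ := hγ (-a) (neg_ne_zero.2 ha)
    -- The value chosen for `-a` belongs to another measure and system; uniqueness identifies it
    -- with the stable integral c' of the conjugate function in the system for `a`.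
    obtain ⟨c', hc'⟩ := hP.conj'.exists_isStable hq.conj'
    have h3 := hP.conj'.isWeilConst hq.conj' hc'
    have h4 := hP'.isWeilConst (isQuadratic_line hψ h2 (-a)) hs'
    have e1 : lineChar ψ (-a) = fun x y => conj (lineChar ψ a x y) := by
      ext x y; rw [lineChar_neg]
    have e2 : lineQuad ψ (-a) = fun x => conj (lineQuad ψ a x) := by
      ext x; rw [lineQuad_neg]
    rw [e1, e2] at h4
    rw [IsWeilConst.unique (hP.conj'.exists_integral_ne_zero hq.conj') h4 h3]
    exact hP.mul_eq_one hq hs hc'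
  · have hq := isQuadratic_diag hψ h2 a
    have hP := IsDualSystem.pi hψ h2 fun i => (hγ (a i) (ha i)).1
    have := fun i => (hγ (a i) (ha i)).1.haar
    have hs := IsStable.pi fun i => (hγ (a i) (ha i)).2
    have hc := hP.isWeilConst hq hs
    have hif : ∏ i, (if a i = 0 then 1 else γ (a i)) = ∏ i, γ (a i) :=
      Finset.prod_congr rfl fun i _ => if_neg (ha i)
    -- Product measures live on the product σ-algebra, which is the Borel one by second
    -- countability.
    have hborel : borel (Fin n → F) = MeasurableSpace.pi :=
      (BorelSpace.measurable_eq (α := Fin n → F)).symm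
    change @IsWeilConst _ _ _ (borel (Fin n → F)) _ _ c ↔ _
    rw [hif, hborel]
    constructor
    · intro h
      exact IsWeilConst.unique (hP.exists_integral_ne_zero hq) h hc
    · rintro rfl
      exact hc

end NonArchimedean

end Metaplectic

namespace Metaplectic

/-! ### Gaussian integrals and their oscillatory limit -/

section Gaussian

open scoped ComplexConjugate FourierTransform Topology
open Filter Complex

variable {ι : Type*} [Fintype ι]

/-- The function `exp (-π ∑ bᵢ xᵢ²)`. -/
def gaussianDiag (b : ι → ℂ) (x : EuclideanSpace ℝ ι) : ℂ :=
  cexp (-Real.pi * ∑ i, b i * (x i : ℂ) ^ 2)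

/-- The bicharacter `exp (2πi ∑ εᵢ xᵢ yᵢ)`. -/
def realDiagChar (ε : ι → ℝ) (x y : EuclideanSpace ℝ ι) : ℂ :=
  cexp ((2 * Real.pi * ∑ i, ε i * x i * y i : ℝ) * I)

lemma continuous_gaussianDiag (b : ι → ℂ) : Continuous (gaussianDiag b) := by
  unfold gaussianDiag; fun_prop

lemma continuous_realDiagChar (ε : ι → ℝ) :
    Continuous fun p : EuclideanSpace ℝ ι × EuclideanSpace ℝ ι => realDiagChar ε p.1 p.2 := by
  unfold realDiagChar; fun_prop

lemma norm_realDiagChar (ε : ι → ℝ) (x y : EuclideanSpace ℝ ι) : ‖realDiagChar ε x y‖ = 1 := by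
  rw [realDiagChar, norm_exp_ofReal_mul_I]

lemma norm_gaussianDiag_le {b : ι → ℂ} (hb : ∀ i, 0 ≤ (b i).re) (x : EuclideanSpace ℝ ι) :
    ‖gaussianDiag b x‖ ≤ 1 := by
  rw [gaussianDiag, norm_exp, Real.exp_le_one_iff, ← ofReal_neg, re_ofReal_mul, re_sum]
  refine mul_nonpos_of_nonpos_of_nonneg (by linarith [Real.pi_pos])
    (Finset.sum_nonneg fun i _ => ?_)
  rw [← ofReal_pow, re_mul_ofReal]
  exact mul_nonneg (hb i) (sq_nonneg _)

lemma gaussianDiag_eq_prod (b : ι → ℂ) (x : EuclideanSpace ℝ ι) :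
    gaussianDiag b x = ∏ i, cexp (-(Real.pi * b i) * (x i : ℂ) ^ 2) := by
  rw [gaussianDiag, ← Complex.exp_sum, Finset.mul_sum]
  congr 1
  exact Finset.sum_congr rfl fun i _ => by ring

lemma realDiagChar_eq_prod (ε : ι → ℝ) (x y : EuclideanSpace ℝ ι) :
    realDiagChar ε x y = ∏ i, cexp (I * (2 * Real.pi * ε i * y i : ℂ) * x i) := by
  rw [realDiagChar, ← Complex.exp_sum]
  congr 1
  push_cast
  rw [Finset.mul_sum, Finset.sum_mul]
  exact Finset.sum_congr rfl fun i _ => by ring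

lemma integrable_gaussianDiag {b : ι → ℂ} (hb : ∀ i, 0 < (b i).re) :
    Integrable (gaussianDiag b) := by
  have h1 : Integrable fun x : ι → ℝ => ∏ i, cexp (-(Real.pi * b i) * (x i : ℂ) ^ 2) :=
    Integrable.fintype_prod (f := fun i (t : ℝ) => cexp (-(Real.pi * b i) * (t : ℂ) ^ 2))
      fun i => integrable_cexp_neg_mul_sq (by
        rw [re_ofReal_mul]; exact mul_pos Real.pi_pos (hb i))
  have h2 := (PiLp.volume_preserving_ofLp ι).integrable_comp_of_integrable h1
  refine h2.congr (Eventually.of_forall fun x => ?_)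
  simp [gaussianDiag_eq_prod]

/-- A product of one-dimensional Gaussian Fourier transforms; the signs enter only through their
squares. -/
lemma integral_gaussianDiag_mul {b : ι → ℂ} (hb : ∀ i, 0 < (b i).re) {ε : ι → ℝ}
    (hε : ∀ i, ε i * ε i = 1) (y : EuclideanSpace ℝ ι) :
    ∫ x, gaussianDiag b x * realDiagChar ε x y =
      (∏ i, (b i)⁻¹ ^ (1 / 2 : ℂ)) * gaussianDiag (fun i => (b i)⁻¹) y := by
  have h1 : ∀ x : EuclideanSpace ℝ ι, gaussianDiag b x * realDiagChar ε x y =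
      (fun z : ι → ℝ => ∏ i, (cexp (I * (2 * Real.pi * ε i * y i : ℂ) * z i) *
        cexp (-(Real.pi * b i) * (z i : ℂ) ^ 2))) (WithLp.ofLp x) := by
    intro x
    beta_reduce
    rw [gaussianDiag_eq_prod, realDiagChar_eq_prod, Finset.prod_mul_distrib, mul_comm]
  simp_rw [h1]
  rw [(PiLp.volume_preserving_ofLp ι).integral_comp
    (MeasurableEquiv.toLp 2 (ι → ℝ)).symm.measurableEmbedding
    (fun z : ι → ℝ => ∏ i, (cexp (I * (2 * Real.pi * ε i * y i : ℂ) * z i) *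
        cexp (-(Real.pi * b i) * (z i : ℂ) ^ 2))),
    integral_fintype_prod_volume_eq_prod (fun i (t : ℝ) =>
      cexp (I * (2 * Real.pi * ε i * y i : ℂ) * t) * cexp (-(Real.pi * b i) * (t : ℂ) ^ 2)),
    gaussianDiag_eq_prod, ← Finset.prod_mul_distrib]
  refine Finset.prod_congr rfl fun i _ => ?_
  have hpi : (Real.pi : ℂ) ≠ 0 := ofReal_ne_zero.2 Real.pi_ne_zero
  have hbi : b i ≠ 0 := fun h => by simpa [h] using hb i
  have hεi : (ε i : ℂ) ^ 2 = 1 := by rw [sq]; exact_mod_cast hε i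
  rw [fourierIntegral_gaussian (by rw [re_ofReal_mul]; exact mul_pos Real.pi_pos (hb i))]
  congr 2
  · field_simp
  · rw [mul_pow, mul_pow, hεi]
    field_simp
    ring

lemma integral_gaussianDiag_mul_integral {b : ι → ℂ} (hb : ∀ i, 0 < (b i).re) {ε : ι → ℝ}
    (hε : ∀ i, ε i * ε i = 1) {φ : EuclideanSpace ℝ ι → ℂ} (hφ : Integrable φ) :
    ∫ x, gaussianDiag b x * kernelTransform (realDiagChar ε) volume φ x =
      (∏ i, (b i)⁻¹ ^ (1 / 2 : ℂ)) * ∫ y, gaussianDiag (fun i => (b i)⁻¹) y * φ y := by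
  simp only [kernelTransform]
  have hI : Integrable (Function.uncurry fun x y : EuclideanSpace ℝ ι =>
      gaussianDiag b x * (φ y * realDiagChar ε x y)) (volume.prod volume) := by
    have h1 := (integrable_gaussianDiag hb).mul_prod hφ
    have hm : AEStronglyMeasurable (fun p : EuclideanSpace ℝ ι × EuclideanSpace ℝ ι =>
        realDiagChar ε p.1 p.2) (volume.prod volume) :=
      (continuous_realDiagChar ε).aestronglyMeasurable
    have h2 := h1.mul_bdd hm (Eventually.of_forall fun p => (norm_realDiagChar ε p.1 p.2).le)
    simp only [mul_assoc] at h2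
    exact h2
  simp_rw [← integral_const_mul]
  rw [integral_integral_swap hI]
  refine integral_congr_ae (Eventually.of_forall fun y => ?_)
  beta_reduce
  rw [← mul_assoc, ← integral_gaussianDiag_mul hb hε, ← integral_mul_const]
  exact integral_congr_ae (Eventually.of_forall fun x => by ring)

/-- The limit constant of the Gaussian integrals. -/
def realWeilConst (ε : ι → ℝ) : ℂ := ∏ i, (I * ε i) ^ (1 / 2 : ℂ)

lemma tendsto_integral_gaussianDiag {b : ℝ → ι → ℂ} {b₀ : ι → ℂ}
    (hb : ∀ δ > 0, ∀ i, 0 ≤ (b δ i).re) (hlim : ∀ i, Tendsto (fun δ => b δ i) (𝓝[>] 0) (𝓝 (b₀ i)))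
    {φ : EuclideanSpace ℝ ι → ℂ} (hφ : Integrable φ) :
    Tendsto (fun δ => ∫ x, gaussianDiag (b δ) x * φ x) (𝓝[>] 0)
      (𝓝 (∫ x, gaussianDiag b₀ x * φ x)) := by
  refine tendsto_integral_filter_of_dominated_convergence (fun x => ‖φ x‖)
    (Eventually.of_forall fun δ => (continuous_gaussianDiag _).aestronglyMeasurable.mul
      hφ.aestronglyMeasurable) ?_ hφ.norm (Eventually.of_forall fun x => ?_)
  · filter_upwards [self_mem_nhdsWithin] with δ hδ
    refine Eventually.of_forall fun x => ?_
    rw [norm_mul]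
    exact mul_le_of_le_one_left (norm_nonneg _) (norm_gaussianDiag_le (hb δ hδ) x)
  · refine Tendsto.mul_const _ ?_
    refine (continuous_exp.tendsto _).comp (Tendsto.const_mul _ ?_)
    exact tendsto_finsetSum _ fun i _ => (hlim i).mul_const _

/-- The exponents -iεᵢ are approached by δ - iεᵢ with δ > 0, where the integrals converge
absolutely; then δ → 0 by dominated convergence. The limit of (δ - iεᵢ)⁻¹ is iεᵢ, which is off the
branch cut of the square root. -/
lemma integral_gaussian_identity {ε : ι → ℝ} (hε : ∀ i, ε i * ε i = 1)
    {φ : EuclideanSpace ℝ ι → ℂ} (hφ : Integrable φ)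
    (hφ' : Integrable (kernelTransform (realDiagChar ε) volume φ)) :
    ∫ x, gaussianDiag (fun i => -(I * ε i)) x * kernelTransform (realDiagChar ε) volume φ x =
      realWeilConst ε * ∫ y, gaussianDiag (fun i => I * ε i) y * φ y := by
  have hne : ∀ (δ : ℝ) (i : ι), (δ : ℂ) - I * ε i ≠ 0 := by
    intro δ i h
    have h1 := congrArg Complex.im h
    have h2 := hε i
    simp at h1
    simp [h1] at h2
  have hre : ∀ δ : ℝ, 0 < δ → ∀ i, 0 < ((δ : ℂ) - I * ε i).re := by
    intro δ hδ i
    simpa using hδ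
  have hinv0 : ∀ i, (-(I * ε i))⁻¹ = I * ε i := by
    intro i
    have h3 : (ε i : ℂ) * ε i = 1 := by exact_mod_cast hε i
    refine inv_eq_of_mul_eq_one_right ?_
    linear_combination (-(ε i : ℂ) * ε i) * I_mul_I + h3
  have hlim : ∀ i, Tendsto (fun δ : ℝ => (δ : ℂ) - I * ε i) (𝓝[>] 0) (𝓝 (-(I * ε i))) := by
    intro i
    have : Continuous fun δ : ℝ => (δ : ℂ) - I * ε i := by fun_prop
    have := this.tendsto 0
    simp only [ofReal_zero, zero_sub] at this
    exact this.mono_left nhdsWithin_le_nhds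
  have hlim' : ∀ i, Tendsto (fun δ : ℝ => ((δ : ℂ) - I * ε i)⁻¹) (𝓝[>] 0) (𝓝 (I * ε i)) := by
    intro i
    have h := (hlim i).inv₀ (by simpa using hne 0 i)
    rwa [hinv0] at h
  refine tendsto_nhds_unique
    (tendsto_integral_gaussianDiag (fun δ hδ i => (hre δ hδ i).le) hlim hφ') ?_
  have h1 := Tendsto.mul (f := fun δ : ℝ => ∏ i, ((δ : ℂ) - I * ε i)⁻¹ ^ (1 / 2 : ℂ))
    (a := realWeilConst ε) ?_
    (tendsto_integral_gaussianDiag (b := fun δ i => ((δ : ℂ) - I * ε i)⁻¹) (fun δ hδ i => ?_)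
      hlim' hφ)
  · refine h1.congr' ?_
    filter_upwards [self_mem_nhdsWithin] with δ hδ
    exact (integral_gaussianDiag_mul_integral (hre δ hδ) hε hφ).symm
  · refine tendsto_finsetProd _ fun i _ => (hlim' i).cpow tendsto_const_nhds ?_
    right
    have h2 := hε i
    have : ε i ≠ 0 := fun h => by simp [h] at h2
    simpa using this
  · rw [inv_re]
    exact div_nonneg (hre δ hδ i).le (normSq_nonneg _)

end Gaussian
end Metaplectic

namespace Metaplectic

/-! ### Diagonal real forms with entries ±1 -/

section RealDiagonal

open scoped ComplexConjugate FourierTransform Topology ContDiff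
open Filter Complex

variable {ι : Type*} [Fintype ι]

/-- A locally constant function on ℝⁿ is constant, hence smooth, and a continuous additive
isomorphism is ℝ-linear. -/
lemma IsSchwartzBruhat.exists_schwartzMap {φ : EuclideanSpace ℝ ι → ℂ}
    (hφ : IsSchwartzBruhat φ) : ∃ f : 𝓢(EuclideanSpace ℝ ι, ℂ), φ = f := by
  rcases hφ with ⟨h1, h2⟩ | ⟨n, e, f, rfl⟩
  · have h3 := h1.eq_const (0 : EuclideanSpace ℝ ι)
    have h4 : ContDiff ℝ ∞ φ := by rw [h3]; exact contDiff_const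
    exact ⟨h2.toSchwartzMap h4, rfl⟩
  · let L : EuclideanSpace ℝ ι ≃L[ℝ] EuclideanSpace ℝ (Fin n) :=
      { e.toAddEquiv with
        map_smul' := fun c x => (e.toAddEquiv.toAddMonoidHom.toRealLinearMap e.continuous).map_smul c x
        continuous_toFun := e.continuous
        continuous_invFun := e.symm.continuous }
    exact ⟨SchwartzMap.compCLMOfContinuousLinearEquiv ℝ L f, rfl⟩

lemma isSchwartzBruhat_schwartzMap (f : 𝓢(EuclideanSpace ℝ ι, ℂ)) :
    IsSchwartzBruhat (f : EuclideanSpace ℝ ι → ℂ) := by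
  let L := LinearIsometryEquiv.piLpCongrLeft 2 ℝ ℝ (Fintype.equivFin ι)
  let e : EuclideanSpace ℝ ι ≃ₜ+ EuclideanSpace ℝ (Fin (Fintype.card ι)) :=
    { L.toLinearEquiv.toAddEquiv with
      continuous_toFun := L.continuous
      continuous_invFun := L.symm.continuous }
  refine Or.inr ⟨_, e,
    SchwartzMap.compCLMOfContinuousLinearEquiv ℝ L.symm.toContinuousLinearEquiv f, ?_⟩
  ext x
  change f x = f (L.symm (L x))
  rw [L.symm_apply_apply]

/-- The diagonal isometry with entries `±1`. -/
def signIsometry {ε : ι → ℝ} (hε : ∀ i, ε i * ε i = 1) :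
    EuclideanSpace ℝ ι ≃ₗᵢ[ℝ] EuclideanSpace ℝ ι where
  toFun x := WithLp.toLp 2 fun i => ε i * x i
  invFun x := WithLp.toLp 2 fun i => ε i * x i
  left_inv x := by
    ext i
    simp [← mul_assoc, hε]
  right_inv x := by
    ext i
    simp [← mul_assoc, hε]
  map_add' x y := by
    ext i
    simp [mul_add]
  map_smul' c x := by
    ext i
    simp [mul_left_comm]
  norm_map' x := by
    change ‖WithLp.toLp 2 fun i => ε i * x i‖ = _
    rw [EuclideanSpace.norm_eq, EuclideanSpace.norm_eq]
    congr 1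
    refine Finset.sum_congr rfl fun i _ => ?_
    have : |ε i| = 1 := by
      rw [← sq_eq_sq₀ (abs_nonneg _) zero_le_one, sq_abs, sq, hε, one_pow]
    simp [this]

/-- This reduces Fourier inversion for an indefinite form to the Euclidean one. -/
lemma kernelTransform_realDiagChar {ε : ι → ℝ} (hε : ∀ i, ε i * ε i = 1)
    (φ : EuclideanSpace ℝ ι → ℂ) (x : EuclideanSpace ℝ ι) :
    kernelTransform (realDiagChar ε) volume φ x = 𝓕⁻ φ (signIsometry hε x) := by
  rw [Real.fourierInv_eq', kernelTransform]
  refine integral_congr_ae (Eventually.of_forall fun y => ?_)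
  beta_reduce
  rw [smul_eq_mul, mul_comm, realDiagChar, PiLp.inner_apply]
  rfl

lemma kernelTransform_realDiagChar_twice {ε : ι → ℝ} (hε : ∀ i, ε i * ε i = 1)
    (φ : 𝓢(EuclideanSpace ℝ ι, ℂ)) (x : EuclideanSpace ℝ ι) :
    kernelTransform (realDiagChar ε) volume (kernelTransform (realDiagChar ε) volume φ) x =
      φ (-x) := by
  have h1 : kernelTransform (realDiagChar ε) volume φ =
      (𝓕⁻ φ : 𝓢(EuclideanSpace ℝ ι, ℂ)) ∘ signIsometry hε := by
    ext y
    rw [kernelTransform_realDiagChar hε, SchwartzMap.fourierInv_coe]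
    rfl
  have h2 : signIsometry hε (signIsometry hε x) = x := (signIsometry hε).symm_apply_apply x
  rw [kernelTransform_realDiagChar hε, h1, Real.fourierInv_comp_linearIsometry, h2,
    Real.fourierInv_eq_fourier_neg, ← SchwartzMap.fourier_coe, FourierTransform.fourier_fourierInv_eq]

lemma isWeilConst_realDiagChar {ε : ι → ℝ} (hε : ∀ i, ε i * ε i = 1) :
    IsWeilConst (realDiagChar ε) (gaussianDiag fun i => -(I * ε i)) (realWeilConst ε) := by
  refine ⟨volume, ⟨inferInstance, fun φ hφ x => ?_⟩, fun φ hφ => ?_⟩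
  · obtain ⟨f, rfl⟩ := hφ.exists_schwartzMap
    exact kernelTransform_realDiagChar_twice hε f x
  · obtain ⟨f, rfl⟩ := hφ.exists_schwartzMap
    have h1 : kernelTransform (realDiagChar ε) volume f =
        (𝓕⁻ f : 𝓢(EuclideanSpace ℝ ι, ℂ)) ∘ signIsometry hε := by
      ext y
      rw [kernelTransform_realDiagChar hε, SchwartzMap.fourierInv_coe]
      rfl
    rw [integral_gaussian_identity hε f.integrable]
    · congr 1
      refine integral_congr_ae (Eventually.of_forall fun x => ?_)
      beta_reduce
      congr 1
      rw [gaussianDiag, gaussianDiag, ← exp_conj]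
      congr 1
      simp
    · rw [h1]
      exact ((signIsometry hε).measurePreserving).integrable_comp_of_integrable
        (𝓕⁻ f : 𝓢(EuclideanSpace ℝ ι, ℂ)).integrable

/-- Otherwise a nowhere vanishing continuous function would be zero almost everywhere. -/
lemma exists_integral_gaussianDiag_ne_zero (b : ι → ℂ)
    (μ : Measure (EuclideanSpace ℝ ι)) [μ.IsAddHaarMeasure] :
    ∃ φ, IsSchwartzBruhat φ ∧ ∫ x, conj (gaussianDiag b x) * φ x ∂μ ≠ 0 := by
  by_contra! hcon
  have h1 := ae_eq_zero_of_integral_contDiff_smul_eq_zero (μ := μ)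
    (f := fun x => conj (gaussianDiag b x))
    (continuous_conj.comp (continuous_gaussianDiag b)).locallyIntegrable
    fun g hg hgs => ?_
  · have h2 : ∀ᵐ x ∂μ, False := h1.mono fun x hx => by
      simp [gaussianDiag] at hx
    rw [eventually_false_iff_eq_bot, ae_eq_bot] at h2
    exact NeZero.ne μ h2
  · have h3 : ContDiff ℝ ∞ fun x => (g x : ℂ) := ofRealCLM.contDiff.comp hg
    have h4 : HasCompactSupport fun x => (g x : ℂ) := hgs.comp_left ofReal_zero
    rw [← hcon _ (isSchwartzBruhat_schwartzMap (h4.toSchwartzMap h3))]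
    refine integral_congr_ae (Eventually.of_forall fun x => ?_)
    change g x • _ = _ * (g x : ℂ)
    rw [real_smul, mul_comm]

lemma isWeilConst_realDiagChar_iff {ε : ι → ℝ} (hε : ∀ i, ε i * ε i = 1) (c : ℂ) :
    IsWeilConst (realDiagChar ε) (gaussianDiag fun i => -(I * ε i)) c ↔ c = realWeilConst ε := by
  constructor
  · intro h
    exact h.unique (fun μ _ => exists_integral_gaussianDiag_ne_zero _ μ) (isWeilConst_realDiagChar hε)
  · rintro rfl
    exact isWeilConst_realDiagChar hε

end RealDiagonal
end Metaplectic

namespace Metaplectic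

/-! ### Reduction of ℝ and ℂ to signs, and transport to isomorphic fields -/

section Archimedean

open Filter Complex

/-- Lift `ψ` through the covering ℝ → Circle. Uniqueness of lifts makes the lift additive, and
continuity makes it linear. -/
lemma exists_linear_lift {A : Type*} [NormedAddCommGroup A] [NormedSpace ℝ A]
    {ψ : AddChar A Circle} (hψ : Continuous ψ) :
    ∃ L : A →L[ℝ] ℝ, ∀ x, ψ x = Circle.exp (2 * Real.pi * L x) := by
  obtain ⟨G, ⟨hG0, hG⟩, -⟩ := Circle.isCoveringMap_exp.existsUnique_continuousMap_lifts
    (⟨ψ, hψ⟩ : C(A, Circle)) 0 0 (by simp)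
  have hGψ : ∀ x, Circle.exp (G x) = ψ x := fun x => congrFun hG x
  have hadd : ∀ x y, G (x + y) = G x + G y := by
    intro x y
    obtain ⟨H, -, hH⟩ := Circle.isCoveringMap_exp.existsUnique_continuousMap_lifts
      (⟨ψ, hψ⟩ : C(A, Circle)) 0 0 (by simp)
    have h1 := hH G ⟨hG0, hG⟩
    have h2 := hH ⟨fun z => G (z + y) - G y, by fun_prop⟩ ⟨by simp, by
      ext z
      simp [Circle.exp_sub, hGψ, AddChar.map_add_eq_mul]⟩
    have h3 := congrArg (fun g : C(A, ℝ) => g x) (h2.trans h1.symm)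
    simp only [ContinuousMap.coe_mk] at h3
    linarith
  let T : A →+ ℝ := AddMonoidHom.mk' G hadd
  refine ⟨(2 * Real.pi)⁻¹ • T.toRealLinearMap G.continuous, fun x => ?_⟩
  rw [← hGψ]
  congr 1
  change G x = 2 * Real.pi * ((2 * Real.pi)⁻¹ * G x)
  rw [mul_inv_cancel_left₀ (by positivity)]

lemma cpow_half_mul_neg {ε : ℝ} (hε : ε * ε = 1) :
    (I * ε) ^ (1 / 2 : ℂ) * (-(I * ε)) ^ (1 / 2 : ℂ) = 1 := by
  have h3 : (ε : ℂ) * ε = 1 := by exact_mod_cast hε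
  have h0 : ε ≠ 0 := fun h => by simp [h] at hε
  have h1 : -(I * ε) = (I * ε)⁻¹ := by
    refine (inv_eq_of_mul_eq_one_right ?_).symm
    linear_combination (-(ε : ℂ) * ε) * I_mul_I + h3
  have harg : (I * ε).arg ≠ Real.pi := by
    rw [Ne, arg_eq_pi_iff]
    simp
  rw [h1, inv_cpow _ _ harg, mul_inv_cancel₀]
  rw [Ne, cpow_eq_zero_iff]
  simp [h0]

lemma exists_isDiagSymbol_real {ψ : AddChar ℝ Circle} (hψ : Continuous ψ) (hψ1 : ψ ≠ 1) :
    ∃ γ₁, IsDiagSymbol ψ γ₁ := by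
  obtain ⟨L, hL⟩ := exists_linear_lift hψ
  let s := L 1
  have hs : ∀ x, ψ x = Circle.exp (2 * Real.pi * (s * x)) := by
    intro x
    rw [hL, show L x = s * x by
      rw [show L x = L (x • 1) by simp, map_smul, smul_eq_mul, mul_comm]]
  have hs0 : s ≠ 0 := by
    intro h0
    refine hψ1 (DFunLike.ext _ _ fun x => ?_)
    simp [hs, h0]
  -- Rescaling each coordinate by √|s·aᵢ| leaves only the sign of s·aᵢ.
  let ε : ℝ → ℝ := fun a => (SignType.sign (s * a) : ℝ)
  have hε : ∀ a, a ≠ 0 → ε a * ε a = 1 := by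
    intro a ha
    rcases (mul_ne_zero hs0 ha).lt_or_gt with h | h <;> simp [ε, h]
  refine ⟨fun a => if a = 0 then 1 else (I * ε a) ^ (1 / 2 : ℂ), by simp, fun a => ?_,
    fun n a ha c => ?_⟩
  · by_cases ha : a = 0
    · simp [ha]
    beta_reduce
    have h1 : ε (-a) = -ε a := by simp [ε, Left.sign_neg]
    rw [if_neg ha, if_neg (neg_ne_zero.2 ha), h1, ofReal_neg, mul_neg]
    exact cpow_half_mul_neg (hε a ha)
  · have hprod : ∏ i, (if a i = 0 then 1 else (I * ε (a i)) ^ (1 / 2 : ℂ)) =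
        realWeilConst fun i => ε (a i) :=
      Finset.prod_congr rfl fun i _ => if_neg (ha i)
    rw [hprod, ← isWeilConst_realDiagChar_iff fun i => hε (a i) (ha i)]
    have hborel : borel (Fin n → ℝ) = MeasurableSpace.pi :=
      (BorelSpace.measurable_eq (α := Fin n → ℝ)).symm
    change @IsWeilConst _ _ _ (borel (Fin n → ℝ)) _ _ c ↔ _
    rw [hborel]
    have hr : ∀ i, √|s * a i| ≠ 0 := fun i =>
      (Real.sqrt_pos.2 (abs_pos.2 (mul_ne_zero hs0 (ha i)))).ne'
    have hr2 : ∀ i, ε (a i) * √|s * a i| * √|s * a i| = s * a i := by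
      intro i
      rw [mul_assoc, Real.mul_self_sqrt (abs_nonneg _)]
      exact sign_mul_abs _
    let E : (Fin n → ℝ) ≃ₜ+ EuclideanSpace ℝ (Fin n) :=
      { toFun x := WithLp.toLp 2 fun i => √|s * a i| * x i
        invFun x := fun i => (√|s * a i|)⁻¹ * x i
        left_inv x := by
          ext i
          exact inv_mul_cancel_left₀ (hr i) _
        right_inv x := by
          ext i
          exact mul_inv_cancel_left₀ (hr i) _
        map_add' x y := by
          ext i
          exact mul_add _ _ _
        continuous_toFun := by fun_prop
        continuous_invFun := by fun_prop }
    have hE : ∀ x i, E x i = √|s * a i| * x i := fun _ _ => rfl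
    refine isWeilConst_comp_iff E (fun x y => ?_) fun x => ?_
    · rw [diagChar, hs, realDiagChar, Circle.coe_exp, Finset.mul_sum]
      congr 4
      refine Finset.sum_congr rfl fun i _ => ?_
      rw [hE, hE]
      linear_combination (- x i * y i) * hr2 i
    · rw [diagQuad, hs, gaussianDiag, Circle.coe_exp]
      congr 1
      push_cast
      simp only [Finset.mul_sum, Finset.sum_mul]
      refine Finset.sum_congr rfl fun i _ => ?_
      have h4 : (ε (a i) : ℂ) * √|s * a i| * √|s * a i| = s * a i := by exact_mod_cast hr2 i
      rw [hE]
      push_cast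
      linear_combination (- x i ^ 2 * Real.pi * I) * h4

lemma exists_isDiagSymbol_complex {ψ : AddChar ℂ Circle} (hψ : Continuous ψ) (hψ1 : ψ ≠ 1) :
    ∃ γ₁, IsDiagSymbol ψ γ₁ := by
  obtain ⟨L, hL⟩ := exists_linear_lift hψ
  let β : ℂ := ⟨L 1, -L I⟩
  have hs : ∀ z, ψ z = Circle.exp (2 * Real.pi * (β * z).re) := by
    intro z
    rw [hL, show L z = (β * z).re by
      rw [show L z = L (z.re • 1 + z.im • I) by simp, map_add, map_smul, map_smul, mul_re]
      simp only [smul_eq_mul, β]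
      ring]
  have hβ0 : β ≠ 0 := by
    intro h0
    refine hψ1 (DFunLike.ext _ _ fun x => ?_)
    simp [hs, h0]
  -- Over ℂ every line splits as a real plane with form Re(z²) = x² - y², whose two constants
  -- cancel.
  refine ⟨fun _ => 1, rfl, fun a => one_mul _, fun n a ha c => ?_⟩
  let ε : Fin n ⊕ Fin n → ℝ := Sum.elim (fun _ => 1) fun _ => -1
  have hε : ∀ i, ε i * ε i = 1 := by rintro (i | i) <;> simp [ε]
  have hprod : ∏ i : Fin n, (1 : ℂ) = realWeilConst ε := by
    rw [realWeilConst, Fintype.prod_sum_type, ← Finset.prod_mul_distrib]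
    refine Finset.prod_congr rfl fun i _ => ?_
    simpa [ε] using (cpow_half_mul_neg (ε := 1) (by norm_num)).symm
  rw [hprod, ← isWeilConst_realDiagChar_iff hε]
  let : MeasurableSpace (Fin n → ℂ) := borel _
  have : BorelSpace (Fin n → ℂ) := ⟨rfl⟩
  -- A square root of β·aᵢ brings each coordinate to the standard form Re(z²).
  choose ρ hρ using fun i => IsAlgClosed.exists_pow_nat_eq (β * a i) two_pos
  have hρ0 : ∀ i, ρ i ≠ 0 := fun i h => mul_ne_zero hβ0 (ha i) (by rw [← hρ, h]; simp)
  let E : (Fin n → ℂ) ≃ₜ+ EuclideanSpace ℝ (Fin n ⊕ Fin n) :=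
    { toFun x := WithLp.toLp 2 (Sum.elim (fun i => (ρ i * x i).re) fun i => (ρ i * x i).im)
      invFun x := fun i => (ρ i)⁻¹ * (x (Sum.inl i) + x (Sum.inr i) * I)
      left_inv x := by
        ext i
        change (ρ i)⁻¹ * ((ρ i * x i).re + (ρ i * x i).im * I) = x i
        rw [re_add_im, inv_mul_cancel_left₀ (hρ0 i)]
      right_inv x := by
        ext (i | i)
        · change (ρ i * ((ρ i)⁻¹ * (x (Sum.inl i) + x (Sum.inr i) * I))).re = _
          rw [mul_inv_cancel_left₀ (hρ0 i)]
          simp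
        · change (ρ i * ((ρ i)⁻¹ * (x (Sum.inl i) + x (Sum.inr i) * I))).im = _
          rw [mul_inv_cancel_left₀ (hρ0 i)]
          simp
      map_add' x y := by
        ext (i | i) <;> simp [mul_add]
      continuous_toFun := by
        refine (PiLp.continuous_toLp 2 _).comp (continuous_pi ?_)
        rintro (i | i) <;> simp only [Sum.elim_inl, Sum.elim_inr] <;> fun_prop
      continuous_invFun := by fun_prop }
  have hE1 : ∀ x i, E x (Sum.inl i) = (ρ i * x i).re := fun _ _ => rfl
  have hE2 : ∀ x i, E x (Sum.inr i) = (ρ i * x i).im := fun _ _ => rfl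
  have key : ∀ x y : Fin n → ℂ, (β * ∑ i, a i * x i * y i).re = ∑ i, ε i * E x i * E y i := by
    intro x y
    rw [Fintype.sum_sum_type, ← Finset.sum_add_distrib, Finset.mul_sum, re_sum]
    refine Finset.sum_congr rfl fun i _ => ?_
    rw [show β * (a i * x i * y i) = (ρ i * x i) * (ρ i * y i) by
      linear_combination (- x i * y i) * hρ i, mul_re]
    simp only [ε, hE1, hE2, Sum.elim_inl, Sum.elim_inr]
    ring
  refine isWeilConst_comp_iff E (fun x y => ?_) fun x => ?_
  · rw [diagChar, hs, realDiagChar, Circle.coe_exp, key]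
  · rw [diagQuad, hs, gaussianDiag, Circle.coe_exp, mul_left_comm,
      show (2 : ℂ)⁻¹ = ((2⁻¹ : ℝ) : ℂ) by push_cast; rfl, re_ofReal_mul, key]
    congr 1
    push_cast
    simp only [Finset.mul_sum, Finset.sum_mul]
    refine Finset.sum_congr rfl fun i _ => ?_
    ring

lemma IsDiagSymbol.comp {F K : Type*} [Field F] [TopologicalSpace F] [IsTopologicalRing F]
    [Field K] [TopologicalSpace K] [IsTopologicalRing K] (e : F ≃+* K) (he : IsHomeomorph e)
    {ψ : AddChar F Circle} {ψ' : AddChar K Circle} (hψ : ∀ x, ψ x = ψ' (e x)) {γ₁ : K → ℂ}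
    (h : IsDiagSymbol ψ' γ₁) : IsDiagSymbol ψ fun a => γ₁ (e a) := by
  refine ⟨by simp [h.1], fun a => by simp [h.2.1], fun n a ha c => ?_⟩
  rw [← h.2.2 n (fun i => e (a i)) fun i => (map_ne_zero e).2 (ha i)]
  let : MeasurableSpace (Fin n → F) := borel _
  have : BorelSpace (Fin n → F) := ⟨rfl⟩
  let : MeasurableSpace (Fin n → K) := borel _
  have : BorelSpace (Fin n → K) := ⟨rfl⟩
  have he' : Continuous e.symm := (e.toEquiv.toHomeomorphOfIsInducing he.isInducing).symm.continuous
  let E : (Fin n → F) ≃ₜ+ (Fin n → K) :=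
    { toFun x := fun i => e (x i)
      invFun x := fun i => e.symm (x i)
      left_inv x := by ext; simp
      right_inv x := by ext; simp
      map_add' x y := by ext; simp
      continuous_toFun := by have := he.continuous; fun_prop
      continuous_invFun := by fun_prop }
  have hE : ∀ x i, E x i = e (x i) := fun _ _ => rfl
  refine isWeilConst_comp_iff E (fun x y => ?_) fun x => ?_
  · simp only [diagChar, hψ, map_sum, map_mul, hE]
  · simp only [diagQuad, hψ, map_sum, map_mul, hE, map_inv₀, map_ofNat]

lemma exists_isDiagSymbol_of_homeomorph {F K : Type*} [Field F] [TopologicalSpace F]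
    [IsTopologicalRing F] [Field K] [TopologicalSpace K] [IsTopologicalRing K] (e : F ≃+* K)
    (he : IsHomeomorph e)
    (hK : ∀ {ψ : AddChar K Circle}, Continuous ψ → ψ ≠ 1 → ∃ γ₁, IsDiagSymbol ψ γ₁)
    {ψ : AddChar F Circle} (hψ : Continuous ψ) (hψ1 : ψ ≠ 1) : ∃ γ₁, IsDiagSymbol ψ γ₁ := by
  have he' : Continuous e.symm := (e.toEquiv.toHomeomorphOfIsInducing he.isInducing).symm.continuous
  let ψ' : AddChar K Circle := ψ.compAddMonoidHom e.symm.toAddMonoidHom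
  have h1 : ∀ x, ψ x = ψ' (e x) := fun x => congrArg ψ (e.symm_apply_apply x).symm
  obtain ⟨γ, hγ⟩ := hK (ψ := ψ') (hψ.comp he') fun h => hψ1 (DFunLike.ext _ _ fun x => by
    rw [h1, h]; rfl)
  exact ⟨_, hγ.comp e he h1⟩

end Archimedean

theorem IsLocalOrFinite.exists_isDiagSymbol {F : Type*} [Field F] [TopologicalSpace F]
    [IsTopologicalRing F] (hF : IsLocalOrFinite F) (h2 : (2 : F) ≠ 0) {ψ : AddChar F Circle}
    (hψ : Continuous ψ) (hψ1 : ψ ≠ 1) : ∃ γ₁, IsDiagSymbol ψ γ₁ := by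
  have hn := hF.isNiceField h2
  have := hn.t2
  have := hn.locallyCompact
  have := hn.secondCountable
  rcases hF with ⟨_, _⟩ | ⟨e, he⟩ | ⟨e, he⟩ | ⟨_, _⟩
  · exact (isBaseLattice_of_finite hψ1).exists_isDiagSymbol hψ h2
  · exact exists_isDiagSymbol_of_homeomorph e he exists_isDiagSymbol_real hψ hψ1
  · exact exists_isDiagSymbol_of_homeomorph e he exists_isDiagSymbol_complex hψ hψ1
  · obtain ⟨N, N', hN⟩ := exists_isBaseLattice_of_nonarchimedean h2 hψ hψ1
    exact hN.exists_isDiagSymbol hψ h2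

end Metaplectic
end

theorem mainTheorem6 {F : Type*} [Field F] [TopologicalSpace F] [IsTopologicalRing F]
    (hF : Metaplectic.IsLocalOrFinite F) (hF2 : (2 : F) ≠ 0)
    (ψ : AddChar F Circle) (hψ_cont : Continuous ψ) (hψ : ψ ≠ 1)
    {V : Type*} [AddCommGroup V] [Module F V] [FiniteDimensional F V]
    (ω : Metaplectic.SymplecticForm F V) :
    (∀ (ℓ ℓ' : Metaplectic.Gr ω) (x : Metaplectic.Mp ψ ω),
      Metaplectic.Theta ℓ x = Metaplectic.Theta ℓ' x) ∧
    (∀ ℓ : Metaplectic.Gr ω,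
      IsLocallyConstant (fun x : Metaplectic.MpReg ψ ω => Metaplectic.Theta ℓ x.1)) := by
  obtain ⟨γ₁, hγ⟩ := hF.exists_isDiagSymbol hF2 hψ_cont hψ
  have h := hγ.isWeilSymbol
  have hn := hF.isNiceField hF2
  have := hn.continuousInv
  exact ⟨fun ℓ ℓ' x => h.Theta_eq hF2 ℓ ℓ' x,
    fun ℓ => h.isLocallyConstant_Theta hF2 hn.squares ℓ⟩
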